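/- Let $T>0$, $\rho>0$, $r>0$, let $W$ be a standard Brownian motion and let $X=(X_t)_{t\in[0,T]}$, $X_t=\int_0^t\psi(t-s)\,dW_s$ with $\psi(t)=t^{\rho-1/2}$, be the Riemann–Liouville process of order $\rho$ (in its pathwise continuous version), viewed as a random vector in $E=\mathcal C([0,T])$ with the supremum norm $\|\cdot\|$. Definitions. An $N$-quantization is a random vector taking at most $N$ values; it is $L^r$-optimal for $Y$ if it minimizes $(\mathbb E\|Y-\widehat Y\|^r)^{1/r}$ among all $N$-quantizations $\widehat Y$. Let $\xi_1,\xi_2,\dots$ be i.i.d. $\mathcal N(0,1)$. A sequence $(f_j)_{j\ge1}$ in $E$ is admissible for $X$ if $\sum_j\xi_jf_j$ converges a.s. in $E$ and has the law of $X$. A product quantization with respect to $(f_j)$ with levels $N_1,\dots,N_m\ge1$ ($m\ge1$) is $\widehat X=\sum_{j=1}^m\widehat\xi_jf_j$ with $\widehat\xi_j$ an $L^r$-optimal $N_j$-quantization of $\xi_j$; it is a product $N$-quantization if $\prod_jN_j\le N$. The error $e^{(\mathrm{prod})}_{N,r}(X)$ is the infimum of $(\mathbb E\|\sum_j\xi_jf_j-\widehat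 X\|^r)^{1/r}$ over all admissible $(f_j)$ and all product $N$-quantizations $\widehat X$ with respect to $(f_j)$. Let $\lambda_j=(\pi(j-1/2)/T)^{-2}$ and $$f_j(t)=\sqrt{2/T}\int_0^t\psi(s)\cos\big((t-s)/\sqrt{\lambda_j}\big)\,ds,\qquad j\ge1 .$$ Claim. The sequence $(f_j)$ is admissible for $X$, and the following holds. (a) If $0<\rho\le 3/2$, then $$e^{(\mathrm{prod})}_{N,r}(X)=O\Big(\frac{(\log\log N)^{\rho+1/2}}{(\log N)^{\rho}}\Big)\qquad(N\to\infty),$$ and this rate is attained by product $N$-quantizations with respect to the cosine sequence $(f_j)$: there are a constant $C$ and, for all large $N$, levels $N_1,\dots,N_m$ with $\prod_jN_j\le N$ such that product quantizations with respect to $(f_j)$ with these levels exist and all of them have error at most $C(\log\log N)^{\rho+1/2}/(\log N)^\rho$. (b) If $\rho>3/2$, let $n\ge1$ be the integer with $2n-1/2<\rho\le 2n+3/2$. Then $f_j=g_j+h_j$ with $$g_j=\sum_{m=1}^n(-1)^{m-1}\lambda_j^m\sqrt{2/T}\,\psi^{(2m-1)},\qquad h_j(t)=(-1)^n\lambda_j^n\sqrt{2/T}\int_0^t\psi^{(2n)}(s)\cos\big((t-s)/\sqrt{\lambda_j}\big)\,ds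 .$$ With $\eta_m=\sum_j\lambda_j^m\xi_j$, the series $\sum_j\xi_jg_j$ converges a.s. in $E$ to $U:=\sum_{m=1}^n(-1)^{m-1}\sqrt{2/T}\,\psi^{(2m-1)}\eta_m$, the series $Z:=\sum_j\xi_jh_j$ converges a.s. in $E$, and $U+Z$ has the law of $X$. The same rate holds for the modified product quantization $$\widehat X=\sum_{m=1}^n(-1)^{m-1}\sqrt{2/T}\,\psi^{(2m-1)}\widehat\eta_m+\widehat Z,$$ where $\widehat\eta_m$ is an $L^r$-optimal $\lfloor N^{1/(2n)}\rfloor$-quantization of $\eta_m$ and $\widehat Z$ is a product $\lfloor\sqrt N\rfloor$-quantization with respect to $(h_j)$: there are a constant $C$ and, for all large $N$, levels $N_1,\dots,N_p$ with $\prod_jN_j\le\lfloor\sqrt N\rfloor$ such that $\widehat X$ of this form, with $\widehat Z$ having these levels, exist, and every such $\widehat X$ takes at most $N$ values and satisfies $$\big(\mathbb E\|U+Z-\widehat X\|^r\big)^{1/r}\le C\,\frac{(\log\log N)^{\rho+1/2}}{(\log N)^{\rho}} .$$ -/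

import Mathlib

open MeasureTheory ProbabilityTheory Filter Topology
open scoped NNReal ENNReal

noncomputable section

/-! ### Quantization of random vectors -/

/-- `Y` is an `N`-quantization: a random vector taking at most `N` values. -/
def IsQuantization {Ω E : Type*} [MeasurableSpace Ω] [MeasurableSpace E]
    (N : ℕ) (Y : Ω → E) : Prop :=
  Measurable Y ∧ (Set.range Y).encard ≤ N

/-- The quantization error `(𝔼 ‖X - Y‖ ^ r) ^ (1 / r)`, with value in `[0, ∞]`, for `0 < r < ∞`. -/
def quantizationError {Ω E : Type*} [MeasurableSpace Ω] [NormedAddCommGroup E]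
    (P : Measure Ω) (r : ℝ) (X Y : Ω → E) : ℝ≥0∞ :=
  eLpNorm (fun ω => X ω - Y ω) (ENNReal.ofReal r) P

/-- The minimal level-`N` quantization error `e_{N,r}(X, E)`. -/
def minimalQuantizationError {Ω E : Type*} [MeasurableSpace Ω] [NormedAddCommGroup E]
    [MeasurableSpace E] (P : Measure Ω) (N : ℕ) (r : ℝ) (X : Ω → E) : ℝ≥0∞ :=
  ⨅ (Y : Ω → E) (_ : IsQuantization N Y), quantizationError P r X Y

/-- `Y` is an `L^r`-optimal `N`-quantization of `X`. -/
def IsOptimalQuantization {Ω E : Type*} [MeasurableSpace Ω] [NormedAddCommGroup E]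
    [MeasurableSpace E] (P : Measure Ω) (N : ℕ) (r : ℝ) (X Y : Ω → E) : Prop :=
  IsQuantization N Y ∧ quantizationError P r X Y = minimalQuantizationError P N r X

/-! ### Admissible sequences and product quantization -/

/-- The law of an i.i.d. sequence of standard normal variables; the coordinates
`ξ_j = (fun ω => ω j)` on `(ℕ → ℝ, gaussianSequence)` are such a sequence
(indexed from `0` instead of `1`). -/
def gaussianSequence : Measure (ℕ → ℝ) := Measure.infinitePi fun _ => gaussianReal 0 1

/-- Almost sure convergence in `E` of the random series `∑ ξ_j f_j`. -/
def GaussianSeriesConverges {E : Type*} [NormedAddCommGroup E] [NormedSpace ℝ E]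
    (f : ℕ → E) : Prop :=
  ∀ᵐ ω ∂gaussianSequence,
    ∃ x : E, Tendsto (fun n => ∑ j ∈ Finset.range n, ω j • f j) atTop (𝓝 x)

/-- The sum `∑ ξ_j f_j`, meaningful at those `ω` at which the series converges. -/
def gaussianSeries {E : Type*} [NormedAddCommGroup E] [NormedSpace ℝ E]
    (f : ℕ → E) (ω : ℕ → ℝ) : E :=
  limUnder atTop (fun n => ∑ j ∈ Finset.range n, ω j • f j)

/-- `(f_j)` is admissible for a random vector with law `μ`: the series `∑ ξ_j f_j` converges
almost surely and has law `μ`. -/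
def IsAdmissible {E : Type*} [NormedAddCommGroup E] [NormedSpace ℝ E] [MeasurableSpace E]
    (f : ℕ → E) (μ : Measure E) : Prop :=
  GaussianSeriesConverges f ∧ gaussianSequence.map (gaussianSeries f) = μ

/-- `Xh = ∑_{j < p} ξh_j f_j`, where `ξh_j` is an `L^r`-optimal `L j`-quantization of `ξ_j`. -/
def IsProductQuantization {E : Type*} [NormedAddCommGroup E] [NormedSpace ℝ E]
    (r : ℝ) (f : ℕ → E) {p : ℕ} (L : Fin p → ℕ) (Xh : (ℕ → ℝ) → E) : Prop :=
  ∃ ξh : Fin p → (ℕ → ℝ) → ℝ,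
    (∀ j, IsOptimalQuantization gaussianSequence (L j) r (fun ω => ω j) (ξh j)) ∧
    Xh = fun ω => ∑ j, ξh j ω • f j

/-- Levels `N_1, …, N_p ≥ 1` (with `p ≥ 1`) of total size `∏ N_j ≤ N`. -/
def IsLevelAllocation (N : ℕ) {p : ℕ} (L : Fin p → ℕ) : Prop :=
  1 ≤ p ∧ (∀ j, 1 ≤ L j) ∧ ∏ j, L j ≤ N

/-- The minimal `N`-th product quantization error `e^{(prod)}_{N,r}(X, E)` of a random vector `X`
with law `μ`. -/
def minimalProductQuantizationError {E : Type*} [NormedAddCommGroup E] [NormedSpace ℝ E]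
    [MeasurableSpace E] (N : ℕ) (r : ℝ) (μ : Measure E) : ℝ≥0∞ :=
  sInf {e | ∃ f : ℕ → E, IsAdmissible f μ ∧
    ∃ (p : ℕ) (L : Fin p → ℕ) (Xh : (ℕ → ℝ) → E),
      IsLevelAllocation N L ∧ IsProductQuantization r f L Xh ∧
      e = quantizationError gaussianSequence r (gaussianSeries f) Xh}

/-! ### Riemann–Liouville processes -/

/-- `Y = ∫_0^t g(s) dW_s` (Wiener integral of a deterministic `g ∈ L²(0,t)`): `Y` is the `L²`-limit
of `∑ c_i (W_{b_i} - W_{a_i})` along step functions `∑ c_i 1_{(a_i, b_i]}` that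
converge to `g` in `L²(0,t)`. -/
def IsWienerIntegral {Ω : Type*} [MeasurableSpace Ω] (P : Measure Ω) (W : ℝ≥0 → Ω → ℝ)
    (t : ℝ≥0) (g : ℝ → ℝ) (Y : Ω → ℝ) : Prop :=
  AEMeasurable Y P ∧ ∀ ε : ℝ≥0∞, 0 < ε →
    ∃ (q : ℕ) (c : Fin q → ℝ) (a b : Fin q → ℝ≥0), (∀ i, a i ≤ b i ∧ b i ≤ t) ∧
      eLpNorm (fun s : ℝ => g s -
          ∑ i, (Set.Ioc (a i : ℝ) (b i : ℝ)).indicator (fun _ => c i) s) 2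
        (volume.restrict (Set.Ioc 0 (t : ℝ))) ≤ ε ∧
      eLpNorm (fun ω => Y ω - ∑ i, c i * (W (b i) ω - W (a i) ω)) 2 P ≤ ε

/-- The path space `C([0,T])`; its norm is the supremum norm. -/
abbrev PathSpace (T : ℝ) : Type := C(Set.Icc (0 : ℝ) T, ℝ)

instance pathSpaceMeasurableSpace (T : ℝ) : MeasurableSpace (PathSpace T) := borel _

instance pathSpaceBorelSpace (T : ℝ) : BorelSpace (PathSpace T) := ⟨rfl⟩

/-- `ψ(t) = t ^ (ρ - 1/2)`. -/
def rlKernel (ρ : ℝ) (t : ℝ) : ℝ := t ^ (ρ - 1 / 2)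

/-- `X` is a (pathwise continuous) Riemann–Liouville process of order `ρ` on `[0,T]` driven by `W`:
`X_t = ∫_0^t (t-s)^(ρ-1/2) dW_s` almost surely, for every `t ∈ [0,T]`. -/
def IsRiemannLiouville {Ω : Type*} [MeasurableSpace Ω] (P : Measure Ω) (W : ℝ≥0 → Ω → ℝ)
    (ρ T : ℝ) (X : Ω → PathSpace T) : Prop :=
  Measurable X ∧ ∀ t : Set.Icc (0 : ℝ) T,
    IsWienerIntegral P W (Real.toNNReal t) (fun s => rlKernel ρ (t - s)) (fun ω => X ω t)

theorem iteratedDeriv_rlKernel (ρ : ℝ) (i : ℕ) :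
    iteratedDeriv i (rlKernel ρ) =
      fun x => (descPochhammer ℝ i).eval (ρ - 1 / 2) * x ^ (ρ - 1 / 2 - i) := by
  funext x
  rw [iteratedDeriv_eq_iterate]
  exact Real.iter_deriv_rpow_const _ _ _

theorem continuous_iteratedDeriv_rlKernel (ρ : ℝ) (i : ℕ) (h : (i : ℝ) ≤ ρ - 1 / 2) :
    Continuous (iteratedDeriv i (rlKernel ρ)) := by
  rw [iteratedDeriv_rlKernel]
  exact continuous_const.mul (Real.continuous_rpow_const (by linarith))

theorem intervalIntegrable_iteratedDeriv_rlKernel (ρ : ℝ) (i : ℕ) (h : (i : ℝ) < ρ + 1 / 2)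
    (a b : ℝ) : IntervalIntegrable (iteratedDeriv i (rlKernel ρ)) volume a b := by
  rw [iteratedDeriv_rlKernel]
  exact (intervalIntegral.intervalIntegrable_rpow' (by linarith)).const_mul _

/-! ### The cosine expansion and its splitting -/

theorem continuous_cosineConvolution (ψ : ℝ → ℝ)
    (hψ : ∀ a b : ℝ, IntervalIntegrable ψ volume a b) (c : ℝ) :
    Continuous fun t : ℝ => ∫ s in (0 : ℝ)..t, ψ s * Real.cos ((t - s) * c) := by
  have hC : ∀ a b : ℝ, IntervalIntegrable (fun s => ψ s * Real.cos (s * c)) volume a b :=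
    fun a b => (hψ a b).mul_continuousOn (by fun_prop)
  have hS : ∀ a b : ℝ, IntervalIntegrable (fun s => ψ s * Real.sin (s * c)) volume a b :=
    fun a b => (hψ a b).mul_continuousOn (by fun_prop)
  have key : (fun t : ℝ => ∫ s in (0 : ℝ)..t, ψ s * Real.cos ((t - s) * c)) = fun t =>
      Real.cos (t * c) * (∫ s in (0 : ℝ)..t, ψ s * Real.cos (s * c)) +
        Real.sin (t * c) * ∫ s in (0 : ℝ)..t, ψ s * Real.sin (s * c) := by
    funext t
    rw [← intervalIntegral.integral_const_mul, ← intervalIntegral.integral_const_mul,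
      ← intervalIntegral.integral_add ((hC 0 t).const_mul _) ((hS 0 t).const_mul _)]
    refine intervalIntegral.integral_congr fun s _ => ?_
    simp only [sub_mul, Real.cos_sub]
    ring
  rw [key]
  have h1 := intervalIntegral.continuous_primitive hC 0
  have h2 := intervalIntegral.continuous_primitive hS 0
  fun_prop

/-- The path `t ↦ ∫_0^t ψ(s) cos(c (t - s)) ds`. -/
def cosineConvolution (T : ℝ) (ψ : ℝ → ℝ)
    (hψ : ∀ a b : ℝ, IntervalIntegrable ψ volume a b) (c : ℝ) : PathSpace T where
  toFun t := ∫ s in (0 : ℝ)..(t : ℝ), ψ s * Real.cos (((t : ℝ) - s) * c)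
  continuous_toFun := (continuous_cosineConvolution ψ hψ c).comp continuous_subtype_val

/-- The frequency `1 / √λ_j = π (j - 1/2) / T`, where `j ≥ 1` is indexed here from `0`. -/
def cosineFrequency (T : ℝ) (j : ℕ) : ℝ := Real.pi * (j + 1 / 2) / T

/-- `λ_j = (π (j - 1/2) / T)^(-2)`, where `j ≥ 1` is indexed here from `0`. -/
def cosineEigenvalue (T : ℝ) (j : ℕ) : ℝ := (cosineFrequency T j ^ 2)⁻¹

theorem intervalIntegrable_rlKernel (ρ : ℝ) (hρ : 0 < ρ) (a b : ℝ) :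
    IntervalIntegrable (rlKernel ρ) volume a b :=
  intervalIntegral.intervalIntegrable_rpow' (by linarith)

/-- The cosine sequence of the Riemann–Liouville process,
`f_j(t) = √(2/T) ∫_0^t ψ(s) cos(π (j - 1/2) (t - s) / T) ds`. -/
def cosineSequence (T ρ : ℝ) (hρ : 0 < ρ) (j : ℕ) : PathSpace T :=
  √(2 / T) • cosineConvolution T (rlKernel ρ) (intervalIntegrable_rlKernel ρ hρ)
    (cosineFrequency T j)

/-- The remainder `h_j(t) = (-1)^n λ_j^n √(2/T) ∫_0^t ψ^{(2n)}(s) cos((t - s) / √λ_j) ds`. -/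
def cosineRemainder (T ρ : ℝ) (n : ℕ) (hn : 2 * (n : ℝ) < ρ + 1 / 2) (j : ℕ) : PathSpace T :=
  ((-1) ^ n * cosineEigenvalue T j ^ n * √(2 / T)) •
    cosineConvolution T (iteratedDeriv (2 * n) (rlKernel ρ))
      (intervalIntegrable_iteratedDeriv_rlKernel ρ (2 * n) (by push_cast; exact hn))
      (cosineFrequency T j)

/-- The path `(-1)^(m-1) √(2/T) ψ^{(2m-1)}`, `1 ≤ m ≤ n`, where `m` is indexed here from `0`. -/
def boundaryPath (T ρ : ℝ) (n : ℕ) (hn : 2 * (n : ℝ) < ρ + 1 / 2) (m : Fin n) : PathSpace T :=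
  ((-1) ^ (m : ℕ) * √(2 / T)) •
    { toFun := fun t => iteratedDeriv (2 * (m : ℕ) + 1) (rlKernel ρ) t
      continuous_toFun := (continuous_iteratedDeriv_rlKernel ρ (2 * (m : ℕ) + 1) (by
        have h : ((m : ℕ) : ℝ) + 1 ≤ n := by exact_mod_cast m.2
        push_cast
        linarith)).comp continuous_subtype_val }

/-- The boundary terms `g_j = ∑_{m=1}^n (-1)^(m-1) λ_j^m √(2/T) ψ^{(2m-1)}`. -/
def cosineBoundary (T ρ : ℝ) (n : ℕ) (hn : 2 * (n : ℝ) < ρ + 1 / 2) (j : ℕ) : PathSpace T :=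
  ∑ m : Fin n, cosineEigenvalue T j ^ ((m : ℕ) + 1) • boundaryPath T ρ n hn m

/-- `η_m = ∑_j λ_j^m ξ_j`, where `m ≥ 1` is indexed here from `0`. -/
def boundaryCoefficient (T : ℝ) (m : ℕ) (ω : ℕ → ℝ) : ℝ :=
  ∑' j, cosineEigenvalue T j ^ (m + 1) * ω j

/-- The finite-dimensional part `U = ∑_{m=1}^n (-1)^(m-1) √(2/T) ψ^{(2m-1)} η_m`. -/
def finiteDimensionalPart (T ρ : ℝ) (n : ℕ) (hn : 2 * (n : ℝ) < ρ + 1 / 2) (ω : ℕ → ℝ) :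
    PathSpace T :=
  ∑ m : Fin n, boundaryCoefficient T m ω • boundaryPath T ρ n hn m

/-- The modified product quantization `Xh = Uh + Zh` of `X = U + Z`, with
`Uh = ∑_{m=1}^n (-1)^(m-1) √(2/T) ψ^{(2m-1)} ηh_m`, where `ηh_m` is an `L^r`-optimal
`M`-quantization of `η_m`, and `Zh` is the `L^r`-product quantization of `Z = ∑ ξ_j h_j` with
respect to `(h_j)` with levels `L`. -/
def IsModifiedProductQuantization (T ρ : ℝ) (n : ℕ) (hn : 2 * (n : ℝ) < ρ + 1 / 2) (r : ℝ)
    (M : ℕ) {p : ℕ} (L : Fin p → ℕ) (Xh : (ℕ → ℝ) → PathSpace T) : Prop :=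
  ∃ (ηh : Fin n → (ℕ → ℝ) → ℝ) (Zh : (ℕ → ℝ) → PathSpace T),
    (∀ m : Fin n,
      IsOptimalQuantization gaussianSequence M r (boundaryCoefficient T m) (ηh m)) ∧
    IsProductQuantization r (cosineRemainder T ρ n hn) L Zh ∧
    Xh = fun ω => (∑ m : Fin n, ηh m ω • boundaryPath T ρ n hn m) + Zh ω

/-- The rate `(log log N)^(ρ + 1/2) / (log N)^ρ`. -/
def rlRate (ρ : ℝ) (N : ℕ) : ℝ :=
  Real.log (Real.log N) ^ (ρ + 1 / 2) / Real.log N ^ ρ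

end

/-!
Put `b = ρ - 1/2 - 2n`, so that `ψ^{(2n)}` is a multiple of `s ^ b` with `-1 < b ≤ 1`. In this range
`∫_0^t s^b cos(c (t - s)) ds = O(c^{-(b + 1)})` uniformly in `t`: for `b ≤ 0` the part `s ≤ 1/c` is
bounded trivially and an integration by parts handles the rest, and for `b > 0` an integration by parts
without boundary terms reduces `b` to `b - 1`. Together with the factor `λ_j^n`, which is of
order `j^{-2n}`, this gives `‖h_j‖ = O(j^{-(ρ + 1/2)})`; the boundary terms `g_j` are what `2n`
integrations by parts split off (`cosineSequence_eq_add`, `exists_norm_cosineRemainder_le`). For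
`ρ ≤ 3/2` one has `n = 0`, there is no boundary term and `h_j = f_j`.

The rate holds for every sequence of paths of norm `O(j^{-(ρ + 1/2)})` whose Hölder constants grow at
most linearly (`exists_product_quantization_rate`). A partial sum of the dyadic block
`2^k ≤ j < 2^{k+1}` of `∑ ξ_j f_j` is, at each time, Gaussian of variance `O(2^{-2ρk})`. Only
`2^{O(k)}` partial sums and grid points matter, so the maximal inequality for Gaussian variables
bounds the whole block by `O(2^{-ρk} √k)` in `L^p` (`exists_block_majorant`). Hence the series
converges, and truncating it at `2^k` costs `O(2^{-ρk} √k)`. Quantizing each of the `2^k` remaining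
coordinates at a level `2^{O(k)}` costs no more, because a real random variable with a moment of order
`2r` has a quantization error of polynomial decay (`exists_minimalQuantizationError_le`). The total
level is `2^{O(k 2^k)}`; choosing `k 2^k` of order `log N`, so that `k` is of order `log log N`, gives
`2^{-ρk} √k = O((log log N)^{ρ + 1/2} / (log N)^ρ)`. Optimal quantizations exist by a compactness
argument (`exists_isOptimalQuantization`).

For the modified quantization, `η_m` is Gaussian, so its quantization at the level `⌊N^{1/(2n)}⌋` has
an error decaying like a power of `N`, and replacing `N` by `⌊√N⌋` changes the rate by a constant
factor only.

Finally, `f_j(t)` is the coefficient of `s ↦ ψ(t - s) 1_{(0, t]}(s)` in the orthonormal basis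
`√(2/T) cos(π (j - 1/2) s / T)` of `L²(0, T)`. By Parseval's identity
(`hasSum_sq_integral_mul_cos`) and the Wiener isometry (`hasLaw_sum_of_isWienerIntegral`), linear
combinations of the values of `∑ ξ_j f_j` and of `X` are centred Gaussian with the same variance, and
these laws determine a law on the path space (`PathSpace.measure_ext`).
-/

/-! ### Oscillatory integrals of powers -/

theorem intervalIntegrable_rpow_mul_cos {b : ℝ} (hb : -1 < b) (x y t c δ : ℝ) :
    IntervalIntegrable (fun s : ℝ => s ^ b * Real.cos ((t - s) * c + δ)) volume x y :=
  (intervalIntegral.intervalIntegrable_rpow' hb).mul_continuousOn (by fun_prop)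

theorem abs_integral_rpow_mul_cos_le_rpow {b : ℝ} (hb : -1 < b) {x y : ℝ} (hx : 0 ≤ x)
    (hxy : x ≤ y) (t c δ : ℝ) :
    |∫ s in x..y, s ^ b * Real.cos ((t - s) * c + δ)| ≤
      (y ^ (b + 1) - x ^ (b + 1)) / (b + 1) := by
  rw [← integral_rpow (Or.inl hb), ← Real.norm_eq_abs]
  refine intervalIntegral.norm_integral_le_of_norm_le hxy (ae_of_all _ fun s hs => ?_)
    (intervalIntegral.intervalIntegrable_rpow' hb)
  have h0 : 0 ≤ s := hx.trans hs.1.le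
  rw [Real.norm_eq_abs, abs_mul, abs_of_nonneg (Real.rpow_nonneg h0 b)]
  exact mul_le_of_le_one_right (Real.rpow_nonneg h0 b) (Real.abs_cos_le_one _)

/-- Away from the singularity, an integration by parts gains a factor `c⁻¹`. -/
theorem abs_integral_rpow_mul_cos_le_of_pos {b : ℝ} (hb : b ≤ 0) {x y c : ℝ} (hx : 0 < x)
    (hxy : x ≤ y) (hc : 0 < c) (t δ : ℝ) :
    |∫ s in x..y, s ^ b * Real.cos ((t - s) * c + δ)| ≤ 2 * x ^ b / c := by
  have hpos : ∀ s ∈ Set.uIcc x y, 0 < s := fun s hs => by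
    rw [Set.uIcc_of_le hxy] at hs
    exact hx.trans_le hs.1
  have hu : ∀ s ∈ Set.uIcc x y, HasDerivAt (fun s : ℝ => s ^ b) (b * s ^ (b - 1)) s :=
    fun s hs => Real.hasDerivAt_rpow_const (Or.inl (hpos s hs).ne')
  have hv : ∀ s ∈ Set.uIcc x y, HasDerivAt (fun s : ℝ => -Real.sin ((t - s) * c + δ) / c)
      (Real.cos ((t - s) * c + δ)) s := fun s _ => by
    have h1 : HasDerivAt (fun s : ℝ => (t - s) * c + δ) (-c) s := by
      simpa using (((hasDerivAt_id s).const_sub t).mul_const c).add_const δ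
    have h2 := (h1.sin.neg).div_const c
    exact h2.congr_deriv (by field_simp)
  have hcont : ContinuousOn (fun s : ℝ => b * s ^ (b - 1)) (Set.uIcc x y) := fun s hs =>
    ((Real.continuousAt_rpow_const s (b - 1) (Or.inl (hpos s hs).ne')).const_mul
      b).continuousWithinAt
  rw [intervalIntegral.integral_mul_deriv_eq_deriv_mul hu hv hcont.intervalIntegrable
    (Continuous.intervalIntegrable (by fun_prop) _ _)]
  have hsin : ∀ z : ℝ, |(-Real.sin z / c)| ≤ 1 / c := fun z => by
    rw [abs_div, abs_neg, abs_of_pos hc]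
    exact div_le_div_of_nonneg_right (Real.abs_sin_le_one z) hc.le
  have hI : |∫ s in x..y, b * s ^ (b - 1) * (-Real.sin ((t - s) * c + δ) / c)| ≤
      (x ^ b - y ^ b) / c := by
    have hF : ∫ s in x..y, -(b * s ^ (b - 1)) / c = (x ^ b - y ^ b) / c := by
      rw [intervalIntegral.integral_div, intervalIntegral.integral_neg,
        intervalIntegral.integral_eq_sub_of_hasDerivAt hu hcont.intervalIntegrable]
      ring
    rw [← hF, ← Real.norm_eq_abs]
    refine intervalIntegral.norm_integral_le_of_norm_le hxy (ae_of_all _ fun s hs => ?_)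
      (hcont.neg.div_const c).intervalIntegrable
    have h0 : 0 < s := hx.trans hs.1
    rw [Real.norm_eq_abs, abs_mul, abs_of_nonpos
      (mul_nonpos_of_nonpos_of_nonneg hb (Real.rpow_nonneg h0.le _)), div_eq_mul_one_div (-(b * _))]
    exact mul_le_mul_of_nonneg_left (hsin _)
      (neg_nonneg.2 (mul_nonpos_of_nonpos_of_nonneg hb (Real.rpow_nonneg h0.le _)))
  have hxb : 0 ≤ x ^ b := Real.rpow_nonneg hx.le b
  have hyb : 0 ≤ y ^ b := Real.rpow_nonneg (hx.le.trans hxy) b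
  have h1 : |y ^ b * (-Real.sin ((t - y) * c + δ) / c)| ≤ y ^ b * (1 / c) := by
    rw [abs_mul, abs_of_nonneg hyb]
    exact mul_le_mul_of_nonneg_left (hsin _) hyb
  have h2 : |x ^ b * (-Real.sin ((t - x) * c + δ) / c)| ≤ x ^ b * (1 / c) := by
    rw [abs_mul, abs_of_nonneg hxb]
    exact mul_le_mul_of_nonneg_left (hsin _) hxb
  calc _ ≤ y ^ b * (1 / c) + x ^ b * (1 / c) + (x ^ b - y ^ b) / c :=
        (abs_sub _ _).trans (add_le_add ((abs_sub _ _).trans (add_le_add h1 h2)) hI)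
    _ = 2 * x ^ b / c := by ring

theorem abs_integral_rpow_mul_cos_le {b : ℝ} (hb : -1 < b) (hb0 : b ≤ 0) {t c : ℝ} (ht : 0 ≤ t)
    (hc : 0 < c) (δ : ℝ) :
    |∫ s in 0..t, s ^ b * Real.cos ((t - s) * c + δ)| ≤
      (1 / (b + 1) + 2) * c ^ (-(b + 1)) := by
  have hb1 : 0 < b + 1 := by linarith
  have hc' : 0 < c⁻¹ := inv_pos.2 hc
  have hcb : (c⁻¹) ^ (b + 1) = c ^ (-(b + 1)) := by
    rw [Real.inv_rpow hc.le, Real.rpow_neg hc.le]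
  have hnn : 0 ≤ c ^ (-(b + 1)) := Real.rpow_nonneg hc.le _
  have hz : (0 : ℝ) ^ (b + 1) = 0 := Real.zero_rpow hb1.ne'
  rcases le_total t c⁻¹ with h | h
  · refine (abs_integral_rpow_mul_cos_le_rpow hb le_rfl ht t c δ).trans ?_
    rw [hz, sub_zero, add_mul, one_div, inv_mul_eq_div]
    have := Real.rpow_le_rpow ht h hb1.le
    rw [hcb] at this
    have h3 := div_le_div_of_nonneg_right this hb1.le
    linarith
  · have hsplit := intervalIntegral.integral_add_adjacent_intervals
      (intervalIntegrable_rpow_mul_cos hb 0 c⁻¹ t c δ)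
      (intervalIntegrable_rpow_mul_cos hb c⁻¹ t t c δ)
    rw [← hsplit]
    have h1 := abs_integral_rpow_mul_cos_le_rpow hb le_rfl hc'.le t c δ
    rw [hz, sub_zero, hcb] at h1
    have h2 := abs_integral_rpow_mul_cos_le_of_pos hb0 hc' h hc t δ
    have h3 : 2 * (c⁻¹) ^ b / c = 2 * c ^ (-(b + 1)) := by
      rw [← hcb, Real.rpow_add hc', Real.rpow_one]
      ring
    rw [h3] at h2
    calc _ ≤ _ := abs_add_le _ _
      _ ≤ c ^ (-(b + 1)) / (b + 1) + 2 * c ^ (-(b + 1)) := add_le_add h1 h2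
      _ = _ := by ring

theorem integral_rpow_mul_cos_eq {b : ℝ} (hb : 0 < b) {t c : ℝ} (ht : 0 ≤ t) (hc : 0 < c) :
    ∫ s in 0..t, s ^ b * Real.cos ((t - s) * c) =
      b / c * ∫ s in 0..t, s ^ (b - 1) * Real.sin ((t - s) * c) := by
  have hu : ∀ s ∈ Set.Ioo (min 0 t) (max 0 t),
      HasDerivWithinAt (fun s : ℝ => s ^ b) (b * s ^ (b - 1)) (Set.Ioi s) s := fun s hs => by
    rw [min_eq_left ht] at hs
    exact (Real.hasDerivAt_rpow_const (Or.inl hs.1.ne')).hasDerivWithinAt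
  have hv : ∀ s ∈ Set.Ioo (min 0 t) (max 0 t), HasDerivWithinAt
      (fun s : ℝ => -Real.sin ((t - s) * c) / c) (Real.cos ((t - s) * c)) (Set.Ioi s) s :=
    fun s _ => by
      have h1 : HasDerivAt (fun s : ℝ => (t - s) * c) (-c) s := by
        simpa using (((hasDerivAt_id s).const_sub t).mul_const c)
      have h2 := (h1.sin.neg).div_const c
      exact (h2.congr_deriv (by field_simp)).hasDerivWithinAt
  have h := intervalIntegral.integral_mul_deriv_eq_deriv_mul_of_hasDeriv_right
    (Real.continuous_rpow_const hb.le).continuousOn (Continuous.continuousOn (by fun_prop)) hu hv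
    ((intervalIntegral.intervalIntegrable_rpow' (by linarith)).const_mul b)
    (Continuous.intervalIntegrable (by fun_prop) _ _)
  rw [h, Real.zero_rpow hb.ne', ← intervalIntegral.integral_const_mul]
  simp only [sub_self, zero_mul, Real.sin_zero, neg_zero, zero_div, mul_zero, zero_sub]
  rw [← intervalIntegral.integral_neg]
  refine intervalIntegral.integral_congr fun s _ => ?_
  ring

theorem integral_rpow_mul_sin_eq {b : ℝ} (hb : 0 < b) {t c : ℝ} (ht : 0 ≤ t) (hc : 0 < c) :
    ∫ s in 0..t, s ^ b * Real.sin ((t - s) * c) =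
      (t ^ b - b * ∫ s in 0..t, s ^ (b - 1) * Real.cos ((t - s) * c)) / c := by
  have hu : ∀ s ∈ Set.Ioo (min 0 t) (max 0 t),
      HasDerivWithinAt (fun s : ℝ => s ^ b) (b * s ^ (b - 1)) (Set.Ioi s) s := fun s hs => by
    rw [min_eq_left ht] at hs
    exact (Real.hasDerivAt_rpow_const (Or.inl hs.1.ne')).hasDerivWithinAt
  have hv : ∀ s ∈ Set.Ioo (min 0 t) (max 0 t), HasDerivWithinAt
      (fun s : ℝ => Real.cos ((t - s) * c) / c) (Real.sin ((t - s) * c)) (Set.Ioi s) s :=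
    fun s _ => by
      have h1 : HasDerivAt (fun s : ℝ => (t - s) * c) (-c) s := by
        simpa using (((hasDerivAt_id s).const_sub t).mul_const c)
      have h2 := h1.cos.div_const c
      exact (h2.congr_deriv (by field_simp)).hasDerivWithinAt
  have h := intervalIntegral.integral_mul_deriv_eq_deriv_mul_of_hasDeriv_right
    (Real.continuous_rpow_const hb.le).continuousOn (Continuous.continuousOn (by fun_prop)) hu hv
    ((intervalIntegral.intervalIntegrable_rpow' (by linarith)).const_mul b)
    (Continuous.intervalIntegrable (by fun_prop) _ _)
  rw [h, Real.zero_rpow hb.ne', sub_div, ← intervalIntegral.integral_const_mul,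
    ← intervalIntegral.integral_div]
  simp only [sub_self, zero_mul, Real.cos_zero, mul_one_div, sub_zero]
  congr 1
  refine intervalIntegral.integral_congr fun s _ => ?_
  ring

/-- The order `c ^ (-(b + 1))` persists for `0 < b ≤ 1` because the boundary terms of an integration
by parts vanish; beyond `b = 1` it fails, which is why boundary terms have to be split off there. -/
theorem exists_abs_integral_rpow_mul_cos_le {b : ℝ} (hb : -1 < b) (hb1 : b ≤ 1) :
    ∃ C : ℝ, 0 ≤ C ∧ ∀ t c : ℝ, 0 ≤ t → 0 < c →
      |∫ s in 0..t, s ^ b * Real.cos ((t - s) * c)| ≤ C * c ^ (-(b + 1)) := by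
  rcases le_or_gt b 0 with h | h
  · have : 0 < b + 1 := by linarith
    refine ⟨1 / (b + 1) + 2, by positivity, fun t c ht hc => ?_⟩
    simpa using abs_integral_rpow_mul_cos_le hb h ht hc 0
  · refine ⟨b * (1 / b + 2), by positivity, fun t c ht hc => ?_⟩
    rw [integral_rpow_mul_cos_eq h ht hc]
    have h1 := abs_integral_rpow_mul_cos_le (b := b - 1) (by linarith) (by linarith) ht hc
      (-(Real.pi / 2))
    have h2 : ∀ s : ℝ, Real.cos ((t - s) * c + -(Real.pi / 2)) = Real.sin ((t - s) * c) :=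
      fun s => by rw [← sub_eq_add_neg, Real.cos_sub_pi_div_two]
    simp only [h2, sub_add_cancel] at h1
    rw [abs_mul, abs_of_nonneg (div_nonneg h.le hc.le), neg_add, Real.rpow_add hc,
      Real.rpow_neg_one]
    calc _ ≤ b / c * ((1 / b + 2) * c ^ (-b)) := mul_le_mul_of_nonneg_left h1 (by positivity)
      _ = _ := by field_simp

theorem integral_rpow_mul_cos_eq_of_one_lt {b : ℝ} (hb : 1 < b) {t c : ℝ} (ht : 0 ≤ t)
    (hc : 0 < c) :
    ∫ s in 0..t, s ^ b * Real.cos ((t - s) * c) =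
      (c ^ 2)⁻¹ * (b * t ^ (b - 1) -
        b * (b - 1) * ∫ s in 0..t, s ^ (b - 2) * Real.cos ((t - s) * c)) := by
  rw [integral_rpow_mul_cos_eq (by linarith) ht hc, integral_rpow_mul_sin_eq (by linarith) ht hc,
    show b - 1 - 1 = b - 2 by ring]
  field_simp

theorem rpow_sub_rpow_le {a s t : ℝ} (ha : 0 < a) (ha1 : a ≤ 1) (hs : 0 ≤ s) (hst : s ≤ t) :
    t ^ a - s ^ a ≤ (t - s) ^ a := by
  have := Real.rpow_add_le_add_rpow (sub_nonneg.2 hst) hs ha.le ha1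
  rw [sub_add_cancel] at this
  linarith

theorem integral_rpow_le_mul_rpow {b : ℝ} (hb : -1 < b) {T s t : ℝ} (hs : 0 ≤ s) (hst : s ≤ t)
    (ht : t ≤ T) :
    ∫ x in s..t, x ^ b ≤ T ^ (b - min b 0) / (min b 0 + 1) * (t - s) ^ (min b 0 + 1) := by
  have hm : -1 < min b 0 := lt_min hb (by norm_num)
  have hm1 : 0 < min b 0 + 1 := by linarith
  have hT : 0 ≤ T := hs.trans (hst.trans ht)
  have h1 : ∫ x in s..t, x ^ b ≤ ∫ x in s..t, T ^ (b - min b 0) * x ^ (min b 0) := by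
    refine intervalIntegral.integral_mono_on_of_le_Ioo hst
      (intervalIntegral.intervalIntegrable_rpow' hb)
      ((intervalIntegral.intervalIntegrable_rpow' hm).const_mul _) fun x hx => ?_
    have hx0 : 0 < x := hs.trans_lt hx.1
    calc x ^ b = x ^ (b - min b 0) * x ^ (min b 0) := by rw [← Real.rpow_add hx0, sub_add_cancel]
      _ ≤ _ := mul_le_mul_of_nonneg_right (Real.rpow_le_rpow hx0.le (hx.2.le.trans ht)
          (sub_nonneg.2 (min_le_left _ _))) (Real.rpow_nonneg hx0.le _)
  refine h1.trans ?_
  rw [intervalIntegral.integral_const_mul, integral_rpow (Or.inl hm), div_mul_eq_mul_div,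
    mul_div_assoc]
  exact mul_le_mul_of_nonneg_left (div_le_div_of_nonneg_right
    (rpow_sub_rpow_le hm1 (by linarith [min_le_right b 0]) hs hst) hm1.le) (Real.rpow_nonneg hT _)

/-- Hölder continuity of `t ↦ ∫_0^t s^b cos((t-s)c) ds`, with a constant growing linearly in the
frequency `c`. -/
theorem exists_abs_integral_rpow_mul_cos_sub_le {b T : ℝ} (hb : -1 < b) (hT : 0 < T) :
    ∃ C : ℝ, 0 ≤ C ∧ ∀ s t c : ℝ, 0 ≤ s → s ≤ t → t ≤ T → 0 ≤ c →
      |(∫ x in 0..t, x ^ b * Real.cos ((t - x) * c)) -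
        ∫ x in 0..s, x ^ b * Real.cos ((s - x) * c)| ≤
        C * (1 + c) * (t - s) ^ (min b 0 + 1) := by
  have hm : -1 < min b 0 := lt_min hb (by norm_num)
  have hm1 : 0 < min b 0 + 1 := by linarith
  have hb1 : 0 < b + 1 := by linarith
  set A := T ^ (b - min b 0) / (min b 0 + 1) with hA
  set B := T ^ (b + 1) / (b + 1) * T ^ (1 - (min b 0 + 1)) with hB
  have hA0 : 0 ≤ A := by positivity
  have hB0 : 0 ≤ B := by positivity
  refine ⟨A + B, by positivity, fun s t c hs hst ht hc => ?_⟩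
  have ht0 : 0 ≤ t := hs.trans hst
  have hint : ∀ u x y, IntervalIntegrable (fun s : ℝ => s ^ b * Real.cos ((u - s) * c)) volume x y :=
    fun u x y => by simpa using intervalIntegrable_rpow_mul_cos hb x y u c 0
  rw [← intervalIntegral.integral_add_adjacent_intervals (hint t 0 s) (hint t s t),
    add_sub_right_comm, ← intervalIntegral.integral_sub (hint t 0 s) (hint s 0 s)]
  have h1 : |∫ x in s..t, x ^ b * Real.cos ((t - x) * c)| ≤ A * (t - s) ^ (min b 0 + 1) := by
    refine le_trans ?_ (integral_rpow_le_mul_rpow hb hs hst ht)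
    rw [integral_rpow (Or.inl hb)]
    simpa using abs_integral_rpow_mul_cos_le_rpow hb hs hst t c 0
  have h2 : |∫ x in 0..s, (x ^ b * Real.cos ((t - x) * c) - x ^ b * Real.cos ((s - x) * c))| ≤
      B * c * (t - s) ^ (min b 0 + 1) := by
    have h3 : |∫ x in 0..s, (x ^ b * Real.cos ((t - x) * c) - x ^ b * Real.cos ((s - x) * c))| ≤
        ∫ x in 0..s, x ^ b * ((t - s) * c) := by
      rw [← Real.norm_eq_abs]
      refine intervalIntegral.norm_integral_le_of_norm_le hs (ae_of_all _ fun x hx => ?_)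
        ((intervalIntegral.intervalIntegrable_rpow' hb).mul_const _)
      rw [← mul_sub, Real.norm_eq_abs, abs_mul, abs_of_nonneg (Real.rpow_nonneg hx.1.le b)]
      refine mul_le_mul_of_nonneg_left ?_ (Real.rpow_nonneg hx.1.le b)
      have h4 := Real.abs_cos_sub_cos_le ((t - x) * c) ((s - x) * c)
      rwa [← sub_mul, sub_sub_sub_cancel_right, abs_of_nonneg
        (mul_nonneg (sub_nonneg.2 hst) hc)] at h4
    refine h3.trans ?_
    rw [intervalIntegral.integral_mul_const, integral_rpow (Or.inl hb), Real.zero_rpow hb1.ne',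
      sub_zero]
    have h5 : s ^ (b + 1) ≤ T ^ (b + 1) := Real.rpow_le_rpow hs (hst.trans ht) hb1.le
    have h6 : t - s ≤ T ^ (1 - (min b 0 + 1)) * (t - s) ^ (min b 0 + 1) := by
      rcases hst.eq_or_lt with rfl | h
      · simp only [sub_self]
        positivity
      · have h7 : 0 < t - s := sub_pos.2 h
        calc t - s = (t - s) ^ (1 - (min b 0 + 1)) * (t - s) ^ (min b 0 + 1) := by
              rw [← Real.rpow_add h7, sub_add_cancel, Real.rpow_one]
          _ ≤ _ := mul_le_mul_of_nonneg_right (Real.rpow_le_rpow h7.le (by linarith)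
              (by linarith [min_le_right b 0])) (by positivity)
    calc s ^ (b + 1) / (b + 1) * ((t - s) * c)
        ≤ T ^ (b + 1) / (b + 1) * ((T ^ (1 - (min b 0 + 1)) * (t - s) ^ (min b 0 + 1)) * c) := by
          have := sub_nonneg.2 hst
          gcongr
      _ = _ := by rw [hB]; ring
  have hP : 0 ≤ (t - s) ^ (min b 0 + 1) := Real.rpow_nonneg (sub_nonneg.2 hst) _
  calc _ ≤ B * c * (t - s) ^ (min b 0 + 1) + A * (t - s) ^ (min b 0 + 1) :=
        (abs_add_le _ _).trans (add_le_add h2 h1)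
    _ ≤ (A + B) * (1 + c) * (t - s) ^ (min b 0 + 1) := by
        rw [← add_mul]
        refine mul_le_mul_of_nonneg_right ?_ hP
        nlinarith [mul_nonneg hA0 hc]

/-! ### The cosine sequence, its boundary terms and its remainder -/

theorem cosineFrequency_pos {T : ℝ} (hT : 0 < T) (j : ℕ) : 0 < cosineFrequency T j := by
  unfold cosineFrequency
  positivity

theorem le_cosineFrequency {T : ℝ} (hT : 0 < T) (j : ℕ) :
    Real.pi / (2 * T) * (j + 1) ≤ cosineFrequency T j := by
  have : (0 : ℝ) ≤ j := j.cast_nonneg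
  have h : cosineFrequency T j - Real.pi / (2 * T) * (j + 1) = Real.pi * j / (2 * T) := by
    unfold cosineFrequency
    field_simp
    ring
  have h2 : 0 ≤ Real.pi * j / (2 * T) := by positivity
  linarith

theorem cosineFrequency_le {T : ℝ} (hT : 0 < T) (j : ℕ) :
    cosineFrequency T j ≤ Real.pi / T * (j + 1) := by
  have h : Real.pi / T * (j + 1) - cosineFrequency T j = Real.pi / (2 * T) := by
    unfold cosineFrequency
    field_simp
    ring
  have h2 : 0 ≤ Real.pi / (2 * T) := by positivity
  linarith

theorem cosineEigenvalue_nonneg (T : ℝ) (j : ℕ) : 0 ≤ cosineEigenvalue T j := by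
  unfold cosineEigenvalue
  positivity

theorem cosineEigenvalue_le {T : ℝ} (hT : 0 < T) (j : ℕ) :
    cosineEigenvalue T j ≤ ((Real.pi / (2 * T)) ^ 2)⁻¹ * (((j : ℝ) + 1) ^ 2)⁻¹ := by
  unfold cosineEigenvalue
  rw [← mul_inv, ← mul_pow]
  gcongr
  exact le_cosineFrequency hT j

theorem summable_cosineEigenvalue {T : ℝ} (hT : 0 < T) : Summable (cosineEigenvalue T) := by
  refine Summable.of_nonneg_of_le (cosineEigenvalue_nonneg T) (cosineEigenvalue_le hT)
    (Summable.mul_left _ ?_)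
  have h := (summable_nat_add_iff 1).2 (Real.summable_nat_pow_inv.2 (by norm_num : 1 < 2))
  simpa using h

theorem cosineEigenvalue_le_const {T : ℝ} (hT : 0 < T) (j : ℕ) :
    cosineEigenvalue T j ≤ ((Real.pi / (2 * T)) ^ 2)⁻¹ := by
  refine (cosineEigenvalue_le hT j).trans (mul_le_of_le_one_right (by positivity) ?_)
  refine inv_le_one_of_one_le₀ (one_le_pow₀ ?_)
  have : (0 : ℝ) ≤ j := j.cast_nonneg
  linarith

theorem summable_cosineEigenvalue_pow {T : ℝ} (hT : 0 < T) (m : ℕ) :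
    Summable fun j => cosineEigenvalue T j ^ (m + 1) := by
  refine Summable.of_nonneg_of_le (fun j => pow_nonneg (cosineEigenvalue_nonneg T j) _) (fun j => ?_)
    ((summable_cosineEigenvalue hT).mul_left ((((Real.pi / (2 * T)) ^ 2)⁻¹) ^ m))
  rw [pow_succ]
  exact mul_le_mul_of_nonneg_right (pow_le_pow_left₀ (cosineEigenvalue_nonneg T j)
    (cosineEigenvalue_le_const hT j) m) (cosineEigenvalue_nonneg T j)

theorem cosineSequence_apply {T ρ : ℝ} (hρ : 0 < ρ) (j : ℕ) (t : Set.Icc (0 : ℝ) T) :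
    cosineSequence T ρ hρ j t = √(2 / T) *
      ∫ s in (0 : ℝ)..t, rlKernel ρ s * Real.cos ((t - s) * cosineFrequency T j) := rfl

theorem cosineRemainder_apply {T ρ : ℝ} {n : ℕ} (hn : 2 * (n : ℝ) < ρ + 1 / 2) (j : ℕ)
    (t : Set.Icc (0 : ℝ) T) :
    cosineRemainder T ρ n hn j t =
      (-1) ^ n * cosineEigenvalue T j ^ n * √(2 / T) *
        ((descPochhammer ℝ (2 * n)).eval (ρ - 1 / 2) *
      ∫ s in (0 : ℝ)..t, s ^ (ρ - 1 / 2 - 2 * n) * Real.cos ((t - s) * cosineFrequency T j)) := by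
  rw [← intervalIntegral.integral_const_mul]
  change _ * (∫ s in (0 : ℝ)..t, iteratedDeriv (2 * n) (rlKernel ρ) s *
    Real.cos ((t - s) * cosineFrequency T j)) = _
  rw [iteratedDeriv_rlKernel]
  push_cast
  simp only [mul_assoc]

theorem cosineRemainder_zero {T ρ : ℝ} (hρ : 0 < ρ) (hn : 2 * ((0 : ℕ) : ℝ) < ρ + 1 / 2) :
    cosineRemainder T ρ 0 hn = cosineSequence T ρ hρ := by
  funext j
  ext t
  rw [cosineRemainder_apply, cosineSequence_apply]
  simp [rlKernel]

theorem boundaryPath_apply {T ρ : ℝ} {n : ℕ} (hn : 2 * (n : ℝ) < ρ + 1 / 2) (m : Fin n)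
    (t : Set.Icc (0 : ℝ) T) :
    boundaryPath T ρ n hn m t =
      (-1) ^ (m : ℕ) * √(2 / T) * iteratedDeriv (2 * (m : ℕ) + 1) (rlKernel ρ) t := rfl

/-- Two integrations by parts turn `ψ^{(k)}` into `ψ^{(k+2)}` at the price of one boundary term; the
contributions of the endpoint `0` vanish because `ψ^{(k)}` and `ψ^{(k+1)}` do there. -/
theorem integral_iteratedDeriv_rlKernel_mul_cos {ρ : ℝ} {k : ℕ} (hk : (k : ℝ) + 1 < ρ - 1 / 2)
    {t c : ℝ} (ht : 0 ≤ t) (hc : 0 < c) :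
    ∫ s in 0..t, iteratedDeriv k (rlKernel ρ) s * Real.cos ((t - s) * c) =
      (c ^ 2)⁻¹ * (iteratedDeriv (k + 1) (rlKernel ρ) t -
        ∫ s in 0..t, iteratedDeriv (k + 2) (rlKernel ρ) s * Real.cos ((t - s) * c)) := by
  simp only [iteratedDeriv_rlKernel, mul_assoc, intervalIntegral.integral_const_mul]
  rw [integral_rpow_mul_cos_eq_of_one_lt (by linarith) ht hc]
  simp only [descPochhammer_succ_eval]
  push_cast
  rw [show ρ - 1 / 2 - ((k : ℝ) + 2) = ρ - 1 / 2 - k - 2 by ring,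
    show ρ - 1 / 2 - ((k : ℝ) + 1) = ρ - 1 / 2 - k - 1 by ring]
  ring

theorem integral_rlKernel_mul_cos_eq_sum {ρ : ℝ} (n : ℕ) (hn : 2 * (n : ℝ) < ρ + 1 / 2)
    {t c : ℝ} (ht : 0 ≤ t) (hc : 0 < c) :
    ∫ s in 0..t, rlKernel ρ s * Real.cos ((t - s) * c) =
      (∑ m ∈ Finset.range n, (-1) ^ m * (c ^ 2)⁻¹ ^ (m + 1) *
        iteratedDeriv (2 * m + 1) (rlKernel ρ) t) +
      (-1) ^ n * (c ^ 2)⁻¹ ^ n *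
        ∫ s in 0..t, iteratedDeriv (2 * n) (rlKernel ρ) s * Real.cos ((t - s) * c) := by
  induction n with
  | zero => simp
  | succ n ih =>
    push_cast at hn
    rw [ih (by linarith), integral_iteratedDeriv_rlKernel_mul_cos (k := 2 * n)
      (by push_cast; linarith) ht hc, Finset.sum_range_succ]
    rw [show 2 * (n + 1) = 2 * n + 2 by ring]
    ring

theorem cosineSequence_eq_add {T ρ : ℝ} (hT : 0 < T) (hρ : 0 < ρ) {n : ℕ}
    (hn : 2 * (n : ℝ) < ρ + 1 / 2) (j : ℕ) :
    cosineSequence T ρ hρ j = cosineBoundary T ρ n hn j + cosineRemainder T ρ n hn j := by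
  ext t
  rw [ContinuousMap.add_apply, cosineSequence_apply,
    integral_rlKernel_mul_cos_eq_sum n hn t.2.1 (cosineFrequency_pos hT j), mul_add,
    cosineBoundary, ContinuousMap.coe_sum, Finset.sum_apply, Finset.mul_sum,
    ← Fin.sum_univ_eq_sum_range (fun m => √(2 / T) * ((-1) ^ m *
      (cosineFrequency T j ^ 2)⁻¹ ^ (m + 1) * iteratedDeriv (2 * m + 1) (rlKernel ρ) t))]
  congr 1
  · refine Finset.sum_congr rfl fun m _ => ?_
    rw [ContinuousMap.coe_smul, Pi.smul_apply, boundaryPath_apply, smul_eq_mul, cosineEigenvalue]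
    ring
  · change _ = (-1) ^ n * cosineEigenvalue T j ^ n * √(2 / T) *
      ∫ s in (0 : ℝ)..t, iteratedDeriv (2 * n) (rlKernel ρ) s *
        Real.cos ((t - s) * cosineFrequency T j)
    rw [cosineEigenvalue]
    ring

/-- The factor `λ_j^n`, of order `j ^ (-2n)`, makes up for the exponent lost by differentiating `ψ`
`2n` times. -/
theorem exists_norm_cosineRemainder_le {T ρ : ℝ} (hT : 0 < T) {n : ℕ}
    (hn : 2 * (n : ℝ) < ρ + 1 / 2) (hn' : ρ ≤ 2 * (n : ℝ) + 3 / 2) :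
    ∃ K : ℝ, 0 ≤ K ∧ ∀ j : ℕ,
      ‖cosineRemainder T ρ n hn j‖ ≤ K * ((j : ℝ) + 1) ^ (-(ρ + 1 / 2)) := by
  obtain ⟨C, hC, h⟩ := exists_abs_integral_rpow_mul_cos_le (b := ρ - 1 / 2 - 2 * n)
    (by linarith) (by linarith)
  set d := (descPochhammer ℝ (2 * n)).eval (ρ - 1 / 2) with hd
  have hρ : 0 < ρ + 1 / 2 := by
    have : (0 : ℝ) ≤ n := n.cast_nonneg
    linarith
  refine ⟨√(2 / T) * |d| * C * (Real.pi / (2 * T)) ^ (-(ρ + 1 / 2)), by positivity, fun j => ?_⟩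
  rw [ContinuousMap.norm_le _ (by positivity)]
  intro t
  have hc := cosineFrequency_pos hT j
  have hj : (0 : ℝ) < (j : ℝ) + 1 := by positivity
  rw [cosineRemainder_apply, ← hd, Real.norm_eq_abs]
  simp only [abs_mul, abs_pow, abs_neg, abs_one, one_pow, one_mul]
  rw [abs_of_nonneg (cosineEigenvalue_nonneg T j), abs_of_nonneg (Real.sqrt_nonneg _)]
  have h1 := h t _ t.2.1 hc
  have h2 : cosineEigenvalue T j ^ n * cosineFrequency T j ^ (-(ρ - 1 / 2 - 2 * n + 1)) =
      cosineFrequency T j ^ (-(ρ + 1 / 2)) := by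
    rw [cosineEigenvalue, inv_pow, ← pow_mul, ← Real.rpow_natCast, ← Real.rpow_neg hc.le,
      ← Real.rpow_add hc]
    push_cast
    congr 1
    ring
  have h3 : cosineFrequency T j ^ (-(ρ + 1 / 2)) ≤
      (Real.pi / (2 * T)) ^ (-(ρ + 1 / 2)) * ((j : ℝ) + 1) ^ (-(ρ + 1 / 2)) := by
    rw [← Real.mul_rpow (by positivity) hj.le]
    exact Real.rpow_le_rpow_of_nonpos (by positivity) (le_cosineFrequency hT j) (by linarith)
  have h4 := pow_nonneg (cosineEigenvalue_nonneg T j) n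
  calc _ ≤ cosineEigenvalue T j ^ n * √(2 / T) *
        (|d| * (C * cosineFrequency T j ^ (-(ρ - 1 / 2 - 2 * n + 1)))) := by gcongr
    _ = √(2 / T) * |d| * C *
        (cosineEigenvalue T j ^ n * cosineFrequency T j ^ (-(ρ - 1 / 2 - 2 * n + 1))) := by ring
    _ ≤ √(2 / T) * |d| * C *
        ((Real.pi / (2 * T)) ^ (-(ρ + 1 / 2)) * ((j : ℝ) + 1) ^ (-(ρ + 1 / 2))) := by
        rw [h2]
        gcongr
    _ = _ := by ring

theorem exists_abs_cosineRemainder_sub_le {T ρ : ℝ} (hT : 0 < T) {n : ℕ}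
    (hn : 2 * (n : ℝ) < ρ + 1 / 2) :
    ∃ K a : ℝ, 0 ≤ K ∧ 0 < a ∧ ∀ (j : ℕ) (s t : Set.Icc (0 : ℝ) T),
      |cosineRemainder T ρ n hn j t - cosineRemainder T ρ n hn j s| ≤
        K * ((j : ℝ) + 1) * |(t : ℝ) - s| ^ a := by
  obtain ⟨C, hC, h⟩ := exists_abs_integral_rpow_mul_cos_sub_le (b := ρ - 1 / 2 - 2 * n)
    (by linarith) hT
  set d := (descPochhammer ℝ (2 * n)).eval (ρ - 1 / 2) with hd
  set a := min (ρ - 1 / 2 - 2 * n) 0 + 1 with ha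
  have ha0 : 0 < a := by
    have : -1 < min (ρ - 1 / 2 - 2 * (n : ℝ)) 0 := lt_min (by linarith) (by norm_num)
    linarith
  have key : ∀ (j : ℕ) (s t : Set.Icc (0 : ℝ) T), (s : ℝ) ≤ t →
      |cosineRemainder T ρ n hn j t - cosineRemainder T ρ n hn j s| ≤
        ((((Real.pi / (2 * T)) ^ 2)⁻¹) ^ n * √(2 / T) * |d| * C * (1 + Real.pi / T)) *
          ((j : ℝ) + 1) * |(t : ℝ) - s| ^ a := fun j s t hst => by
    have hc := cosineFrequency_pos hT j
    have hj : (0 : ℝ) ≤ j := j.cast_nonneg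
    have hts : 0 ≤ (t : ℝ) - s := sub_nonneg.2 hst
    rw [cosineRemainder_apply, cosineRemainder_apply, ← hd, ← mul_sub, ← mul_sub]
    simp only [abs_mul, abs_pow, abs_neg, abs_one, one_pow, one_mul]
    rw [abs_of_nonneg (cosineEigenvalue_nonneg T j), abs_of_nonneg (Real.sqrt_nonneg _),
      abs_of_nonneg hts]
    have h1 := h s t _ s.2.1 hst t.2.2 hc.le
    have h2 : 1 + cosineFrequency T j ≤ (1 + Real.pi / T) * ((j : ℝ) + 1) := by
      have := cosineFrequency_le hT j
      linarith
    have h3 := pow_le_pow_left₀ (cosineEigenvalue_nonneg T j) (cosineEigenvalue_le_const hT j) n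
    have h4 : 0 ≤ ((t : ℝ) - s) ^ a := Real.rpow_nonneg hts _
    calc _ ≤ (((Real.pi / (2 * T)) ^ 2)⁻¹) ^ n * √(2 / T) *
          (|d| * (C * ((1 + Real.pi / T) * ((j : ℝ) + 1)) * ((t : ℝ) - s) ^ a)) := by
          gcongr
          exact h1.trans (by gcongr)
      _ = _ := by ring
  refine ⟨(((Real.pi / (2 * T)) ^ 2)⁻¹) ^ n * √(2 / T) * |d| * C * (1 + Real.pi / T), a,
    by positivity, ha0, fun j s t => ?_⟩
  rcases le_total (s : ℝ) t with hst | hst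
  · exact key j s t hst
  · rw [abs_sub_comm, abs_sub_comm (t : ℝ)]
    exact key j t s hst

/-! ### Gaussian sums and maxima of Gaussian variables -/

instance isProbabilityMeasure_gaussianSequence : IsProbabilityMeasure gaussianSequence := by
  unfold gaussianSequence
  infer_instance

theorem hasLaw_eval_gaussianSequence (j : ℕ) :
    HasLaw (fun ω : ℕ → ℝ => ω j) (gaussianReal 0 1) gaussianSequence :=
  ⟨(measurable_pi_apply j).aemeasurable, Measure.infinitePi_map_eval _ j⟩

theorem iIndepFun_mul_eval_gaussianSequence (a : ℕ → ℝ) :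
    iIndepFun (fun (j : ℕ) (ω : ℕ → ℝ) => a j * ω j) gaussianSequence :=
  iIndepFun_infinitePi (X := fun j x => a j * x) fun j => measurable_const_mul (a j)

theorem hasLaw_sum_gaussianSequence (s : Finset ℕ) (a : ℕ → ℝ) :
    HasLaw (fun ω : ℕ → ℝ => ∑ j ∈ s, a j * ω j)
      (gaussianReal 0 (∑ j ∈ s, a j ^ 2).toNNReal) gaussianSequence := by
  have hm : ∀ j, Measurable fun ω : ℕ → ℝ => a j * ω j := fun j => by fun_prop
  have hs : Measurable fun ω : ℕ → ℝ => ∑ j ∈ s, a j * ω j := Finset.measurable_fun_sum s fun j _ => hm j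
  refine ⟨hs.aemeasurable, ?_⟩
  have := Measure.isProbabilityMeasure_map (μ := gaussianSequence) hs.aemeasurable
  refine Measure.ext_of_charFun ?_
  have hind : iIndepFun (s.restrict fun (j : ℕ) (ω : ℕ → ℝ) => a j * ω j) gaussianSequence :=
    (iIndepFun_mul_eval_gaussianSequence a).precomp (g := fun i : s => (i : ℕ))
      Subtype.val_injective
  rw [iIndepFun.charFun_map_fun_finsetSum_eq_prod (X := fun (j : ℕ) (ω : ℕ → ℝ) => a j * ω j)
    (fun j _ => (hm j).aemeasurable) hind]
  funext t
  have h1 : ∀ j, gaussianSequence.map (fun ω : ℕ → ℝ => a j * ω j) =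
      gaussianReal (a j * 0) (.mk (a j ^ 2) (sq_nonneg _) * 1) := fun j =>
    (gaussianReal_const_mul (hasLaw_eval_gaussianSequence j) (a j)).map_eq
  simp only [Finset.prod_apply, h1, charFun_gaussianReal]
  rw [← Complex.exp_sum]
  congr 1
  have h2 : ((∑ j ∈ s, a j ^ 2).toNNReal : ℝ) = ∑ j ∈ s, a j ^ 2 :=
    Real.coe_toNNReal _ (Finset.sum_nonneg fun j _ => sq_nonneg _)
  have h3 : (((∑ j ∈ s, a j ^ 2).toNNReal : ℝ) : ℂ) = ∑ j ∈ s, (a j : ℂ) ^ 2 := by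
    rw [h2]
    push_cast
    rfl
  rw [h3]
  simp [Finset.sum_mul, Finset.sum_div]

theorem eLpNorm_ofReal_le_of_lintegral_le {Ω F : Type*} [MeasurableSpace Ω] [NormedAddCommGroup F]
    {P : Measure Ω} {p : ℝ} (hp : 0 < p) {f : Ω → F} {A : ℝ≥0∞}
    (h : ∫⁻ ω, ‖f ω‖ₑ ^ p ∂P ≤ A ^ p) : eLpNorm f (ENNReal.ofReal p) P ≤ A := by
  rw [eLpNorm_eq_lintegral_rpow_enorm_toReal (by simpa using hp) ENNReal.ofReal_ne_top,
    ENNReal.toReal_ofReal hp.le, one_div, ENNReal.rpow_inv_le_iff hp]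
  exact h

theorem eLpNorm_ofReal_rpow {Ω F : Type*} [MeasurableSpace Ω] [NormedAddCommGroup F]
    {P : Measure Ω} {p : ℝ} (hp : 0 < p) (f : Ω → F) :
    eLpNorm f (ENNReal.ofReal p) P ^ p = ∫⁻ ω, ‖f ω‖ₑ ^ p ∂P := by
  rw [eLpNorm_eq_lintegral_rpow_enorm_toReal (by simpa using hp) ENNReal.ofReal_ne_top,
    ENNReal.toReal_ofReal hp.le, one_div, ENNReal.rpow_inv_rpow hp.ne']

/-- Centered Gaussian variables of variance at most `σ ^ 2` have a square exponential moment at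
scale `σ`, uniformly. -/
theorem exists_lintegral_exp_sq_gaussianReal_le :
    ∃ (c : ℝ) (K : ℝ≥0), 0 < c ∧ ∀ (v : ℝ≥0) (σ : ℝ), 0 < σ → (v : ℝ) ≤ σ ^ 2 →
      ∫⁻ x, ENNReal.ofReal (Real.exp (c * (x / σ) ^ 2)) ∂gaussianReal 0 v ≤ K := by
  obtain ⟨c, hc, hint⟩ := IsGaussian.exists_integrable_exp_sq (gaussianReal 0 1)
  refine ⟨c, (∫ x, Real.exp (c * ‖x‖ ^ 2) ∂gaussianReal 0 1).toNNReal, hc, fun v σ hσ hv => ?_⟩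
  have hmap : gaussianReal 0 v = (gaussianReal 0 1).map (√(v : ℝ) * ·) := by
    rw [gaussianReal_map_const_mul, mul_zero, mul_one]
    congr 1
    ext
    simp
  rw [hmap, lintegral_map (by fun_prop) (by fun_prop)]
  rw [show (((∫ x, Real.exp (c * ‖x‖ ^ 2) ∂gaussianReal 0 1).toNNReal : ℝ≥0) : ℝ≥0∞) =
    ENNReal.ofReal (∫ x, Real.exp (c * ‖x‖ ^ 2) ∂gaussianReal 0 1) from rfl,
    ofReal_integral_eq_lintegral_ofReal hint (ae_of_all _ fun x => (Real.exp_pos _).le)]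
  refine lintegral_mono fun x => ENNReal.ofReal_le_ofReal (Real.exp_le_exp.2 ?_)
  refine mul_le_mul_of_nonneg_left ?_ hc.le
  rw [div_pow, mul_pow, Real.sq_sqrt v.coe_nonneg, Real.norm_eq_abs, sq_abs, div_le_iff₀ (by positivity),
    mul_comm]
  exact mul_le_mul_of_nonneg_left hv (sq_nonneg x)

/-- The `L^p` norm of the maximum of `M` centered Gaussian variables of variance at most `σ ^ 2` is
`O(σ √(log M))`; no independence is needed. The maximum is replaced by a measurable majorant. -/
theorem exists_gaussian_majorant {Ω ι : Type*} [MeasurableSpace Ω] (P : Measure Ω)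
    [IsProbabilityMeasure P] (p : ℝ) :
    ∃ C : ℝ, 0 ≤ C ∧ ∀ (s : Finset ι) (G : ι → Ω → ℝ) (v : ι → ℝ≥0) (σ M : ℝ), 0 < σ → 2 ≤ M →
      (s.card : ℝ) ≤ M → (∀ i ∈ s, Measurable (G i)) →
      (∀ i ∈ s, HasLaw (G i) (gaussianReal 0 (v i)) P) → (∀ i ∈ s, (v i : ℝ) ≤ σ ^ 2) →
      ∃ R : Ω → ℝ, Measurable R ∧ (∀ i ∈ s, ∀ ω, |G i ω| ≤ R ω) ∧
        eLpNorm R (ENNReal.ofReal p) P ≤ ENNReal.ofReal (C * σ * √(Real.log M)) := by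
  obtain ⟨c, K, hc, hK⟩ := exists_lintegral_exp_sq_gaussianReal_le
  set q : ℕ := ⌈p⌉₊ + 1 with hq
  have hpq : p ≤ 2 * q := by
    have h1 := Nat.le_ceil p
    have h2 : (0 : ℝ) ≤ ⌈p⌉₊ := Nat.cast_nonneg _
    rw [hq]
    push_cast
    linarith
  have hl2 : 0 < Real.log 2 := Real.log_pos (by norm_num)
  set B : ℝ := 1 + q.factorial * (1 + K) / Real.log 2 ^ q with hB
  have hB1 : 1 ≤ B := by
    rw [hB, le_add_iff_nonneg_right]
    positivity
  refine ⟨√(2 * B / c), Real.sqrt_nonneg _, fun s G v σ M hσ hM hs hG hlaw hv => ?_⟩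
  have hM0 : 0 < M := by linarith
  have hlM : Real.log 2 ≤ Real.log M := Real.log_le_log (by norm_num) hM
  have hlM0 : 0 < Real.log M := hl2.trans_le hlM
  set Y : Ω → ℝ := fun ω => (∑ i ∈ s, Real.exp (c * (G i ω / σ) ^ 2)) / M with hY
  have hY0 : ∀ ω, 0 ≤ Y ω := fun ω => by positivity
  have hYm : Measurable Y := by
    refine Measurable.div_const (Finset.measurable_fun_sum s fun i hi => ?_) M
    have := hG i hi
    fun_prop
  have hL0 : ∀ ω, 0 ≤ Real.log (1 + Y ω) := fun ω => Real.log_nonneg (by linarith [hY0 ω])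
  refine ⟨fun ω => σ / √c * √(Real.log M + Real.log (1 + Y ω)), by fun_prop, fun i hi ω => ?_, ?_⟩
  · have h1 : Real.exp (c * (G i ω / σ) ^ 2) ≤ M * (1 + Y ω) := by
      have h2 : M * Y ω = ∑ i ∈ s, Real.exp (c * (G i ω / σ) ^ 2) := by
        rw [hY]
        field_simp
      rw [mul_add, h2, mul_one]
      have := Finset.single_le_sum (f := fun i => Real.exp (c * (G i ω / σ) ^ 2))
        (fun i _ => (Real.exp_pos _).le) hi
      linarith
    have h3 : c * (G i ω / σ) ^ 2 ≤ Real.log M + Real.log (1 + Y ω) := by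
      rw [← Real.log_mul hM0.ne' (by linarith [hY0 ω])]
      exact (Real.le_log_iff_exp_le (by nlinarith [hY0 ω])).2 h1
    have h4 : |√c * (G i ω / σ)| ≤ √(Real.log M + Real.log (1 + Y ω)) := by
      refine Real.abs_le_sqrt ?_
      rwa [mul_pow, Real.sq_sqrt hc.le]
    rw [abs_mul, abs_div, abs_of_pos hσ, abs_of_nonneg (Real.sqrt_nonneg c)] at h4
    have hc' : 0 < √c := Real.sqrt_pos.2 hc
    calc |G i ω| = σ / √c * (√c * (|G i ω| / σ)) := by field_simp
      _ ≤ _ := mul_le_mul_of_nonneg_left h4 (by positivity)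
  · refine (eLpNorm_le_eLpNorm_of_exponent_le (ENNReal.ofReal_le_ofReal hpq)
      (Measurable.aestronglyMeasurable (by fun_prop))).trans
      (eLpNorm_ofReal_le_of_lintegral_le (by positivity) ?_)
    have hpow : ∀ z : ℝ, 0 ≤ z → ENNReal.ofReal z ^ (2 * (q : ℝ)) = ENNReal.ofReal ((z ^ 2) ^ q) :=
      fun z hz => by
        rw [← pow_mul, ENNReal.ofReal_rpow_of_nonneg hz (by positivity)]
        congr 1
        rw [← Real.rpow_natCast]
        push_cast
        rfl
    set A : ℝ := (σ ^ 2 / c) ^ q * 2 ^ q with hA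
    have hA0 : 0 ≤ A := by positivity
    have hpt : ∀ ω, ‖σ / √c * √(Real.log M + Real.log (1 + Y ω))‖ₑ ^ (2 * (q : ℝ)) ≤
        ENNReal.ofReal A * (ENNReal.ofReal (Real.log M ^ q + q.factorial) +
          ENNReal.ofReal q.factorial * ENNReal.ofReal (Y ω)) := fun ω => by
      rw [Real.enorm_of_nonneg (by positivity), hpow _ (by positivity), mul_pow, div_pow,
        Real.sq_sqrt hc.le, Real.sq_sqrt (add_nonneg hlM0.le (hL0 ω)),
        ← ENNReal.ofReal_mul (by positivity), ← ENNReal.ofReal_add (by positivity)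
          (mul_nonneg (by positivity) (hY0 ω)), ← ENNReal.ofReal_mul hA0]
      refine ENNReal.ofReal_le_ofReal ?_
      have h1 := add_pow_le hlM0.le (hL0 ω) q
      have h2 : Real.log (1 + Y ω) ^ q ≤ q.factorial * (1 + Y ω) := by
        have h3 := Real.pow_div_factorial_le_exp _ (hL0 ω) q
        rw [Real.exp_log (by linarith [hY0 ω]), div_le_iff₀ (by positivity)] at h3
        linarith
      have h4 : (2 : ℝ) ^ (q - 1) ≤ 2 ^ q := pow_le_pow_right₀ (by norm_num) (Nat.sub_le q 1)
      have h5 : 0 ≤ Real.log (1 + Y ω) ^ q := pow_nonneg (hL0 ω) q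
      rw [mul_pow, hA, mul_assoc]
      refine mul_le_mul_of_nonneg_left (h1.trans ?_) (by positivity)
      refine mul_le_mul h4 ?_ (by positivity) (by positivity)
      linarith
    have hYint : ∫⁻ ω, ENNReal.ofReal (Y ω) ∂P ≤ K := by
      have h1 : ∀ ω, ENNReal.ofReal (Y ω) = (ENNReal.ofReal M)⁻¹ *
          ∑ i ∈ s, ENNReal.ofReal (Real.exp (c * (G i ω / σ) ^ 2)) := fun ω => by
        rw [← ENNReal.ofReal_sum_of_nonneg fun i _ => (Real.exp_pos _).le,
          ← ENNReal.ofReal_inv_of_pos hM0, ← ENNReal.ofReal_mul (by positivity), inv_mul_eq_div]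
      have hmi : ∀ i ∈ s, Measurable fun ω => ENNReal.ofReal (Real.exp (c * (G i ω / σ) ^ 2)) :=
        fun i hi => by
          have := hG i hi
          fun_prop
      simp only [h1]
      rw [lintegral_const_mul _ (Finset.measurable_fun_sum s hmi), lintegral_finsetSum _ hmi]
      have h2 : ∀ i ∈ s, ∫⁻ ω, ENNReal.ofReal (Real.exp (c * (G i ω / σ) ^ 2)) ∂P ≤ K :=
        fun i hi => by
          rw [(hlaw i hi).lintegral_comp (f := fun x => ENNReal.ofReal (Real.exp (c * (x / σ) ^ 2)))
            (by fun_prop)]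
          exact hK (v i) σ hσ (hv i hi)
      calc (ENNReal.ofReal M)⁻¹ * ∑ i ∈ s, ∫⁻ ω, ENNReal.ofReal (Real.exp (c * (G i ω / σ) ^ 2)) ∂P
          ≤ (ENNReal.ofReal M)⁻¹ * (s.card * (K : ℝ≥0∞)) := by
            gcongr
            refine (Finset.sum_le_sum h2).trans ?_
            rw [Finset.sum_const, nsmul_eq_mul]
        _ ≤ (ENNReal.ofReal M)⁻¹ * (ENNReal.ofReal M * (K : ℝ≥0∞)) := by
            gcongr
            rw [← ENNReal.ofReal_natCast]
            exact ENNReal.ofReal_le_ofReal hs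
        _ = K := by
            rw [← mul_assoc, ENNReal.inv_mul_cancel (by simpa using hM0) ENNReal.ofReal_ne_top,
              one_mul]
    calc ∫⁻ ω, ‖σ / √c * √(Real.log M + Real.log (1 + Y ω))‖ₑ ^ (2 * (q : ℝ)) ∂P
        ≤ ∫⁻ ω, ENNReal.ofReal A * (ENNReal.ofReal (Real.log M ^ q + q.factorial) +
          ENNReal.ofReal q.factorial * ENNReal.ofReal (Y ω)) ∂P := lintegral_mono hpt
      _ = ENNReal.ofReal A * (ENNReal.ofReal (Real.log M ^ q + q.factorial) +
          ENNReal.ofReal q.factorial * ∫⁻ ω, ENNReal.ofReal (Y ω) ∂P) := by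
          rw [lintegral_const_mul _ (by fun_prop), lintegral_add_left (by fun_prop),
            lintegral_const_mul _ (by fun_prop), lintegral_const, measure_univ, mul_one]
      _ ≤ ENNReal.ofReal A * (ENNReal.ofReal (Real.log M ^ q + q.factorial) +
          ENNReal.ofReal q.factorial * ENNReal.ofReal K) := by
          gcongr
          simpa using hYint
      _ = ENNReal.ofReal (A * (Real.log M ^ q + q.factorial * (1 + K))) := by
          rw [← ENNReal.ofReal_mul (by positivity), ← ENNReal.ofReal_add (by positivity)
            (by positivity), ← ENNReal.ofReal_mul hA0]
          congr 1
          ring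
      _ ≤ ENNReal.ofReal (√(2 * B / c) * σ * √(Real.log M)) ^ (2 * (q : ℝ)) := by
          have h0 : (√(2 * B / c) * σ * √(Real.log M)) ^ 2 =
              2 * B / c * σ ^ 2 * Real.log M := by
            rw [mul_pow, mul_pow, Real.sq_sqrt (by positivity), Real.sq_sqrt hlM0.le]
          rw [hpow _ (by positivity), h0]
          refine ENNReal.ofReal_le_ofReal ?_
          have h1 : q.factorial * (1 + (K : ℝ)) ≤
              q.factorial * (1 + K) / Real.log 2 ^ q * Real.log M ^ q := by
            rw [div_mul_eq_mul_div, le_div_iff₀ (by positivity)]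
            gcongr
          have h2 : B ≤ B ^ q := le_self_pow₀ hB1 (by omega)
          have h3 : Real.log M ^ q + q.factorial * (1 + (K : ℝ)) ≤ B ^ q * Real.log M ^ q := by
            have h4 : B * Real.log M ^ q ≤ B ^ q * Real.log M ^ q := by gcongr
            rw [hB] at h4 ⊢
            linarith
          calc A * (Real.log M ^ q + q.factorial * (1 + K)) ≤ A * (B ^ q * Real.log M ^ q) := by
                gcongr
            _ = _ := by
                rw [hA, ← mul_pow, ← mul_pow, ← mul_pow]
                congr 1
                ring

/-! ### Random series of paths: dyadic blocks, convergence and tails -/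

theorem eLpNorm_eval_gaussianSequence (p : ℝ≥0∞) (j : ℕ) :
    eLpNorm (fun ω : ℕ → ℝ => ω j) p gaussianSequence = eLpNorm id p (gaussianReal 0 1) := by
  have h := hasLaw_eval_gaussianSequence j
  rw [← h.map_eq]
  exact (eLpNorm_map_measure aestronglyMeasurable_id h.aemeasurable).symm

theorem exists_grid_point {T : ℝ} (hT : 0 < T) {N : ℕ} (hN : 0 < N) (t : Set.Icc (0 : ℝ) T) :
    ∃ i ∈ Finset.range (N + 1), |(t : ℝ) - Set.projIcc 0 T hT.le (T * i / N)| ≤ T / N := by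
  have hN' : (0 : ℝ) < N := by exact_mod_cast hN
  have h0 : 0 ≤ (t : ℝ) * N / T := div_nonneg (mul_nonneg t.2.1 hN'.le) hT.le
  have hle : ⌊(t : ℝ) * N / T⌋₊ ≤ N := by
    refine Nat.floor_le_of_le ?_
    rw [div_le_iff₀ hT, mul_comm]
    exact mul_le_mul_of_nonneg_left t.2.2 hN'.le
  refine ⟨⌊(t : ℝ) * N / T⌋₊, Finset.mem_range.2 (Nat.lt_succ_of_le hle), ?_⟩
  have h1 := Nat.floor_le h0
  have h2 := Nat.lt_floor_add_one ((t : ℝ) * N / T)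
  rw [le_div_iff₀ hT] at h1
  rw [div_lt_iff₀ hT] at h2
  have hle' : (⌊(t : ℝ) * N / T⌋₊ : ℝ) ≤ N := by exact_mod_cast hle
  have hmem : T * ⌊(t : ℝ) * N / T⌋₊ / N ∈ Set.Icc (0 : ℝ) T :=
    ⟨by positivity, by rw [div_le_iff₀ hN']; exact mul_le_mul_of_nonneg_left hle' hT.le⟩
  rw [Set.projIcc_of_mem _ hmem]
  have h3 : (t : ℝ) - T * ⌊(t : ℝ) * N / T⌋₊ / N =
      (t * N - T * ⌊(t : ℝ) * N / T⌋₊) / N := by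
    field_simp
  rw [h3, abs_div, abs_of_pos hN']
  refine div_le_div_of_nonneg_right ?_ hN'.le
  rw [abs_le]
  constructor <;> linarith

theorem two_rpow_neg_pow (ρ : ℝ) (k : ℕ) : ((2 : ℝ) ^ (-ρ)) ^ k = ((2 : ℝ) ^ k) ^ (-ρ) := by
  rw [← Real.rpow_natCast, ← Real.rpow_mul (by norm_num), mul_comm, Real.rpow_mul (by norm_num),
    Real.rpow_natCast]

theorem sum_sq_block_le {T ρ K : ℝ} (hρ : 0 < ρ) (hK : 0 ≤ K) {f : ℕ → PathSpace T}
    (hf : ∀ j, ‖f j‖ ≤ K * ((j : ℝ) + 1) ^ (-(ρ + 1 / 2))) (k n : ℕ) (hn : n ≤ 2 ^ k)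
    (t : Set.Icc (0 : ℝ) T) :
    ∑ j ∈ Finset.Ico (2 ^ k) (2 ^ k + n), f j t ^ 2 ≤ ((K + 1) * ((2 : ℝ) ^ (-ρ)) ^ k) ^ 2 := by
  have hk : (0 : ℝ) < 2 ^ k := by positivity
  have h1 : ∀ j ∈ Finset.Ico (2 ^ k) (2 ^ k + n),
      f j t ^ 2 ≤ K ^ 2 * ((2 : ℝ) ^ k) ^ (-(2 * ρ + 1)) := fun j hj => by
    have hj1 : (2 : ℝ) ^ k ≤ (j : ℝ) + 1 := by
      have h2 : 2 ^ k ≤ j := (Finset.mem_Ico.1 hj).1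
      have h3 : ((2 ^ k : ℕ) : ℝ) ≤ j := by exact_mod_cast h2
      push_cast at h3
      linarith
    have h4 : |f j t| ≤ K * ((2 : ℝ) ^ k) ^ (-(ρ + 1 / 2)) :=
      ((f j).norm_coe_le_norm t).trans ((hf j).trans (mul_le_mul_of_nonneg_left
        (Real.rpow_le_rpow_of_nonpos hk hj1 (by linarith)) hK))
    rw [← sq_abs]
    refine (pow_le_pow_left₀ (abs_nonneg _) h4 2).trans (le_of_eq ?_)
    rw [mul_pow, ← Real.rpow_natCast (((2 : ℝ) ^ k) ^ (-(ρ + 1 / 2))), ← Real.rpow_mul hk.le]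
    congr 2
    push_cast
    ring
  refine (Finset.sum_le_card_nsmul _ _ _ h1).trans ?_
  rw [Nat.card_Ico, add_tsub_cancel_left, nsmul_eq_mul, two_rpow_neg_pow, mul_pow]
  have h5 : (((2 : ℝ) ^ k) ^ (-ρ)) ^ 2 = 2 ^ k * ((2 : ℝ) ^ k) ^ (-(2 * ρ + 1)) := by
    rw [← Real.rpow_natCast, ← Real.rpow_mul hk.le]
    nth_rewrite 2 [← Real.rpow_one ((2 : ℝ) ^ k)]
    rw [← Real.rpow_add hk]
    congr 1
    push_cast
    ring
  rw [h5]
  have h6 : (n : ℝ) ≤ 2 ^ k := by exact_mod_cast hn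
  have h7 : K ^ 2 ≤ (K + 1) ^ 2 := by nlinarith
  calc (n : ℝ) * (K ^ 2 * ((2 : ℝ) ^ k) ^ (-(2 * ρ + 1)))
      ≤ 2 ^ k * ((K + 1) ^ 2 * ((2 : ℝ) ^ k) ^ (-(2 * ρ + 1))) := by gcongr
    _ = _ := by ring

/-- All partial sums of the `k`-th dyadic block are dominated by one random variable of `L^p` norm
`O(2 ^ (-ρ k) √k)`. The maximal inequality is applied to the values of all these partial sums on a
grid of `2 ^ (B k)` points; the Hölder condition controls what happens between grid points. -/
theorem exists_block_majorant {T ρ K K' a p : ℝ} (hT : 0 < T) (hρ : 0 < ρ) (hK : 0 ≤ K)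
    (hK' : 0 ≤ K') (ha : 0 < a) (hp : 1 ≤ p) {f : ℕ → PathSpace T}
    (hf : ∀ j, ‖f j‖ ≤ K * ((j : ℝ) + 1) ^ (-(ρ + 1 / 2)))
    (hf' : ∀ (j : ℕ) (s t : Set.Icc (0 : ℝ) T),
      |f j t - f j s| ≤ K' * ((j : ℝ) + 1) * |(t : ℝ) - s| ^ a) :
    ∃ C : ℝ, 0 ≤ C ∧ ∀ k : ℕ, 1 ≤ k → ∃ R : (ℕ → ℝ) → ℝ, Measurable R ∧
      eLpNorm R (ENNReal.ofReal p) gaussianSequence ≤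
        ENNReal.ofReal (C * (((2 : ℝ) ^ (-ρ)) ^ k * √k)) ∧
      ∀ (ω : ℕ → ℝ) (n : ℕ), n ≤ 2 ^ k →
        ‖∑ j ∈ Finset.Ico (2 ^ k) (2 ^ k + n), ω j • f j‖ ≤ R ω := by
  obtain ⟨C, hC, hmax⟩ := exists_gaussian_majorant (ι := ℕ × ℕ) gaussianSequence p
  have hp' : (1 : ℝ≥0∞) ≤ ENNReal.ofReal p := by simpa using ENNReal.ofReal_le_ofReal hp
  -- the exponent of the grid size: large enough to make the oscillation between grid points
  -- negligible
  obtain ⟨B, hB⟩ : ∃ B : ℕ, ρ + 2 ≤ a * B := by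
    obtain ⟨B, hB⟩ := exists_nat_ge ((ρ + 2) / a)
    exact ⟨B, by rwa [div_le_iff₀ ha, mul_comm] at hB⟩
  set m : ℝ := (eLpNorm id (ENNReal.ofReal p) (gaussianReal 0 1)).toReal with hm
  have hmtop : eLpNorm id (ENNReal.ofReal p) (gaussianReal 0 1) ≠ ∞ :=
    (memLp_id_gaussianReal' _ ENNReal.ofReal_ne_top).2.ne
  have hm0 : 0 ≤ m := ENNReal.toReal_nonneg
  have hnorm : ∀ j, eLpNorm (fun ω : ℕ → ℝ => ω j) (ENNReal.ofReal p) gaussianSequence =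
      ENNReal.ofReal m := fun j => by
    rw [hm, ENNReal.ofReal_toReal hmtop, eLpNorm_eval_gaussianSequence]
  refine ⟨C * (K + 1) * √((B + 3) * Real.log 2) + 2 * K' * T ^ a * m, by positivity, fun k hk => ?_⟩
  set N : ℕ := 2 ^ (B * k) with hN
  have hN0 : 0 < N := by positivity
  set G : ℕ × ℕ → (ℕ → ℝ) → ℝ := fun i ω => ∑ j ∈ Finset.Ico (2 ^ k) (2 ^ k + i.1),
    f j (Set.projIcc 0 T hT.le (T * i.2 / N)) * ω j with hG
  obtain ⟨R, hRm, hRle, hRp⟩ := hmax (Finset.range (2 ^ k + 1) ×ˢ Finset.range (N + 1)) G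
    (fun i => (∑ j ∈ Finset.Ico (2 ^ k) (2 ^ k + i.1),
      f j (Set.projIcc 0 T hT.le (T * i.2 / N)) ^ 2).toNNReal)
    ((K + 1) * ((2 : ℝ) ^ (-ρ)) ^ k) (2 ^ ((B + 3) * k)) (by positivity)
    (by
      have : (2 : ℝ) ^ 1 ≤ 2 ^ ((B + 3) * k) := pow_le_pow_right₀ (by norm_num) (by nlinarith)
      simpa using this)
    (by
      have h1 : (2 ^ k + 1) * (N + 1) ≤ 2 ^ ((B + 3) * k) := by
        have h2 : 2 ^ k + 1 ≤ 2 ^ (k + 1) := by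
          rw [pow_succ]
          have := Nat.one_le_two_pow (n := k)
          omega
        have h3 : N + 1 ≤ 2 ^ (B * k + 1) := by
          rw [pow_succ, hN]
          have := Nat.one_le_two_pow (n := B * k)
          omega
        calc (2 ^ k + 1) * (N + 1) ≤ 2 ^ (k + 1) * 2 ^ (B * k + 1) := Nat.mul_le_mul h2 h3
          _ = 2 ^ (k + 1 + (B * k + 1)) := (pow_add _ _ _).symm
          _ ≤ _ := Nat.pow_le_pow_right (by norm_num) (by nlinarith)
      rw [Finset.card_product, Finset.card_range, Finset.card_range]
      exact_mod_cast h1)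
    (fun i _ => by
      simp only [hG]
      fun_prop)
    (fun i _ => hasLaw_sum_gaussianSequence _ _)
    (fun i hi => by
      rw [Real.coe_toNNReal _ (Finset.sum_nonneg fun j _ => sq_nonneg _)]
      exact sum_sq_block_le hρ hK hf k i.1
        (Nat.lt_succ_iff.1 (Finset.mem_range.1 (Finset.mem_product.1 hi).1)) _)
  set D : (ℕ → ℝ) → ℝ := fun ω => ∑ j ∈ Finset.Ico ((2 : ℕ) ^ k) (2 ^ k + 2 ^ k),
    K' * ((j : ℝ) + 1) * (T / N) ^ a * |ω j| with hD
  have hDm : Measurable D := by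
    simp only [hD]
    fun_prop
  have hNr : (N : ℝ) = 2 ^ (B * k) := by
    rw [hN]
    push_cast
    rfl
  have hDp : eLpNorm D (ENNReal.ofReal p) gaussianSequence ≤
      ENNReal.ofReal (2 * K' * T ^ a * m * ((2 : ℝ) ^ (-ρ)) ^ k) := by
    have h1 : D = ∑ j ∈ Finset.Ico ((2 : ℕ) ^ k) (2 ^ k + 2 ^ k), fun ω : ℕ → ℝ =>
        K' * ((j : ℝ) + 1) * (T / N) ^ a * |ω j| := by
      ext ω
      simp [hD]
    have h2 : ∀ j ∈ Finset.Ico ((2 : ℕ) ^ k) (2 ^ k + 2 ^ k), eLpNorm (fun ω : ℕ → ℝ =>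
        K' * ((j : ℝ) + 1) * (T / N) ^ a * |ω j|) (ENNReal.ofReal p) gaussianSequence ≤
          ENNReal.ofReal (K' * 2 ^ (k + 1) * (T / N) ^ a * m) := fun j hj => by
      have h3 : eLpNorm (fun ω : ℕ → ℝ => K' * ((j : ℝ) + 1) * (T / N) ^ a * |ω j|)
          (ENNReal.ofReal p) gaussianSequence = ‖K' * ((j : ℝ) + 1) * (T / N) ^ a‖ₑ *
            eLpNorm (fun ω : ℕ → ℝ => ω j) (ENNReal.ofReal p) gaussianSequence := by
        rw [← eLpNorm_norm (fun ω : ℕ → ℝ => ω j)]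
        exact eLpNorm_const_smul (K' * ((j : ℝ) + 1) * (T / N) ^ a) _ _ _
      have h4 : (j : ℝ) + 1 ≤ 2 ^ (k + 1) := by
        have h5 := (Finset.mem_Ico.1 hj).2
        have h6 : j + 1 ≤ 2 ^ (k + 1) := by
          rw [pow_succ]
          omega
        exact_mod_cast h6
      rw [h3, hnorm, Real.enorm_of_nonneg (by positivity), ← ENNReal.ofReal_mul (by positivity)]
      exact ENNReal.ofReal_le_ofReal (by gcongr)
    rw [h1]
    refine (eLpNorm_sum_le (fun j _ => Measurable.aestronglyMeasurable (by fun_prop)) hp').trans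
      ((Finset.sum_le_card_nsmul _ _ _ h2).trans ?_)
    rw [Nat.card_Ico, add_tsub_cancel_left, nsmul_eq_mul, ← ENNReal.ofReal_natCast,
      ← ENNReal.ofReal_mul (by positivity)]
    refine ENNReal.ofReal_le_ofReal ?_
    have h7 : (2 : ℝ) ^ k * 2 ^ k * (((2 : ℝ) ^ (B * k)) ^ a)⁻¹ ≤ ((2 : ℝ) ^ (-ρ)) ^ k := by
      have h8 : (((2 : ℝ) ^ (B * k)) ^ a)⁻¹ = (2 : ℝ) ^ (-(a * B) * k) := by
        rw [← Real.rpow_natCast, ← Real.rpow_mul (by norm_num), ← Real.rpow_neg (by norm_num)]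
        congr 1
        push_cast
        ring
      have h9 : ((2 : ℝ) ^ (-ρ)) ^ k = (2 : ℝ) ^ (-ρ * k) := by
        rw [← Real.rpow_natCast, ← Real.rpow_mul (by norm_num)]
      rw [h8, h9, ← Real.rpow_natCast, ← Real.rpow_add (by norm_num),
        ← Real.rpow_add (by norm_num)]
      refine Real.rpow_le_rpow_of_exponent_le (by norm_num) ?_
      have : (0 : ℝ) ≤ k := k.cast_nonneg
      nlinarith
    rw [Real.div_rpow hT.le (by positivity), hNr]
    push_cast
    calc (2 : ℝ) ^ k * (K' * 2 ^ (k + 1) * (T ^ a / ((2 : ℝ) ^ (B * k)) ^ a) * m)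
        = 2 * K' * T ^ a * m * (2 ^ k * 2 ^ k * (((2 : ℝ) ^ (B * k)) ^ a)⁻¹) := by ring
      _ ≤ _ := by gcongr
  refine ⟨fun ω => R ω + D ω, hRm.add hDm, ?_, fun ω n hn => ?_⟩
  · refine (eLpNorm_add_le hRm.aestronglyMeasurable hDm.aestronglyMeasurable hp').trans
      ((add_le_add hRp hDp).trans ?_)
    rw [← ENNReal.ofReal_add (by positivity) (by positivity)]
    refine ENNReal.ofReal_le_ofReal ?_
    have h1 : √(Real.log (2 ^ ((B + 3) * k))) = √((B + 3) * Real.log 2) * √k := by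
      rw [Real.log_pow, ← Real.sqrt_mul (by positivity)]
      congr 1
      push_cast
      ring
    have h2 : 1 ≤ √(k : ℝ) := by
      rw [Real.one_le_sqrt]
      exact_mod_cast hk
    rw [h1]
    have h3 : 2 * K' * T ^ a * m * ((2 : ℝ) ^ (-ρ)) ^ k * 1 ≤
        2 * K' * T ^ a * m * ((2 : ℝ) ^ (-ρ)) ^ k * √k :=
      mul_le_mul_of_nonneg_left h2 (by positivity)
    linarith
  · have hD0 : 0 ≤ D ω := Finset.sum_nonneg fun j _ => by positivity
    have hR0 : 0 ≤ R ω := (abs_nonneg _).trans (hRle (0, 0) (by simp) ω)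
    rw [ContinuousMap.norm_le _ (add_nonneg hR0 hD0)]
    intro t
    obtain ⟨i, hi, hit⟩ := exists_grid_point hT hN0 t
    set u := Set.projIcc 0 T hT.le (T * i / N) with hu
    have h1 : (∑ j ∈ Finset.Ico (2 ^ k) (2 ^ k + n), ω j • f j) t =
        G (n, i) ω + ∑ j ∈ Finset.Ico (2 ^ k) (2 ^ k + n), (f j t - f j u) * ω j := by
      simp only [hG, ContinuousMap.coe_sum, Finset.sum_apply, ContinuousMap.coe_smul, Pi.smul_apply,
        smul_eq_mul, ← Finset.sum_add_distrib, ← hu]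
      exact Finset.sum_congr rfl fun j _ => by ring
    rw [h1, Real.norm_eq_abs]
    refine (abs_add_le _ _).trans (add_le_add (hRle (n, i) (Finset.mem_product.2
      ⟨Finset.mem_range.2 (Nat.lt_succ_of_le hn), hi⟩) ω) ?_)
    refine (Finset.abs_sum_le_sum_abs _ _).trans ?_
    refine le_trans (Finset.sum_le_sum fun j _ => ?_)
      (Finset.sum_le_sum_of_subset_of_nonneg (Finset.Ico_subset_Ico_right (by omega))
        fun j _ _ => ?_)
    · rw [abs_mul]
      refine mul_le_mul_of_nonneg_right ((hf' j u t).trans ?_) (abs_nonneg _)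
      exact mul_le_mul_of_nonneg_left (Real.rpow_le_rpow (abs_nonneg _) hit ha.le) (by positivity)
    · positivity

theorem summable_pow_mul_sqrt {x : ℝ} (hx0 : 0 ≤ x) (hx1 : x < 1) :
    Summable fun k : ℕ => x ^ k * √((k : ℝ) + 1) := by
  have h1 : Summable fun k : ℕ => (k : ℝ) ^ 1 * x ^ k :=
    summable_pow_mul_geometric_of_norm_lt_one 1 (by rwa [Real.norm_of_nonneg hx0])
  refine Summable.of_nonneg_of_le (fun k => by positivity) (fun k => ?_)
    (h1.add (summable_geometric_of_lt_one hx0 hx1))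
  have h2 : √((k : ℝ) + 1) ≤ k + 1 := by
    rw [Real.sqrt_le_left (by positivity)]
    have : (0 : ℝ) ≤ k := k.cast_nonneg
    nlinarith
  calc x ^ k * √((k : ℝ) + 1) ≤ x ^ k * (k + 1) := by gcongr
    _ = _ := by ring

/-- Convergence of a series whose dyadic blocks, together with all their partial sums, are
dominated by a summable sequence. -/
theorem exists_tendsto_sum_of_block_bound {E : Type*} [NormedAddCommGroup E] [CompleteSpace E]
    {u : ℕ → E} {R : ℕ → ℝ} (hR : Summable R)
    (h : ∀ᶠ k in atTop, ∀ n ≤ 2 ^ k, ‖∑ j ∈ Finset.Ico (2 ^ k) (2 ^ k + n), u j‖ ≤ R k) :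
    ∃ x, Tendsto (fun n => ∑ j ∈ Finset.range n, u j) atTop (𝓝 x) := by
  have hsub : ∀ k n, (∑ j ∈ Finset.range (2 ^ k + n), u j) - ∑ j ∈ Finset.range (2 ^ k), u j =
      ∑ j ∈ Finset.Ico (2 ^ k) (2 ^ k + n), u j := fun k n =>
    (Finset.sum_Ico_eq_sub _ (Nat.le_add_right _ _)).symm
  have hc : ∃ x, Tendsto (fun k => ∑ j ∈ Finset.range (2 ^ k), u j) atTop (𝓝 x) := by
    obtain ⟨k₀, hk₀⟩ := eventually_atTop.1 h
    have hs : Summable fun k => ∑ j ∈ Finset.Ico (2 ^ (k + k₀)) (2 ^ (k + k₀) + 2 ^ (k + k₀)), u j :=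
      Summable.of_norm_bounded ((summable_nat_add_iff k₀).2 hR)
        fun k => hk₀ _ (Nat.le_add_left _ _) _ le_rfl
    have h1 := (hs.hasSum.tendsto_sum_nat).add_const (∑ j ∈ Finset.range (2 ^ k₀), u j)
    refine ⟨_, (tendsto_add_atTop_iff_nat k₀).1 (h1.congr fun n => ?_)⟩
    have h2 : ∀ k, (∑ j ∈ Finset.Ico (2 ^ (k + k₀)) (2 ^ (k + k₀) + 2 ^ (k + k₀)), u j) =
        (∑ j ∈ Finset.range (2 ^ (k + 1 + k₀)), u j) - ∑ j ∈ Finset.range (2 ^ (k + k₀)), u j :=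
      fun k => by
        rw [← hsub]
        congr 3
        ring
    simp only [h2]
    rw [Finset.sum_range_sub (fun k => ∑ j ∈ Finset.range (2 ^ (k + k₀)), u j)]
    simp
  obtain ⟨x, hx⟩ := hc
  have hlog : Tendsto (fun n => Nat.log 2 n) atTop atTop := by
    refine tendsto_atTop.2 fun b => ?_
    filter_upwards [eventually_ge_atTop (2 ^ b)] with n hn
    exact Nat.le_log_of_pow_le (by norm_num) hn
  refine ⟨x, ?_⟩
  have h3 : Tendsto (fun n => (∑ j ∈ Finset.range n, u j) -
      ∑ j ∈ Finset.range (2 ^ Nat.log 2 n), u j) atTop (𝓝 0) := by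
    refine squeeze_zero_norm' ?_ (hR.tendsto_atTop_zero.comp hlog)
    filter_upwards [hlog.eventually h, eventually_ge_atTop 1] with n hn hn1
    have h4 : 2 ^ Nat.log 2 n ≤ n := Nat.pow_log_le_self 2 (by omega)
    have h5 : n < 2 ^ (Nat.log 2 n + 1) := Nat.lt_pow_succ_log_self (by norm_num) n
    obtain ⟨d, hd⟩ := Nat.exists_eq_add_of_le h4
    have h6 := hn d (by rw [pow_succ] at h5; omega)
    rw [← hsub, ← hd] at h6
    exact h6
  simpa using h3.add (hx.comp hlog)

theorem gaussianSeriesConverges_of_block_bound {T x C : ℝ} (hx0 : 0 ≤ x) (hx1 : x < 1) (hC : 0 ≤ C)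
    {f : ℕ → PathSpace T}
    (h : ∀ k : ℕ, 1 ≤ k → ∃ R : (ℕ → ℝ) → ℝ, Measurable R ∧
      eLpNorm R (ENNReal.ofReal 1) gaussianSequence ≤ ENNReal.ofReal (C * (x ^ k * √k)) ∧
      ∀ (ω : ℕ → ℝ) (n : ℕ), n ≤ 2 ^ k →
        ‖∑ j ∈ Finset.Ico (2 ^ k) (2 ^ k + n), ω j • f j‖ ≤ R ω) :
    GaussianSeriesConverges f := by
  choose! R hRm hRp hR using h
  have hsum : ∑' k : ℕ, ∫⁻ ω, ‖R (k + 1) ω‖ₑ ∂gaussianSequence ≠ ∞ := by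
    have h1 : ∀ k : ℕ, ∫⁻ ω, ‖R (k + 1) ω‖ₑ ∂gaussianSequence ≤
        ENNReal.ofReal (C * (x ^ k * √((k : ℝ) + 1))) := fun k => by
      rw [← eLpNorm_one_eq_lintegral_enorm, ← ENNReal.ofReal_one]
      refine (hRp (k + 1) (by omega)).trans (ENNReal.ofReal_le_ofReal ?_)
      push_cast
      have : x ^ (k + 1) ≤ x ^ k := pow_le_pow_of_le_one hx0 hx1.le (Nat.le_succ k)
      gcongr
    refine ne_top_of_le_ne_top ?_ (ENNReal.tsum_le_tsum h1)
    have h2 := ((summable_pow_mul_sqrt hx0 hx1).mul_left C)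
    exact h2.tsum_ofReal_ne_top
  rw [← lintegral_tsum fun k => ((hRm (k + 1) (by omega)).enorm).aemeasurable] at hsum
  have hfin := ae_lt_top' (AEMeasurable.tsum fun k =>
    ((hRm (k + 1) (by omega)).enorm).aemeasurable) hsum
  filter_upwards [hfin] with ω hω
  have h3 : Summable fun k => R (k + 1) ω := by
    refine Summable.of_norm ?_
    have h4 := ENNReal.summable_toReal hω.ne
    simpa using h4
  have h4 : Summable fun k => R k ω := (summable_nat_add_iff (f := fun k => R k ω) 1).1 h3
  refine exists_tendsto_sum_of_block_bound (u := fun j => ω j • f j) h4 ?_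
  filter_upwards [eventually_ge_atTop 1] with k hk n hn
  exact hR k hk ω n hn

theorem aestronglyMeasurable_partialSum {T : ℝ} (f : ℕ → PathSpace T) (s : Finset ℕ) :
    AEStronglyMeasurable (fun ω : ℕ → ℝ => ∑ j ∈ s, ω j • f j) gaussianSequence :=
  Finset.aestronglyMeasurable_fun_sum s fun j _ =>
    ((measurable_pi_apply j).stronglyMeasurable.smul_const (f j)).aestronglyMeasurable

theorem tendsto_gaussianSeries {E : Type*} [NormedAddCommGroup E] [NormedSpace ℝ E] {f : ℕ → E}
    (hf : GaussianSeriesConverges f) :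
    ∀ᵐ ω ∂gaussianSequence, Tendsto (fun n => ∑ j ∈ Finset.range n, ω j • f j) atTop
      (𝓝 (gaussianSeries f ω)) := by
  filter_upwards [hf] with ω hω
  exact tendsto_nhds_limUnder hω

theorem aestronglyMeasurable_gaussianSeries {T : ℝ} {f : ℕ → PathSpace T}
    (hf : GaussianSeriesConverges f) :
    AEStronglyMeasurable (gaussianSeries f) gaussianSequence :=
  aestronglyMeasurable_of_tendsto_ae atTop (fun _ => aestronglyMeasurable_partialSum f _)
    (tendsto_gaussianSeries hf)

/-- The tail of the series after a dyadic index is a sum of dyadic blocks, the first of which dominates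
up to a constant. -/
theorem eLpNorm_gaussianSeries_sub_le {T x C p : ℝ} (hx0 : 0 ≤ x) (hx1 : x < 1) (hC : 0 ≤ C)
    (hp : 1 ≤ p) {f : ℕ → PathSpace T} (hf : GaussianSeriesConverges f)
    (h : ∀ k : ℕ, 1 ≤ k → ∃ R : (ℕ → ℝ) → ℝ, Measurable R ∧
      eLpNorm R (ENNReal.ofReal p) gaussianSequence ≤ ENNReal.ofReal (C * (x ^ k * √k)) ∧
      ∀ (ω : ℕ → ℝ) (n : ℕ), n ≤ 2 ^ k →
        ‖∑ j ∈ Finset.Ico (2 ^ k) (2 ^ k + n), ω j • f j‖ ≤ R ω) (k : ℕ) (hk : 1 ≤ k) :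
    eLpNorm (fun ω => gaussianSeries f ω - ∑ j ∈ Finset.range (2 ^ k), ω j • f j)
      (ENNReal.ofReal p) gaussianSequence ≤
        ENNReal.ofReal (C * (∑' i : ℕ, x ^ i * √((i : ℝ) + 1)) * (x ^ k * √k)) := by
  have hp' : (1 : ℝ≥0∞) ≤ ENNReal.ofReal p := by simpa using ENNReal.ofReal_le_ofReal hp
  set S : ℕ → (ℕ → ℝ) → PathSpace T := fun i ω => ∑ j ∈ Finset.range (2 ^ i), ω j • f j with hS
  have hSm : ∀ i, AEStronglyMeasurable (S i) gaussianSequence := fun i =>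
    aestronglyMeasurable_partialSum f _
  have hsum := summable_pow_mul_sqrt hx0 hx1
  have hlim : ∀ᵐ ω ∂gaussianSequence, Tendsto (fun n => S (n + k) ω - S k ω) atTop
      (𝓝 (gaussianSeries f ω - S k ω)) := by
    filter_upwards [tendsto_gaussianSeries hf] with ω hω
    have h1 : Tendsto (fun n : ℕ => 2 ^ (n + k)) atTop atTop :=
      (tendsto_pow_atTop_atTop_of_one_lt (by norm_num : 1 < 2)).comp (tendsto_add_atTop_nat k)
    exact (hω.comp h1).sub_const _
  refine (Lp.eLpNorm_lim_le_liminf_eLpNorm (fun n => (hSm (n + k)).sub (hSm k)) _ hlim).trans ?_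
  refine liminf_le_of_le (by isBoundedDefault) fun b hb => ?_
  obtain ⟨n, hn⟩ := hb.exists
  refine hn.trans ?_
  have hdiff : ∀ i, eLpNorm (fun ω => S (i + 1 + k) ω - S (i + k) ω) (ENNReal.ofReal p)
      gaussianSequence ≤ ENNReal.ofReal (C * (x ^ k * √k) * (x ^ i * √((i : ℝ) + 1))) := fun i => by
    obtain ⟨R, -, hRp, hR⟩ := h (i + k) (by omega)
    refine (eLpNorm_mono_real (g := R) fun ω => ?_).trans
      (hRp.trans (ENNReal.ofReal_le_ofReal ?_))
    · have h2 := hR ω (2 ^ (i + k)) le_rfl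
      rw [Finset.sum_Ico_eq_sub _ (Nat.le_add_right _ _)] at h2
      rw [show i + 1 + k = (i + k) + 1 by ring]
      simp only [hS]
      rw [pow_succ, mul_two]
      exact h2
    · have h3 : √((i + k : ℕ) : ℝ) ≤ √k * √((i : ℝ) + 1) := by
        rw [← Real.sqrt_mul (by positivity)]
        refine Real.sqrt_le_sqrt ?_
        have h4 : (1 : ℝ) ≤ k := by exact_mod_cast hk
        have h5 : (0 : ℝ) ≤ i := i.cast_nonneg
        push_cast
        nlinarith
      calc C * (x ^ (i + k) * √((i + k : ℕ) : ℝ)) ≤ C * (x ^ (i + k) * (√k * √((i : ℝ) + 1))) := by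
            gcongr
        _ = _ := by rw [pow_add]; ring
  have htel : (S (n + k) - S k) = ∑ i ∈ Finset.range n, fun ω => S (i + 1 + k) ω - S (i + k) ω := by
    funext ω
    rw [Finset.sum_apply, Finset.sum_range_sub (fun i => S (i + k) ω)]
    simp
  calc eLpNorm (S (n + k) - S k) (ENNReal.ofReal p) gaussianSequence
      ≤ ∑ i ∈ Finset.range n, ENNReal.ofReal (C * (x ^ k * √k) * (x ^ i * √((i : ℝ) + 1))) := by
        rw [htel]
        exact (eLpNorm_sum_le (fun i _ => (hSm _).sub (hSm _)) hp').trans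
          (Finset.sum_le_sum fun i _ => hdiff i)
    _ = ENNReal.ofReal (C * (x ^ k * √k) * ∑ i ∈ Finset.range n, x ^ i * √((i : ℝ) + 1)) := by
        rw [Finset.mul_sum, ENNReal.ofReal_sum_of_nonneg fun i _ => by positivity]
    _ ≤ _ := by
        refine ENNReal.ofReal_le_ofReal ?_
        have := hsum.sum_le_tsum (Finset.range n) fun i _ => by positivity
        rw [mul_right_comm]
        gcongr

/-! ### Optimal quantization of real random variables -/

theorem exists_enumeration_of_encard_le {α : Type*} [Inhabited α] {s : Set α} {N : ℕ}
    (hs : s.encard ≤ N) : ∃ e : ℕ → α, ∀ y ∈ s, ∃ i < N, e i = y := by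
  have hfin : s.Finite := Set.finite_of_encard_le_coe hs
  refine ⟨fun i => hfin.toFinset.toList.getD i default, fun y hy => ?_⟩
  have hy' : y ∈ hfin.toFinset.toList := by simpa using hy
  obtain ⟨i, hi, rfl⟩ := List.getElem_of_mem hy'
  have hlen : hfin.toFinset.toList.length ≤ N := by
    rw [Finset.length_toList]
    rw [hfin.encard_eq_coe_toFinset_card] at hs
    exact_mod_cast hs
  exact ⟨i, hi.trans_le hlen, List.getD_eq_getElem _ _ hi⟩

theorem isQuantization_nearestPt_comp {Ω : Type*} [MeasurableSpace Ω] {X : Ω → ℝ}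
    (hX : Measurable X) (e : ℕ → ℝ) {N : ℕ} (hN : 1 ≤ N) :
    IsQuantization N fun ω => SimpleFunc.nearestPt e (N - 1) (X ω) := by
  refine ⟨(SimpleFunc.nearestPt e (N - 1)).measurable.comp hX, ?_⟩
  have h1 : Set.range (fun ω => SimpleFunc.nearestPt e (N - 1) (X ω)) ⊆
      e '' (Finset.range N : Set ℕ) := by
    rintro _ ⟨ω, rfl⟩
    have h2 := SimpleFunc.nearestPtInd_le e (N - 1) (X ω)
    exact ⟨SimpleFunc.nearestPtInd e (N - 1) (X ω), by simpa using by omega, rfl⟩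
  refine (Set.encard_le_encard h1).trans ((Set.encard_image_le _ _).trans ?_)
  rw [Set.encard_coe_eq_coe_finsetCard, Finset.card_range]

theorem tendsto_abs_sub_atTop_of_tendsto_coe {a : ℕ → ℝ} {b : EReal}
    (hab : Tendsto (fun k => (a k : EReal)) atTop (𝓝 b)) (hb : b = ⊤ ∨ b = ⊥) (x : ℝ) :
    Tendsto (fun k => |x - a k|) atTop atTop := by
  rcases hb with rfl | rfl
  · have h := EReal.tendsto_coe_nhds_top_iff.1 hab
    have h2 : Tendsto (fun k => x - a k) atTop atBot :=
      tendsto_atBot_add_const_left _ x (tendsto_neg_atTop_atBot.comp h)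
    exact tendsto_abs_atBot_atTop.comp h2
  · have h := EReal.tendsto_coe_nhds_bot_iff.1 hab
    have h2 : Tendsto (fun k => x - a k) atTop atTop :=
      tendsto_atTop_add_const_left _ x (tendsto_neg_atBot_atTop.comp h)
    exact tendsto_abs_atTop_atTop.comp h2

theorem ofReal_rpow_le_liminf_of_forall_lt {r d : ℝ} (hr : 0 < r) {u : ℕ → ℝ}
    (h : ∀ c < d, ∀ᶠ k in atTop, c < |u k|) :
    ENNReal.ofReal d ^ r ≤ liminf (fun k => ‖u k‖ₑ ^ r) atTop := by
  have hcont : Tendsto (fun c : ℝ => ENNReal.ofReal c ^ r) (𝓝[<] d) (𝓝 (ENNReal.ofReal d ^ r)) :=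
    (((ENNReal.continuous_rpow_const (y := r)).comp ENNReal.continuous_ofReal).tendsto
      d).mono_left nhdsWithin_le_nhds
  refine le_of_tendsto hcont (eventually_mem_nhdsWithin.mono fun c hc => ?_)
  refine le_liminf_of_le (by isBoundedDefault) ((h c hc).mono fun k hk => ?_)
  rw [Real.enorm_eq_ofReal_abs]
  exact ENNReal.rpow_le_rpow (ENNReal.ofReal_le_ofReal hk.le) hr.le

/-- Optimal quantizations of real random variables exist at every level `N ≥ 1`: the `N`-tuples of
values of a minimizing sequence converge, along a subsequence, in `[-∞, ∞]^N`; limit points at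
infinity can be discarded, and Fatou's lemma shows that the nearest-point projection onto the
remaining ones is optimal. -/
theorem exists_isOptimalQuantization {Ω : Type*} [MeasurableSpace Ω] (P : Measure Ω)
    [IsProbabilityMeasure P] {r : ℝ} (hr : 0 < r) {X : Ω → ℝ}
    (hX : MemLp X (ENNReal.ofReal r) P) {N : ℕ} (hN : 1 ≤ N) :
    ∃ Y, IsOptimalQuantization P N r X Y := by
  set m := minimalQuantizationError P N r X with hm
  have hmtop : m ≠ ∞ := by
    have h0 : IsQuantization N (fun _ : Ω => (0 : ℝ)) := by
      refine ⟨measurable_const, (Set.encard_le_encard (t := {0}) ?_).trans ?_⟩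
      · rintro _ ⟨ω, rfl⟩
        rfl
      · rw [Set.encard_singleton]
        exact_mod_cast hN
    have h1 : m ≤ quantizationError P r X fun _ => 0 := iInf₂_le (fun _ : Ω => (0 : ℝ)) h0
    refine ne_top_of_le_ne_top ?_ h1
    simpa [quantizationError] using hX.2.ne
  have hseq : ∀ k : ℕ, ∃ Y : Ω → ℝ, IsQuantization N Y ∧
      quantizationError P r X Y ≤ m + ((k : ℝ≥0∞) + 1)⁻¹ := fun k => by
    have h1 : m < m + ((k : ℝ≥0∞) + 1)⁻¹ :=
      ENNReal.lt_add_right hmtop (ENNReal.inv_ne_zero.2 (by finiteness))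
    obtain ⟨Y, hY⟩ := iInf_lt_iff.1 h1
    obtain ⟨hY1, hY2⟩ := iInf_lt_iff.1 hY
    exact ⟨Y, hY1, hY2.le⟩
  choose Y hY hYm using hseq
  have hpts : ∀ k, ∃ e : ℕ → ℝ, ∀ ω, ∃ i < N, e i = Y k ω := fun k => by
    obtain ⟨e, he⟩ := exists_enumeration_of_encard_le (hY k).2
    exact ⟨e, fun ω => he _ ⟨ω, rfl⟩⟩
  choose a ha using hpts
  obtain ⟨b, φ, hφ, hb⟩ := CompactSpace.tendsto_subseq fun k (i : ℕ) => (a k i : EReal)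
  have hbi : ∀ i, Tendsto (fun k => (a (φ k) i : EReal)) atTop (𝓝 (b i)) := fun i =>
    (tendsto_pi_nhds.1 hb) i
  have hXm : AEMeasurable X P := hX.1.aemeasurable
  have hmeas : ∀ k, AEMeasurable (fun ω => ‖X ω - Y (φ k) ω‖ₑ ^ r) P := fun k =>
    ((hXm.sub (hY (φ k)).1.aemeasurable).enorm).pow_const r
  have hliminf : liminf (fun k => ∫⁻ ω, ‖X ω - Y (φ k) ω‖ₑ ^ r ∂P) atTop ≤ m ^ r := by
    have h1 : Tendsto (fun k : ℕ => (m + ((φ k : ℝ≥0∞) + 1)⁻¹) ^ r) atTop (𝓝 (m ^ r)) := by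
      have h2 : Tendsto (fun k : ℕ => ((k : ℝ≥0∞) + 1)⁻¹) atTop (𝓝 0) := by
        have h3 := (tendsto_add_atTop_iff_nat 1).2 ENNReal.tendsto_inv_nat_nhds_zero
        refine h3.congr fun n => ?_
        push_cast
        rfl
      have h3 := (h2.comp hφ.tendsto_atTop).const_add m
      rw [add_zero] at h3
      exact (ENNReal.continuous_rpow_const.tendsto m).comp h3
    rw [← h1.liminf_eq]
    refine liminf_le_liminf (Eventually.of_forall fun k => ?_)
    rw [← eLpNorm_ofReal_rpow hr]
    exact ENNReal.rpow_le_rpow (hYm (φ k)) hr.le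
  have hfatou := (lintegral_liminf_le' hmeas).trans hliminf
  have hforall : ∀ (ω : Ω) (c : ℝ), (∀ i < N, ∀ᶠ k in atTop, c < |X ω - a (φ k) i|) →
      ∀ᶠ k in atTop, c < |X ω - Y (φ k) ω| := fun ω c h => by
    have h1 : ∀ᶠ k in atTop, ∀ i ∈ Finset.range N, c < |X ω - a (φ k) i| :=
      (Finset.eventually_all _).2 fun i hi => h i (Finset.mem_range.1 hi)
    filter_upwards [h1] with k hk
    obtain ⟨i, hi, hia⟩ := ha (φ k) ω
    rw [← hia]
    exact hk i (Finset.mem_range.2 hi)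
  by_cases hfin : ∃ i < N, ¬ (b i = ⊤ ∨ b i = ⊥)
  · -- limit points at infinity are replaced by a finite one, which only adds repetitions
    obtain ⟨i₀, hi₀, hb₀⟩ := hfin
    classical
    set e : ℕ → ℝ := fun i => if b i = ⊤ ∨ b i = ⊥ then (b i₀).toReal else (b i).toReal with he
    set Z : Ω → ℝ := fun ω => SimpleFunc.nearestPt e (N - 1) (hXm.mk X ω) with hZ
    have hZq : IsQuantization N Z := isQuantization_nearestPt_comp hXm.measurable_mk e hN
    refine ⟨Z, hZq, le_antisymm ?_ (iInf₂_le Z hZq)⟩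
    refine eLpNorm_ofReal_le_of_lintegral_le hr (le_trans (lintegral_mono_ae ?_) hfatou)
    filter_upwards [hXm.ae_eq_mk] with ω hω
    rw [Real.enorm_eq_ofReal_abs]
    refine ofReal_rpow_le_liminf_of_forall_lt hr fun c hc => hforall ω c fun i hi => ?_
    by_cases hbi' : b i = ⊤ ∨ b i = ⊥
    · exact (tendsto_abs_sub_atTop_of_tendsto_coe (hbi i) hbi' (X ω)).eventually_gt_atTop c
    · have h1 : Tendsto (fun k => a (φ k) i) atTop (𝓝 (e i)) := by
        have h2 := (EReal.tendsto_toReal (a := b i) (fun h => hbi' (Or.inl h))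
          fun h => hbi' (Or.inr h)).comp (hbi i)
        simp only [he, if_neg hbi']
        exact h2
      have h3 : |X ω - Z ω| ≤ |X ω - e i| := by
        have h4 := SimpleFunc.edist_nearestPt_le e (hXm.mk X ω) (k := i) (N := N - 1) (by omega)
        rw [edist_dist, edist_dist, ENNReal.ofReal_le_ofReal_iff dist_nonneg, Real.dist_eq,
          Real.dist_eq, abs_sub_comm, abs_sub_comm (e i), ← hω] at h4
        simp only [hZ]
        rw [← hω]
        exact h4
      exact ((h1.const_sub (X ω)).abs).eventually_const_lt (hc.trans_le h3)
  · -- if all the values escaped to infinity, the errors would be unbounded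
    exfalso
    push Not at hfin
    have htop : ∀ ω, liminf (fun k => ‖X ω - Y (φ k) ω‖ₑ ^ r) atTop = ∞ := fun ω => by
      refine top_unique (le_of_tendsto (f := fun d : ℝ => ENNReal.ofReal d ^ r) (x := atTop) ?_
        (Eventually.of_forall fun d => ofReal_rpow_le_liminf_of_forall_lt hr (d := d)
          fun c _ => hforall ω c fun i hi =>
            (tendsto_abs_sub_atTop_of_tendsto_coe (hbi i) (hfin i hi) (X ω)).eventually_gt_atTop c))
      have h1 := (ENNReal.continuous_rpow_const (y := r)).tendsto ∞
      rw [ENNReal.top_rpow_of_pos hr] at h1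
      exact h1.comp ENNReal.tendsto_ofReal_atTop
    simp only [htop, lintegral_const, measure_univ, mul_one, top_le_iff] at hfatou
    exact (ENNReal.rpow_ne_top_of_nonneg hr.le hmtop) hfatou

/-- Any polynomial decay of the quantization error is enough here; the rate `K ^ (-1/2)` comes from
the uniform grid of step `1 / √K` on `[-√K, √K]`. -/
theorem exists_minimalQuantizationError_le {Ω : Type*} [MeasurableSpace Ω] (P : Measure Ω)
    [IsProbabilityMeasure P] {r : ℝ} (hr : 0 < r) {B : ℝ≥0∞} (hB : B ≠ ∞) :
    ∃ C : ℝ, 0 ≤ C ∧ ∀ X : Ω → ℝ, AEMeasurable X P → eLpNorm X (ENNReal.ofReal (2 * r)) P ≤ B →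
      ∀ K N : ℕ, 1 ≤ K → 2 * K ≤ N → minimalQuantizationError P N r X ≤ ENNReal.ofReal (C / √K) := by
  have h2r : 0 < 2 * r := by linarith
  set I : ℝ≥0∞ := 1 + B ^ (2 * r) with hI
  have hItop : I ^ (1 / r) ≠ ∞ := by
    refine ENNReal.rpow_ne_top_of_nonneg (by positivity) (ENNReal.add_ne_top.2 ⟨by simp, ?_⟩)
    exact ENNReal.rpow_ne_top_of_nonneg h2r.le hB
  refine ⟨(I ^ (1 / r)).toReal, ENNReal.toReal_nonneg, fun X hXm hXB K N hK hN => ?_⟩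
  have hK0 : (0 : ℝ) < K := by exact_mod_cast hK
  have hs : 0 < √(K : ℝ) := Real.sqrt_pos.2 hK0
  have hss : √(K : ℝ) * √K = K := Real.mul_self_sqrt hK0.le
  set g : ℝ → ℝ := fun x => if |x| < √K then (⌊x * √K⌋ : ℝ) / √K else 0 with hg
  have hgm : Measurable g :=
    Measurable.ite (measurableSet_lt (by fun_prop) measurable_const) (by fun_prop) measurable_const
  have hgq : IsQuantization N fun ω => g (hXm.mk X ω) := by
    refine ⟨hgm.comp hXm.measurable_mk, ?_⟩
    have h1 : Set.range (fun ω => g (hXm.mk X ω)) ⊆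
        (fun i : ℤ => (i : ℝ) / √K) '' (Finset.Ico (-(K : ℤ)) K : Set ℤ) := by
      rintro _ ⟨ω, rfl⟩
      simp only [hg]
      split_ifs with h
      · rw [abs_lt] at h
        refine ⟨_, ?_, rfl⟩
        rw [Finset.coe_Ico, Set.mem_Ico, Int.le_floor, Int.floor_lt]
        push_cast
        constructor <;> nlinarith
      · exact ⟨0, by simpa using Nat.lt_of_succ_le hK, by simp⟩
    refine (Set.encard_le_encard h1).trans ((Set.encard_image_le _ _).trans ?_)
    rw [Set.encard_coe_eq_coe_finsetCard, Int.card_Ico]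
    have h2 : ((K : ℤ) - -(K : ℤ)).toNat ≤ N := by omega
    exact_mod_cast h2
  refine (iInf₂_le _ hgq).trans (eLpNorm_ofReal_le_of_lintegral_le hr ?_)
  have hpt : ∀ x : ℝ, ‖x - g x‖ₑ ^ r ≤
      ENNReal.ofReal (1 / √K) ^ r * (1 + ‖x‖ₑ ^ (2 * r)) := fun x => by
    simp only [hg]
    split_ifs with h
    · have h1 : |x - (⌊x * √K⌋ : ℝ) / √K| ≤ 1 / √K := by
        have h2 := Int.floor_le (x * √K)
        have h3 := Int.lt_floor_add_one (x * √K)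
        have h4 : x - (⌊x * √K⌋ : ℝ) / √K = (x * √K - ⌊x * √K⌋) / √K := by field_simp
        rw [h4, abs_div, abs_of_pos hs, abs_of_nonneg (by linarith)]
        exact div_le_div_of_nonneg_right (by linarith) hs.le
      rw [Real.enorm_eq_ofReal_abs]
      calc _ ≤ ENNReal.ofReal (1 / √K) ^ r * 1 := by
            rw [mul_one]
            exact ENNReal.rpow_le_rpow (ENNReal.ofReal_le_ofReal h1) hr.le
        _ ≤ _ := by gcongr; exact le_self_add
    · rw [sub_zero]
      push Not at h
      have h1 : 1 ≤ 1 / √K * |x| := by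
        rw [one_div, inv_mul_eq_div, one_le_div hs]
        exact h
      have h2 : (1 : ℝ≥0∞) ≤ ENNReal.ofReal (1 / √K) ^ r * ‖x‖ₑ ^ r := by
        rw [← ENNReal.mul_rpow_of_nonneg _ _ hr.le, Real.enorm_eq_ofReal_abs,
          ← ENNReal.ofReal_mul (by positivity)]
        exact ENNReal.one_le_rpow (by simpa using ENNReal.ofReal_le_ofReal h1) hr
      calc ‖x‖ₑ ^ r ≤ ENNReal.ofReal (1 / √K) ^ r * ‖x‖ₑ ^ r * ‖x‖ₑ ^ r :=
            le_mul_of_one_le_left zero_le h2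
        _ = ENNReal.ofReal (1 / √K) ^ r * ‖x‖ₑ ^ (2 * r) := by
            rw [mul_assoc, two_mul, ENNReal.rpow_add_of_nonneg _ _ hr.le hr.le]
        _ ≤ _ := by gcongr; exact le_add_self
  calc ∫⁻ ω, ‖X ω - g (hXm.mk X ω)‖ₑ ^ r ∂P
      ≤ ∫⁻ ω, ENNReal.ofReal (1 / √K) ^ r * (1 + ‖X ω‖ₑ ^ (2 * r)) ∂P := by
        refine lintegral_mono_ae ?_
        filter_upwards [hXm.ae_eq_mk] with ω hω
        rw [← hω]
        exact hpt _
    _ ≤ ENNReal.ofReal (1 / √K) ^ r * I := by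
        rw [lintegral_const_mul'' _ ((hXm.enorm.pow_const _).const_add 1),
          lintegral_add_left measurable_const, lintegral_const, measure_univ, mul_one, hI,
          ← eLpNorm_ofReal_rpow h2r]
        gcongr
    _ = ENNReal.ofReal ((I ^ (1 / r)).toReal / √K) ^ r := by
        rw [div_eq_mul_one_div (I ^ (1 / r)).toReal, ENNReal.ofReal_mul ENNReal.toReal_nonneg,
          ENNReal.ofReal_toReal hItop, ENNReal.mul_rpow_of_nonneg _ _ hr.le, one_div r,
          ENNReal.rpow_inv_rpow hr.ne', mul_comm]

/-! ### The error of product quantizations -/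

theorem ENNReal.sum_rpow_le_card_rpow_mul_sum {ι : Type*} (s : Finset ι) (x : ι → ℝ≥0∞) {r : ℝ}
    (hr : 0 < r) : (∑ i ∈ s, x i) ^ r ≤ (s.card : ℝ≥0∞) ^ r * ∑ i ∈ s, x i ^ r := by
  rcases s.eq_empty_or_nonempty with rfl | hs
  · simp [hr]
  · obtain ⟨i, hi, hmax⟩ := s.exists_max_image x hs
    calc (∑ i ∈ s, x i) ^ r ≤ (s.card * x i) ^ r := by
          refine ENNReal.rpow_le_rpow ?_ hr.le
          rw [← nsmul_eq_mul]
          exact Finset.sum_le_card_nsmul _ _ _ hmax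
      _ = (s.card : ℝ≥0∞) ^ r * x i ^ r := ENNReal.mul_rpow_of_nonneg _ _ hr.le
      _ ≤ _ := by
          gcongr
          exact Finset.single_le_sum (f := fun i => x i ^ r) (fun _ _ => zero_le) hi

/-- A crude bound, valid for all `r > 0`; the power of the number of terms is harmless because the
errors of the coordinates will be made polynomially small. -/
theorem eLpNorm_sum_smul_le {Ω E : Type*} [MeasurableSpace Ω] [NormedAddCommGroup E]
    [NormedSpace ℝ E] {P : Measure Ω} {r : ℝ} (hr : 0 < r) {m : ℕ} {d : Fin m → Ω → ℝ}
    {b : Fin m → E} {K : ℝ} (hd : ∀ j, AEMeasurable (d j) P) (hb : ∀ j, ‖b j‖ ≤ K) {ε : ℝ≥0∞}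
    (hε : ∀ j, eLpNorm (d j) (ENNReal.ofReal r) P ≤ ε) :
    eLpNorm (fun ω => ∑ j, d j ω • b j) (ENNReal.ofReal r) P ≤
      ENNReal.ofReal K * (m : ℝ≥0∞) ^ (1 + 1 / r) * ε := by
  refine eLpNorm_ofReal_le_of_lintegral_le hr ?_
  have hpt : ∀ ω, ‖∑ j, d j ω • b j‖ₑ ^ r ≤
      (ENNReal.ofReal K) ^ r * ((m : ℝ≥0∞) ^ r * ∑ j, ‖d j ω‖ₑ ^ r) := fun ω => by
    have h1 : ‖∑ j, d j ω • b j‖ₑ ≤ ENNReal.ofReal K * ∑ j, ‖d j ω‖ₑ := by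
      refine (enorm_sum_le _ _).trans ?_
      rw [Finset.mul_sum]
      refine Finset.sum_le_sum fun j _ => ?_
      rw [enorm_smul, mul_comm]
      gcongr
      rw [← ofReal_norm]
      exact ENNReal.ofReal_le_ofReal (hb j)
    refine (ENNReal.rpow_le_rpow h1 hr.le).trans ?_
    rw [ENNReal.mul_rpow_of_nonneg _ _ hr.le]
    gcongr
    have := ENNReal.sum_rpow_le_card_rpow_mul_sum Finset.univ (fun j => ‖d j ω‖ₑ) hr
    rwa [Finset.card_univ, Fintype.card_fin] at this
  have hm : ∀ j ∈ (Finset.univ : Finset (Fin m)), AEMeasurable (fun ω => ‖d j ω‖ₑ ^ r) P :=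
    fun j _ => (hd j).enorm.pow_const r
  calc ∫⁻ ω, ‖∑ j, d j ω • b j‖ₑ ^ r ∂P
      ≤ ∫⁻ ω, (ENNReal.ofReal K) ^ r * ((m : ℝ≥0∞) ^ r * ∑ j, ‖d j ω‖ₑ ^ r) ∂P :=
        lintegral_mono hpt
    _ = (ENNReal.ofReal K) ^ r * ((m : ℝ≥0∞) ^ r * ∑ j, ∫⁻ ω, ‖d j ω‖ₑ ^ r ∂P) := by
        rw [lintegral_const_mul'' _ ((Finset.aemeasurable_fun_sum _ hm).const_mul _),
          lintegral_const_mul'' _ (Finset.aemeasurable_fun_sum _ hm), lintegral_finsetSum' _ hm]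
    _ ≤ (ENNReal.ofReal K) ^ r * ((m : ℝ≥0∞) ^ r * (m * ε ^ r)) := by
        gcongr
        have h2 : ∀ j ∈ (Finset.univ : Finset (Fin m)), ∫⁻ ω, ‖d j ω‖ₑ ^ r ∂P ≤ ε ^ r :=
          fun j _ => by
            rw [← eLpNorm_ofReal_rpow hr]
            exact ENNReal.rpow_le_rpow (hε j) hr.le
        have := Finset.sum_le_card_nsmul _ _ _ h2
        rwa [Finset.card_univ, Fintype.card_fin, nsmul_eq_mul] at this
    _ = (ENNReal.ofReal K * (m : ℝ≥0∞) ^ (1 + 1 / r) * ε) ^ r := by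
        rw [ENNReal.mul_rpow_of_nonneg _ _ hr.le, ENNReal.mul_rpow_of_nonneg _ _ hr.le,
          ← ENNReal.rpow_mul, add_mul, one_mul, one_div, inv_mul_cancel₀ hr.ne',
          ENNReal.rpow_add_of_nonneg _ _ hr.le zero_le_one, ENNReal.rpow_one]
        ring

theorem memLp_eval_gaussianSequence {p : ℝ≥0∞} (hp : p ≠ ∞) (j : ℕ) :
    MemLp (fun ω : ℕ → ℝ => ω j) p gaussianSequence :=
  ⟨(measurable_pi_apply j).aestronglyMeasurable, by
    rw [eLpNorm_eval_gaussianSequence]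
    exact (memLp_id_gaussianReal' _ hp).2⟩

theorem exists_isProductQuantization {E : Type*} [NormedAddCommGroup E] [NormedSpace ℝ E] {r : ℝ}
    (hr : 0 < r) (f : ℕ → E) {p : ℕ} (L : Fin p → ℕ) (hL : ∀ j, 1 ≤ L j) :
    ∃ Xh, IsProductQuantization r f L Xh := by
  have h : ∀ j : Fin p, ∃ Y, IsOptimalQuantization gaussianSequence (L j) r
      (fun ω : ℕ → ℝ => ω j) Y := fun j =>
    exists_isOptimalQuantization _ hr (memLp_eval_gaussianSequence ENNReal.ofReal_ne_top _) (hL j)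
  choose ξh hξh using h
  exact ⟨_, ξh, hξh, rfl⟩

theorem gaussianSeriesConverges_of_norm_le {T ρ K K' a : ℝ} (hT : 0 < T) (hρ : 0 < ρ)
    (hK : 0 ≤ K) (hK' : 0 ≤ K') (ha : 0 < a) {f : ℕ → PathSpace T}
    (hf : ∀ j, ‖f j‖ ≤ K * ((j : ℝ) + 1) ^ (-(ρ + 1 / 2)))
    (hf' : ∀ (j : ℕ) (s t : Set.Icc (0 : ℝ) T),
      |f j t - f j s| ≤ K' * ((j : ℝ) + 1) * |(t : ℝ) - s| ^ a) :
    GaussianSeriesConverges f := by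
  obtain ⟨C, hC, h⟩ := exists_block_majorant hT hρ hK hK' ha le_rfl hf hf'
  exact gaussianSeriesConverges_of_block_bound (by positivity)
    (Real.rpow_lt_one_of_one_lt_of_neg (by norm_num) (by linarith)) hC h

/-- With `2 ^ k` coordinates, each quantized at a level that is a large power of `2 ^ k`, the error
has the order of the tail of the series. -/
theorem exists_quantizationError_le {T ρ K K' a r : ℝ} (hT : 0 < T) (hρ : 0 < ρ)
    (hK : 0 ≤ K) (hK' : 0 ≤ K') (ha : 0 < a) (hr : 0 < r) {f : ℕ → PathSpace T}
    (hf : ∀ j, ‖f j‖ ≤ K * ((j : ℝ) + 1) ^ (-(ρ + 1 / 2)))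
    (hf' : ∀ (j : ℕ) (s t : Set.Icc (0 : ℝ) T),
      |f j t - f j s| ≤ K' * ((j : ℝ) + 1) * |(t : ℝ) - s| ^ a) :
    ∃ (A : ℕ) (C : ℝ), 0 ≤ C ∧ ∀ k : ℕ, 1 ≤ k → ∀ Xh,
      IsProductQuantization r f (fun _ : Fin (2 ^ k) => 2 * 4 ^ (A * k)) Xh →
      quantizationError gaussianSequence r (gaussianSeries f) Xh ≤
        ENNReal.ofReal (C * (((2 : ℝ) ^ (-ρ)) ^ k * √k)) := by
  have hconv := gaussianSeriesConverges_of_norm_le hT hρ hK hK' ha hf hf'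
  obtain ⟨C₁, hC₁, hblock⟩ := exists_block_majorant hT hρ hK hK' ha (le_max_right r 1) hf hf'
  obtain ⟨C₂, hC₂, hquant⟩ := exists_minimalQuantizationError_le gaussianSequence hr
    (B := eLpNorm id (ENNReal.ofReal (2 * r)) (gaussianReal 0 1))
    (memLp_id_gaussianReal' _ ENNReal.ofReal_ne_top).2.ne
  obtain ⟨A, hA⟩ := exists_nat_ge (ρ + 1 + 1 / r)
  have hx1 : (2 : ℝ) ^ (-ρ) < 1 := Real.rpow_lt_one_of_one_lt_of_neg (by norm_num) (by linarith)
  have hx0 : 0 ≤ (2 : ℝ) ^ (-ρ) := by positivity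
  set C₃ : ℝ := C₁ * ∑' i : ℕ, ((2 : ℝ) ^ (-ρ)) ^ i * √((i : ℝ) + 1) with hC₃
  have hC₃0 : 0 ≤ C₃ := mul_nonneg hC₁ (tsum_nonneg fun i => by positivity)
  set c : ℝ≥0∞ := ENNReal.LpAddConst (ENNReal.ofReal r) with hc
  have hctop : c ≠ ∞ := (ENNReal.LpAddConst_lt_top _).ne
  refine ⟨A, c.toReal * (C₃ + K * C₂), by positivity, fun k hk Xh hXh => ?_⟩
  obtain ⟨ξh, hξh, rfl⟩ := hXh
  have hk0 : (0 : ℝ) < 2 ^ k := by positivity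
  have htail : eLpNorm (fun ω => gaussianSeries f ω - ∑ j ∈ Finset.range (2 ^ k), ω j • f j)
      (ENNReal.ofReal r) gaussianSequence ≤
        ENNReal.ofReal (C₃ * (((2 : ℝ) ^ (-ρ)) ^ k * √k)) :=
    (eLpNorm_le_eLpNorm_of_exponent_le (ENNReal.ofReal_le_ofReal (le_max_left r 1))
      ((aestronglyMeasurable_gaussianSeries hconv).sub
        (aestronglyMeasurable_partialSum f _))).trans
      (eLpNorm_gaussianSeries_sub_le hx0 hx1 hC₁ (le_max_right r 1) hconv hblock k hk)
  have hcoord : ∀ j : Fin (2 ^ k), eLpNorm (fun ω : ℕ → ℝ => ω j - ξh j ω) (ENNReal.ofReal r)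
      gaussianSequence ≤ ENNReal.ofReal (C₂ / 2 ^ (A * k)) := fun j => by
    have h1 := hquant (fun ω : ℕ → ℝ => ω j) (measurable_pi_apply _).aemeasurable
      (eLpNorm_eval_gaussianSequence _ _).le (4 ^ (A * k)) (2 * 4 ^ (A * k))
      (Nat.one_le_pow _ _ (by norm_num)) le_rfl
    rw [← (hξh j).2] at h1
    have h2 : √((4 ^ (A * k) : ℕ) : ℝ) = 2 ^ (A * k) := by
      rw [show (4 : ℕ) = 2 ^ 2 by norm_num, ← pow_mul, mul_comm 2, pow_mul]
      push_cast
      exact Real.sqrt_sq (by positivity)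
    rwa [h2] at h1
  have hbound : ∀ j : Fin (2 ^ k), ‖f j‖ ≤ K := fun j => (hf j).trans
    (mul_le_of_le_one_right hK (Real.rpow_le_one_of_one_le_of_nonpos
      (by linarith [(Nat.cast_nonneg (j : ℕ) : (0 : ℝ) ≤ ((j : ℕ) : ℝ))]) (by linarith)))
  have hξm : ∀ j : Fin (2 ^ k), AEMeasurable (fun ω : ℕ → ℝ => ω j - ξh j ω) gaussianSequence :=
    fun j => ((measurable_pi_apply _).sub (hξh j).1.1).aemeasurable
  have hmain := eLpNorm_sum_smul_le hr hξm hbound hcoord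
  have hmain' : eLpNorm (fun ω : ℕ → ℝ => ∑ j : Fin (2 ^ k), (ω j - ξh j ω) • f j)
      (ENNReal.ofReal r) gaussianSequence ≤
        ENNReal.ofReal (K * C₂ * (((2 : ℝ) ^ (-ρ)) ^ k * √k)) := by
    refine hmain.trans ?_
    rw [← ENNReal.ofReal_natCast, ENNReal.ofReal_rpow_of_nonneg (by positivity) (by positivity),
      ← ENNReal.ofReal_mul hK, ← ENNReal.ofReal_mul (by positivity)]
    refine ENNReal.ofReal_le_ofReal ?_
    push_cast
    have h3 : ((2 : ℝ) ^ k) ^ (1 + 1 / r) / 2 ^ (A * k) ≤ ((2 : ℝ) ^ (-ρ)) ^ k := by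
      rw [two_rpow_neg_pow, mul_comm A k, pow_mul, ← Real.rpow_natCast ((2 : ℝ) ^ k) A,
        ← Real.rpow_sub hk0]
      exact Real.rpow_le_rpow_of_exponent_le (one_le_pow₀ (by norm_num)) (by linarith)
    have h4 : 1 ≤ √(k : ℝ) := by
      rw [Real.one_le_sqrt]
      exact_mod_cast hk
    calc K * ((2 : ℝ) ^ k) ^ (1 + 1 / r) * (C₂ / 2 ^ (A * k))
        = K * C₂ * (((2 : ℝ) ^ k) ^ (1 + 1 / r) / 2 ^ (A * k) * 1) := by ring
      _ ≤ _ := by gcongr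
  have hsplit : (fun ω => gaussianSeries f ω - ∑ j : Fin (2 ^ k), ξh j ω • f j) =
      (fun ω => gaussianSeries f ω - ∑ j ∈ Finset.range (2 ^ k), ω j • f j) +
        fun ω : ℕ → ℝ => ∑ j : Fin (2 ^ k), (ω j - ξh j ω) • f j := by
    funext ω
    rw [Pi.add_apply, Finset.sum_range (fun j => ω j • f j)]
    simp only [sub_smul, Finset.sum_sub_distrib]
    abel
  have hm2 : AEStronglyMeasurable (fun ω : ℕ → ℝ => ∑ j : Fin (2 ^ k), (ω j - ξh j ω) • f j)
      gaussianSequence :=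
    Finset.aestronglyMeasurable_fun_sum _ fun j _ =>
      (hξm j).aestronglyMeasurable.smul_const (f j)
  unfold quantizationError
  rw [hsplit]
  refine (eLpNorm_add_le' ((aestronglyMeasurable_gaussianSeries hconv).sub
    (aestronglyMeasurable_partialSum f _)) hm2 _).trans ?_
  rw [mul_assoc, ENNReal.ofReal_mul ENNReal.toReal_nonneg, ENNReal.ofReal_toReal hctop, add_mul,
    ENNReal.ofReal_add (by positivity) (by positivity)]
  exact mul_le_mul' le_rfl (add_le_add htail hmain')

/-! ### Allocation of the levels -/

/-- The number `2 ^ k` of coordinates is chosen with `k 2 ^ k` of order `log N`. -/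
theorem eventually_exists_dyadic_size {D : ℕ} (hD : 1 ≤ D) :
    ∀ᶠ N : ℕ in atTop, ∃ k : ℕ, 1 ≤ k ∧ 2 ^ (D * k * 2 ^ k) ≤ N ∧
      Real.log N ≤ 4 * D * k * 2 ^ k ∧ (k : ℝ) ≤ 3 * Real.log (Real.log N) := by
  have hloglog : Tendsto (fun N : ℕ => Real.log (Real.log N)) atTop atTop :=
    Real.tendsto_log_atTop.comp (Real.tendsto_log_atTop.comp tendsto_natCast_atTop_atTop)
  filter_upwards [eventually_ge_atTop (2 ^ (D * 2)), hloglog.eventually_ge_atTop 1,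
    (Real.tendsto_log_atTop.comp tendsto_natCast_atTop_atTop).eventually_ge_atTop 1]
    with N hN hll hl
  simp only [Function.comp_apply] at hl
  have hN0 : N ≠ 0 := by
    have := Nat.one_le_two_pow (n := D * 2)
    omega
  have hNr : (0 : ℝ) < N := by exact_mod_cast Nat.pos_of_ne_zero hN0
  set l := Nat.log 2 N with hl'
  have hl1 : D * 1 * 2 ^ 1 ≤ l := by
    rw [mul_one]
    exact Nat.le_log_of_pow_le (by norm_num) hN
  set k := Nat.findGreatest (fun k => D * k * 2 ^ k ≤ l) l with hk
  have hl1' : 1 ≤ l := by omega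
  have hkl : D * k * 2 ^ k ≤ l := Nat.findGreatest_spec (P := fun k => D * k * 2 ^ k ≤ l) hl1' hl1
  have hk1 : 1 ≤ k := Nat.le_findGreatest hl1' hl1
  have hnext : l < D * (k + 1) * 2 ^ (k + 1) := by
    by_contra hcon
    push Not at hcon
    have h1 : k + 1 ≤ l := by
      refine le_trans ?_ hcon
      have := Nat.one_le_two_pow (n := k + 1)
      calc k + 1 = 1 * (k + 1) * 1 := by ring
        _ ≤ D * (k + 1) * 2 ^ (k + 1) := by gcongr
    exact Nat.findGreatest_is_greatest (P := fun k => D * k * 2 ^ k ≤ l) (Nat.lt_succ_self k) h1 hcon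
  have hlog2 : Real.log 2 ≤ 1 := by
    have := Real.log_two_lt_d9
    linarith
  have hlog2' : 1 / 2 < Real.log 2 := by
    have := Real.log_two_gt_d9
    linarith
  refine ⟨k, hk1, (Nat.pow_le_pow_right (by norm_num) hkl).trans (Nat.pow_log_le_self 2 hN0), ?_, ?_⟩
  · have h1 : N < 2 ^ (l + 1) := Nat.lt_pow_succ_log_self (by norm_num) N
    have h2 : (N : ℝ) ≤ 2 ^ (l + 1) := by exact_mod_cast h1.le
    have h3 : Real.log N ≤ (l + 1 : ℕ) * Real.log 2 := by
      rw [← Real.log_pow]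
      exact Real.log_le_log hNr h2
    have h4 : l + 1 ≤ 4 * D * k * 2 ^ k := by
      have h5 : D * (k + 1) * 2 ^ (k + 1) ≤ D * (2 * k) * 2 ^ (k + 1) := by
        gcongr
        omega
      calc l + 1 ≤ D * (2 * k) * 2 ^ (k + 1) := hnext.trans_le h5
        _ = _ := by ring
    have h6 : ((l + 1 : ℕ) : ℝ) ≤ 4 * D * k * 2 ^ k := by exact_mod_cast h4
    have h7 : (0 : ℝ) ≤ (l + 1 : ℕ) := Nat.cast_nonneg _
    nlinarith
  · have h1 : 2 ^ k ≤ l := by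
      refine le_trans ?_ hkl
      calc 2 ^ k = 1 * 1 * 2 ^ k := by ring
        _ ≤ D * k * 2 ^ k := by gcongr
    have h2 : (2 : ℝ) ^ l ≤ N := by exact_mod_cast Nat.pow_log_le_self 2 hN0
    have h3 : l * Real.log 2 ≤ Real.log N := by
      rw [← Real.log_pow]
      exact Real.log_le_log (by positivity) h2
    have h4 : (2 : ℝ) ^ k ≤ l := by exact_mod_cast h1
    have h5 : (2 : ℝ) ^ k ≤ 2 * Real.log N := by
      have : (0 : ℝ) ≤ l := Nat.cast_nonneg _
      nlinarith
    have h6 : k * Real.log 2 ≤ Real.log 2 + Real.log (Real.log N) := by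
      rw [← Real.log_pow, ← Real.log_mul (by norm_num) (by linarith)]
      exact Real.log_le_log (by positivity) h5
    have h7 : (0 : ℝ) ≤ k := Nat.cast_nonneg _
    have h8 := Real.log_two_gt_d9
    nlinarith

theorem rpow_mul_sqrt_le_rlRate {ρ : ℝ} (hρ : 0 < ρ) {D k N : ℕ} (hD : 1 ≤ D) (hk : 1 ≤ k)
    (hl : 0 < Real.log N) (h1 : Real.log N ≤ 4 * D * k * 2 ^ k)
    (h2 : (k : ℝ) ≤ 3 * Real.log (Real.log N)) :
    ((2 : ℝ) ^ (-ρ)) ^ k * √k ≤ (4 * D : ℝ) ^ ρ * 3 ^ (ρ + 1 / 2) * rlRate ρ N := by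
  have hk0 : (0 : ℝ) < k := by exact_mod_cast hk
  have hD0 : (0 : ℝ) < D := by exact_mod_cast hD
  have hll : 0 < Real.log (Real.log N) := by linarith
  have h3 : Real.log N / (4 * D * k) ≤ 2 ^ k := by
    rw [div_le_iff₀ (by positivity)]
    linarith
  have h4 : ((2 : ℝ) ^ k) ^ (-ρ) ≤ (Real.log N / (4 * D * k)) ^ (-ρ) :=
    Real.rpow_le_rpow_of_nonpos (by positivity) h3 (by linarith)
  have h5 : (Real.log N / (4 * D * k)) ^ (-ρ) = (4 * D : ℝ) ^ ρ * k ^ ρ / Real.log N ^ ρ := by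
    rw [Real.rpow_neg (by positivity), Real.div_rpow hl.le (by positivity), inv_div,
      Real.mul_rpow (by positivity) hk0.le]
  have h6 : (k : ℝ) ^ ρ * √k ≤ 3 ^ (ρ + 1 / 2) * Real.log (Real.log N) ^ (ρ + 1 / 2) := by
    rw [Real.sqrt_eq_rpow, ← Real.rpow_add hk0, ← Real.mul_rpow (by norm_num) hll.le]
    exact Real.rpow_le_rpow hk0.le h2 (by positivity)
  rw [two_rpow_neg_pow]
  calc ((2 : ℝ) ^ k) ^ (-ρ) * √k ≤ (4 * D : ℝ) ^ ρ * k ^ ρ / Real.log N ^ ρ * √k := by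
        rw [← h5]
        gcongr
    _ = (4 * D : ℝ) ^ ρ * (k ^ ρ * √k) / Real.log N ^ ρ := by ring
    _ ≤ (4 * D : ℝ) ^ ρ * (3 ^ (ρ + 1 / 2) * Real.log (Real.log N) ^ (ρ + 1 / 2)) /
        Real.log N ^ ρ := by gcongr
    _ = _ := by
        rw [rlRate]
        ring

/-- All of the `2 ^ k` first coordinates get the same level `2 * 4 ^ (A * k) ≤ 2 ^ (D * k)`, where
`D = 2 * (A + 1)`, so that the total level is at most `2 ^ (D * k * 2 ^ k)`. -/
theorem exists_product_quantization_rate {T ρ K K' a r : ℝ} (hT : 0 < T) (hρ : 0 < ρ)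
    (hK : 0 ≤ K) (hK' : 0 ≤ K') (ha : 0 < a) (hr : 0 < r) {f : ℕ → PathSpace T}
    (hf : ∀ j, ‖f j‖ ≤ K * ((j : ℝ) + 1) ^ (-(ρ + 1 / 2)))
    (hf' : ∀ (j : ℕ) (s t : Set.Icc (0 : ℝ) T),
      |f j t - f j s| ≤ K' * ((j : ℝ) + 1) * |(t : ℝ) - s| ^ a) :
    ∃ C : ℝ, 0 ≤ C ∧ ∀ᶠ N : ℕ in atTop, ∃ (p : ℕ) (L : Fin p → ℕ), IsLevelAllocation N L ∧
      (∃ Xh, IsProductQuantization r f L Xh) ∧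
      ∀ Xh, IsProductQuantization r f L Xh →
        quantizationError gaussianSequence r (gaussianSeries f) Xh ≤
          ENNReal.ofReal (C * rlRate ρ N) := by
  obtain ⟨A, C, hC, h⟩ := exists_quantizationError_le hT hρ hK hK' ha hr hf hf'
  set D := 2 * (A + 1) with hD
  refine ⟨C * ((4 * D : ℝ) ^ ρ * 3 ^ (ρ + 1 / 2)), by positivity, ?_⟩
  filter_upwards [eventually_exists_dyadic_size (D := D) (by omega),
    (Real.tendsto_log_atTop.comp tendsto_natCast_atTop_atTop).eventually_gt_atTop 0] with N hN hl
  obtain ⟨k, hk, hkN, h1, h2⟩ := hN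
  have hL : ∀ _ : Fin (2 ^ k), 1 ≤ 2 * 4 ^ (A * k) := fun _ => by
    have := Nat.one_le_pow (A * k) 4 (by norm_num)
    omega
  refine ⟨2 ^ k, fun _ => 2 * 4 ^ (A * k), ⟨Nat.one_le_two_pow, hL, ?_⟩,
    exists_isProductQuantization hr f _ hL, fun Xh hXh => (h k hk Xh hXh).trans ?_⟩
  · refine le_trans ?_ hkN
    rw [Finset.prod_const, Finset.card_univ, Fintype.card_fin, pow_mul 2 (D * k)]
    refine Nat.pow_le_pow_left ?_ _
    calc 2 * 4 ^ (A * k) = 2 ^ (1 + 2 * (A * k)) := by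
          rw [pow_add, pow_mul 2 2]
          norm_num
      _ ≤ 2 ^ (D * k) := Nat.pow_le_pow_right (by norm_num) (by
          rw [hD]
          nlinarith)
  · refine ENNReal.ofReal_le_ofReal ?_
    rw [mul_assoc]
    exact mul_le_mul_of_nonneg_left
      (rpow_mul_sqrt_le_rlRate hρ (by omega) hk hl h1 h2) hC

/-! ### Parseval's identity for the cosine system -/

/-- Parseval's identity for the orthonormal basis `√(2/T) cos(π (j + 1/2) s / T)` of `L²(0, T)`.
The even extension of `g` to `[-T, T]`, multiplied by `exp(-iπs/(2T))`, has the cosine coefficients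
of `g` as its Fourier coefficients; the indices `j` and `-(j + 1)` give the same coefficient. -/
theorem hasSum_sq_integral_mul_cos {T : ℝ} (hT : 0 < T) {g : ℝ → ℝ} (hg : MemLp g 2 volume)
    (hg0 : ∀ s, s ∉ Set.Ioc 0 T → g s = 0) :
    HasSum (fun j : ℕ => (√(2 / T) * ∫ s, g s * Real.cos (s * cosineFrequency T j)) ^ 2)
      (∫ s, g s ^ 2) := by
  have hTT : -T < T := by linarith
  have hgi : Integrable g := by
    have h1 : IntegrableOn g (Set.Ioc 0 T) :=
      (hg.restrict _).integrable (by norm_num)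
    exact (integrableOn_iff_integrable_of_support_subset fun s hs => by
      by_contra h; exact hs (hg0 s h)).1 h1
  have hgsq : Integrable fun s => g s ^ 2 := hg.integrable_sq
  have hsub : Set.Ioc 0 T ⊆ Set.Ioc (-T) T := Set.Ioc_subset_Ioc_left (by linarith)
  set e : ℝ → ℂ := fun s => Complex.exp (((-(Real.pi * s / (2 * T)) : ℝ) : ℂ) * Complex.I) with he
  set F : ℝ → ℂ := fun s => ((g s + g (-s) : ℝ) : ℂ) * e s with hF
  have hne : ∀ s, ‖e s‖ = 1 := fun s => Complex.norm_exp_ofReal_mul_I _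
  have hec : Continuous e := by fun_prop
  have hgn : MemLp (fun s => g (-s)) 2 volume :=
    hg.comp_measurePreserving (Measure.measurePreserving_neg volume)
  have hFL : MemLp F 2 volume := by
    have h1 : MemLp (fun s => ((g s + g (-s) : ℝ) : ℂ)) 2 volume := (hg.add hgn).ofReal
    refine h1.congr_norm (h1.1.mul hec.aestronglyMeasurable) (Eventually.of_forall fun s => ?_)
    simp [hF, hne]
  have hP := hasSum_sq_fourierCoeffOn hTT (hFL.restrict (Set.Ioc (-T) T))
  have hfull : ∀ u : ℝ → ℝ, (∫ s in -T..T, g s * u s) = ∫ s, g s * u s := fun u =>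
    intervalIntegral.integral_eq_integral_of_support_subset fun s hs => hsub (by
      by_contra h; exact hs (by simp [hg0 s h]))
  have hnorm : (∫ s in -T..T, ‖F s‖ ^ 2) = 2 * ∫ s, g s ^ 2 := by
    have h1 : ∀ s, ‖F s‖ ^ 2 = g s ^ 2 + g (-s) ^ 2 := fun s => by
      have h2 : g s * g (-s) = 0 := by
        rcases le_or_gt s 0 with h | h
        · rw [hg0 s fun h' => absurd h'.1 (not_lt.2 h), zero_mul]
        · rw [hg0 (-s) fun h' => absurd h'.1 (by linarith), mul_zero]
      simp only [hF, norm_mul, hne, mul_one, Complex.norm_real, Real.norm_eq_abs, sq_abs]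
      linear_combination 2 * h2
    simp only [h1]
    have h3 : (∫ s in -T..T, g s ^ 2) = ∫ s, g s ^ 2 := by
      simpa [pow_two] using hfull g
    rw [intervalIntegral.integral_add hgsq.intervalIntegrable
      (hgn.integrable_sq).intervalIntegrable,
      intervalIntegral.integral_comp_neg fun s => g s ^ 2, neg_neg, h3]
    ring
  have hcoef : ∀ n : ℤ, fourierCoeffOn hTT F n =
      ((1 / T * ∫ s, g s * Real.cos (s * (Real.pi * (n + 1 / 2) / T)) : ℝ) : ℂ) := fun n => by
    rw [fourierCoeffOn_eq_integral]
    set θ : ℝ := Real.pi * (n + 1 / 2) / T with hθ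
    set E : ℝ → ℂ := fun s => Complex.exp (((-(s * θ) : ℝ) : ℂ) * Complex.I) with hE
    have hEc : Continuous E := by fun_prop
    have hEn : ∀ s, ‖E s‖ ≤ 1 := fun s => (Complex.norm_exp_ofReal_mul_I _).le
    have h1 : ∀ s : ℝ, fourier (-n) (s : AddCircle (T - -T)) • F s =
        (g s : ℂ) * E s + (g (-s) : ℂ) * E s := fun s => by
      have h2 : (fourier (-n) (s : AddCircle (T - -T)) : ℂ) * e s = E s := by
        rw [fourier_coe_apply, he, hE, ← Complex.exp_add]
        congr 1
        have hTc : (T : ℂ) ≠ 0 := by exact_mod_cast hT.ne'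
        simp only [hθ]
        push_cast
        rw [show (T : ℂ) - -T = 2 * T by ring]
        field_simp
        ring
      simp only [hF, smul_eq_mul]
      push_cast
      linear_combination ((g s : ℂ) + g (-s)) * h2
    have hi1 : Integrable fun s => (g s : ℂ) * E s :=
      (hgi.ofReal).mul_bdd (c := 1) hEc.aestronglyMeasurable (Eventually.of_forall hEn)
    have hi2 : Integrable fun s => (g s : ℂ) * E (-s) :=
      (hgi.ofReal).mul_bdd (c := 1) (hEc.comp continuous_neg).aestronglyMeasurable
        (Eventually.of_forall fun s => hEn _)
    have hi3 : Integrable fun s => (g (-s) : ℂ) * E s := by simpa using hi2.comp_neg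
    have h4 : (∫ s in -T..T, (g (-s) : ℂ) * E s) = ∫ s in -T..T, (g s : ℂ) * E (-s) := by
      have := intervalIntegral.integral_comp_neg (a := -T) (b := T) fun s => (g s : ℂ) * E (-s)
      simpa using this
    simp only [h1]
    rw [intervalIntegral.integral_add hi1.intervalIntegrable hi3.intervalIntegrable, h4,
      ← intervalIntegral.integral_add hi1.intervalIntegrable hi2.intervalIntegrable]
    have h5 : ∀ s : ℝ, (g s : ℂ) * E s + (g s : ℂ) * E (-s) =
        ((2 * (g s * Real.cos (s * θ)) : ℝ) : ℂ) := fun s => by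
      simp only [hE]
      push_cast
      rw [Complex.cos]
      ring_nf
    simp only [h5]
    rw [intervalIntegral.integral_ofReal, intervalIntegral.integral_const_mul,
      hfull fun s => Real.cos (s * θ), Complex.real_smul]
    generalize (∫ s, g s * Real.cos (s * θ)) = J
    rw [← Complex.ofReal_mul]
    congr 1
    field_simp
    ring
  simp only [hcoef, hnorm, Complex.norm_real, Real.norm_eq_abs, sq_abs, smul_eq_mul] at hP
  have hN := (hP.nat_add_neg_add_one).mul_left T
  have h6 : ∀ (j : ℕ) (s : ℝ), Real.cos (s * (Real.pi * (((-((j : ℤ) + 1) : ℤ) : ℝ) + 1 / 2) / T)) =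
      Real.cos (s * (Real.pi * ((j : ℝ) + 1 / 2) / T)) := fun j s => by
    rw [← Real.cos_neg]
    congr 1
    push_cast
    ring
  have h7 : T * ((T - -T)⁻¹ * (2 * ∫ s, g s ^ 2)) = ∫ s, g s ^ 2 := by
    generalize (∫ s, g s ^ 2) = J
    rw [sub_neg_eq_add]
    field_simp
    ring
  rw [h7] at hN
  refine hN.congr_fun fun j => ?_
  simp only [h6, cosineFrequency, Int.cast_natCast, mul_pow,
    Real.sq_sqrt (show (0 : ℝ) ≤ 2 / T by positivity)]
  generalize (∫ s, g s * Real.cos (s * (Real.pi * ((j : ℝ) + 1 / 2) / T))) = J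
  field_simp
  ring

/-! ### Limits of centred Gaussian variables -/

theorem HasLaw.gaussianReal_of_tendsto_ae {Ω : Type*} [MeasurableSpace Ω] {P : Measure Ω}
    [IsProbabilityMeasure P] {Y : ℕ → Ω → ℝ} {Z : Ω → ℝ} {v : ℕ → ℝ≥0} {w : ℝ≥0}
    (hY : ∀ n, HasLaw (Y n) (gaussianReal 0 (v n)) P) (hv : Tendsto v atTop (𝓝 w))
    (h : ∀ᵐ ω ∂P, Tendsto (fun n => Y n ω) atTop (𝓝 (Z ω))) :
    HasLaw Z (gaussianReal 0 w) P := by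
  have hZ : AEMeasurable Z P := aemeasurable_of_tendsto_metrizable_ae' (fun n => (hY n).aemeasurable) h
  have := Measure.isProbabilityMeasure_map (μ := P) hZ
  refine ⟨hZ, Measure.ext_of_charFun (funext fun t => ?_)⟩
  have hc : ∀ {U : Ω → ℝ}, AEMeasurable U P → charFun (P.map U) t =
      ∫ ω, Complex.exp (t * U ω * Complex.I) ∂P := fun {U} hU => by
    rw [charFun_apply_real, integral_map hU (by fun_prop)]
  have h1 : Tendsto (fun n => ∫ ω, Complex.exp (t * Y n ω * Complex.I) ∂P) atTop
      (𝓝 (∫ ω, Complex.exp (t * Z ω * Complex.I) ∂P)) := by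
    refine tendsto_integral_of_dominated_convergence (fun _ => 1) (fun n => ?_) (by fun_prop)
      (fun n => Eventually.of_forall fun ω => ?_) ?_
    · have := (hY n).aemeasurable
      exact (Complex.measurable_exp.comp_aemeasurable (by fun_prop)).aestronglyMeasurable
    · exact_mod_cast (Complex.norm_exp_ofReal_mul_I (t * Y n ω)).le
    · filter_upwards [h] with ω hω
      exact (Complex.continuous_exp.tendsto _).comp
        (((Complex.continuous_ofReal.tendsto _).comp hω).const_mul _ |>.mul_const _)
  rw [hc hZ]
  refine tendsto_nhds_unique h1 ?_
  have h2 : ∀ n, (∫ ω, Complex.exp (t * Y n ω * Complex.I) ∂P) =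
      charFun (gaussianReal 0 (v n)) t := fun n => by
    rw [← hc (hY n).aemeasurable, (hY n).map_eq]
  simp only [h2, charFun_gaussianReal]
  refine (Complex.continuous_exp.tendsto _).comp (Tendsto.sub tendsto_const_nhds ?_)
  have h3 : Tendsto (fun n => ((v n : ℝ) : ℂ)) atTop (𝓝 ((w : ℝ) : ℂ)) :=
    (Complex.continuous_ofReal.tendsto _).comp ((NNReal.continuous_coe.tendsto _).comp hv)
  exact (h3.mul_const _).div_const _

theorem HasLaw.gaussianReal_of_tendsto_eLpNorm {Ω : Type*} [MeasurableSpace Ω] {P : Measure Ω}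
    [IsProbabilityMeasure P] {Y : ℕ → Ω → ℝ} {Z : Ω → ℝ} {v : ℕ → ℝ≥0} {w : ℝ≥0}
    (hY : ∀ n, HasLaw (Y n) (gaussianReal 0 (v n)) P) (hv : Tendsto v atTop (𝓝 w))
    (hZ : AEMeasurable Z P)
    (h : Tendsto (fun n => eLpNorm (Y n - Z) 2 P) atTop (𝓝 0)) :
    HasLaw Z (gaussianReal 0 w) P := by
  obtain ⟨ns, hns, hlim⟩ := (tendstoInMeasure_of_tendsto_eLpNorm (by norm_num)
    (fun n => (hY n).aemeasurable.aestronglyMeasurable) hZ.aestronglyMeasurable h).exists_seq_tendsto_ae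
  exact HasLaw.gaussianReal_of_tendsto_ae (fun n => hY (ns n)) (hv.comp hns.tendsto_atTop) hlim

/-! ### Wiener integrals -/

theorem integral_mul_indicator_Ioc {a b a' b' : ℝ} (c c' : ℝ) (h : a ≤ b) (h' : a' ≤ b') :
    (∫ x, (Set.Ioc a b).indicator (fun _ => c) x * (Set.Ioc a' b').indicator (fun _ => c') x) =
      c * c' * (min b b' - min b a' - min a b' + min a a') := by
  have h1 : ∀ x, (Set.Ioc a b).indicator (fun _ => c) x * (Set.Ioc a' b').indicator (fun _ => c') x =
      (Set.Ioc a b ∩ Set.Ioc a' b').indicator (fun _ => c * c') x := fun x => by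
    rw [Set.inter_indicator_mul]
  simp only [h1]
  rw [integral_indicator_const _ (measurableSet_Ioc.inter measurableSet_Ioc), Set.Ioc_inter_Ioc,
    Real.volume_real_Ioc, smul_eq_mul, mul_comm (c * c')]
  congr 1
  simp only [min_def, max_def]
  split_ifs <;> linarith

/-- The elementary Wiener isometry: for a step function, the sum of the increments of a Brownian
motion is centred Gaussian, with the squared `L²` norm of the step function as variance. -/
theorem IsPreBrownianReal.hasLaw_sum_increments {Ω : Type*} [MeasurableSpace Ω] {P : Measure Ω}
    {W : ℝ≥0 → Ω → ℝ} (hW : IsPreBrownianReal W P) {ι : Type*} (s : Finset ι) (c : ι → ℝ)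
    (a b : ι → ℝ≥0) (hab : ∀ i, a i ≤ b i) :
    HasLaw (fun ω => ∑ i ∈ s, c i * (W (b i) ω - W (a i) ω))
      (gaussianReal 0 (∫ x, (∑ i ∈ s,
        (Set.Ioc (a i : ℝ) (b i)).indicator (fun _ => c i) x) ^ 2).toNNReal) P := by
  have hP : IsProbabilityMeasure P := hW.isGaussianProcess.isProbabilityMeasure
  have hL2 : ∀ t, MemLp (fun ω => W t ω) 2 P := fun t =>
    (hW.isGaussianProcess.hasGaussianLaw_eval t).memLp_two
  have hI2 : ∀ i, MemLp (fun ω => W (b i) ω - W (a i) ω) 2 P := fun i => (hL2 _).sub (hL2 _)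
  have hY2 : ∀ i, MemLp (fun ω => c i * (W (b i) ω - W (a i) ω)) 2 P := fun i =>
    (hI2 i).const_mul _
  have hG : IsGaussianProcess (fun (i : ι) ω => c i * (W (b i) ω - W (a i) ω)) P := by
    classical
    refine hW.isGaussianProcess.of_isGaussianProcess fun i => ⟨{a i, b i},
      c i • (ContinuousLinearMap.proj (R := ℝ) (φ := fun _ => ℝ) ⟨b i, by simp⟩ -
        ContinuousLinearMap.proj (R := ℝ) (φ := fun _ => ℝ) ⟨a i, by simp⟩), fun ω => ?_⟩
    simp
  have hsum : HasGaussianLaw (fun ω => ∑ i ∈ s, c i * (W (b i) ω - W (a i) ω)) P :=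
    hG.hasGaussianLaw_fun_sum
  refine ⟨hsum.aemeasurable, ?_⟩
  have hmean : (∫ ω, ∑ i ∈ s, c i * (W (b i) ω - W (a i) ω) ∂P) = 0 := by
    rw [integral_finsetSum _ fun i _ => (hY2 i).integrable (by norm_num)]
    refine Finset.sum_eq_zero fun i _ => ?_
    rw [integral_const_mul, integral_sub (hW.integrable_eval _) (hW.integrable_eval _),
      hW.integral_eval, hW.integral_eval, sub_zero, mul_zero]
  have hvar : Var[fun ω => ∑ i ∈ s, c i * (W (b i) ω - W (a i) ω); P] =
      ∫ x, (∑ i ∈ s, (Set.Ioc (a i : ℝ) (b i)).indicator (fun _ => c i) x) ^ 2 := by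
    rw [← covariance_self hsum.aemeasurable, covariance_fun_sum_fun_sum' (fun i _ => hY2 i)
      (fun i _ => hY2 i)]
    simp only [pow_two, Finset.sum_mul_sum]
    have hint : ∀ i j, Integrable fun x => (Set.Ioc (a i : ℝ) (b i)).indicator (fun _ => c i) x *
        (Set.Ioc (a j : ℝ) (b j)).indicator (fun _ => c j) x := fun i j => by
      simp only [← Set.inter_indicator_mul]
      rw [integrable_indicator_iff (measurableSet_Ioc.inter measurableSet_Ioc), Set.Ioc_inter_Ioc]
      exact integrableOn_const (by simp)
    rw [integral_finsetSum _ fun i _ => integrable_finsetSum _ fun j _ => hint i j]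
    refine Finset.sum_congr rfl fun i _ => ?_
    rw [integral_finsetSum _ fun j _ => hint i j]
    refine Finset.sum_congr rfl fun j _ => ?_
    rw [integral_mul_indicator_Ioc _ _ (by exact_mod_cast hab i) (by exact_mod_cast hab j),
      covariance_const_mul_left, covariance_const_mul_right,
      covariance_fun_sub_fun_sub (hL2 _) (hL2 _) (hL2 _) (hL2 _)]
    simp only [hW.covariance_fun_eval, NNReal.coe_min]
    ring
  rw [hsum.map_eq_gaussianReal, hmean, hvar]

theorem tendsto_integral_sq_of_tendsto_eLpNorm {α : Type*} [MeasurableSpace α] {μ : Measure α}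
    {f : ℕ → α → ℝ} {g : α → ℝ} (hf : ∀ n, MemLp (f n) 2 μ) (hg : MemLp g 2 μ)
    (h : Tendsto (fun n => eLpNorm (f n - g) 2 μ) atTop (𝓝 0)) :
    Tendsto (fun n => ∫ x, f n x ^ 2 ∂μ) atTop (𝓝 (∫ x, g x ^ 2 ∂μ)) := by
  have hsq : ∀ {u : α → ℝ} (hu : MemLp u 2 μ), ‖hu.toLp u‖ ^ 2 = ∫ x, u x ^ 2 ∂μ := fun {u} hu => by
    rw [← real_inner_self_eq_norm_sq, L2.inner_def]
    refine integral_congr_ae ?_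
    filter_upwards [hu.coeFn_toLp] with x hx
    simp [hx, pow_two]
  have h1 : Tendsto (fun n => (hf n).toLp (f n)) atTop (𝓝 (hg.toLp g)) :=
    (Lp.tendsto_Lp_iff_tendsto_eLpNorm'' _ hf _ hg).2 h
  have h2 := h1.norm.pow 2
  simpa only [hsq] using h2

/-- Linear combinations of Wiener integrals are centred Gaussian, with variance given by the Wiener
isometry. -/
theorem hasLaw_sum_of_isWienerIntegral {Ω : Type*} [MeasurableSpace Ω] {P : Measure Ω}
    {W : ℝ≥0 → Ω → ℝ} (hW : IsPreBrownianReal W P) (s : Finset ℕ) (a : ℕ → ℝ) {t : ℕ → ℝ≥0}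
    {g : ℕ → ℝ → ℝ} {Y : ℕ → Ω → ℝ} (hY : ∀ k, IsWienerIntegral P W (t k) (g k) (Y k))
    (hg : ∀ k, MemLp ((Set.Ioc 0 (t k : ℝ)).indicator (g k)) 2 volume) :
    HasLaw (fun ω => ∑ k ∈ s, a k * Y k ω) (gaussianReal 0
      (∫ x, (∑ k ∈ s, a k * (Set.Ioc 0 (t k : ℝ)).indicator (g k) x) ^ 2).toNNReal) P := by
  have hP : IsProbabilityMeasure P := hW.isGaussianProcess.isProbabilityMeasure
  have hε : ∀ n : ℕ, (0 : ℝ≥0∞) < ((n : ℝ≥0∞))⁻¹ := fun n => by simp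
  -- step functions approximating the integrands, with accuracy `1 / n`
  choose q c α β hαβ hφ hψ using fun (n k : ℕ) => (hY k).2 _ (hε n)
  set φ : ℕ → ℕ → ℝ → ℝ := fun n k x =>
    ∑ i, (Set.Ioc (α n k i : ℝ) (β n k i)).indicator (fun _ => c n k i) x with hφd
  set G : ℝ → ℝ := fun x => ∑ k ∈ s, a k * (Set.Ioc 0 (t k : ℝ)).indicator (g k) x with hG
  set Gn : ℕ → ℝ → ℝ := fun n x => ∑ k ∈ s, a k * φ n k x with hGn
  set Yn : ℕ → Ω → ℝ := fun n ω =>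
    ∑ k ∈ s, a k * ∑ i, c n k i * (W (β n k i) ω - W (α n k i) ω) with hYn
  have hlaw : ∀ n, HasLaw (Yn n) (gaussianReal 0 (∫ x, Gn n x ^ 2).toNNReal) P := fun n => by
    have h1 := IsPreBrownianReal.hasLaw_sum_increments hW
      (s.sigma fun k => (Finset.univ : Finset (Fin (q n k))))
      (fun i => a i.1 * c n i.1 i.2) (fun i => α n i.1 i.2) (fun i => β n i.1 i.2)
      (fun i => (hαβ n i.1 i.2).1)
    have h2 : Yn n = fun ω => ∑ i ∈ s.sigma fun k => (Finset.univ : Finset (Fin (q n k))),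
        a i.1 * c n i.1 i.2 * (W (β n i.1 i.2) ω - W (α n i.1 i.2) ω) := by
      funext ω
      simp only [hYn, Finset.sum_sigma, Finset.mul_sum, mul_assoc]
    have h3 : Gn n = fun x => ∑ i ∈ s.sigma fun k => (Finset.univ : Finset (Fin (q n k))),
        (Set.Ioc (α n i.1 i.2 : ℝ) (β n i.1 i.2)).indicator (fun _ => a i.1 * c n i.1 i.2) x := by
      funext x
      simp only [hGn, hφd, Finset.sum_sigma, Finset.mul_sum]
      refine Finset.sum_congr rfl fun k _ => Finset.sum_congr rfl fun i _ => ?_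
      simp only [Set.indicator_apply, mul_ite, mul_zero]
    rw [h2, h3]
    exact h1
  have hφL : ∀ n k, MemLp (φ n k) 2 volume := fun n k =>
    memLp_finsetSum _ fun i _ => memLp_indicator_const 2 measurableSet_Ioc _ (Or.inr (by simp))
  have hdiff : ∀ n k, eLpNorm (φ n k - (Set.Ioc 0 (t k : ℝ)).indicator (g k)) 2 volume ≤
      (n : ℝ≥0∞)⁻¹ := fun n k => by
    refine le_trans (le_of_eq ?_) (hφ n k)
    rw [← eLpNorm_indicator_eq_eLpNorm_restrict measurableSet_Ioc, ← eLpNorm_neg]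
    congr 1
    funext x
    by_cases hx : x ∈ Set.Ioc 0 (t k : ℝ)
    · simp [hx, hφd]
    · have h4 : φ n k x = 0 := Finset.sum_eq_zero fun i _ => Set.indicator_of_notMem (fun h => hx
        ⟨lt_of_le_of_lt (α n k i).2 h.1, h.2.trans (by exact_mod_cast (hαβ n k i).2)⟩) _
      simp [hx, h4]
  have hGL : MemLp G 2 volume := memLp_finsetSum _ fun k _ => (hg k).const_mul _
  have hGnL : ∀ n, MemLp (Gn n) 2 volume := fun n =>
    memLp_finsetSum _ fun k _ => (hφL n k).const_mul _
  have hYm : ∀ k, AEMeasurable (Y k) P := fun k => (hY k).1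
  have hWm : ∀ u, AEMeasurable (W u) P := hW.aemeasurable
  -- the common bound for the distance in `L²` to the limits
  have hlim : Tendsto (fun n : ℕ => ∑ k ∈ s, ‖a k‖ₑ * (n : ℝ≥0∞)⁻¹) atTop (𝓝 0) := by
    have h1 : ∀ k ∈ s, Tendsto (fun n : ℕ => ‖a k‖ₑ * (n : ℝ≥0∞)⁻¹) atTop (𝓝 0) := fun k _ => by
      have := ENNReal.Tendsto.const_mul (a := ‖a k‖ₑ) ENNReal.tendsto_inv_nat_nhds_zero
        (Or.inr (by simp))
      simpa using this
    simpa using tendsto_finsetSum s h1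
  have hYc : Tendsto (fun n => eLpNorm (Yn n - fun ω => ∑ k ∈ s, a k * Y k ω) 2 P) atTop (𝓝 0) := by
    refine tendsto_of_tendsto_of_tendsto_of_le_of_le tendsto_const_nhds hlim (fun n => zero_le)
      fun n => ?_
    have h1 : (Yn n - fun ω => ∑ k ∈ s, a k * Y k ω) = ∑ k ∈ s, a k • fun ω =>
        (∑ i, c n k i * (W (β n k i) ω - W (α n k i) ω)) - Y k ω := by
      funext ω
      simp [hYn, ← Finset.sum_sub_distrib, mul_sub]
    rw [h1]
    refine (eLpNorm_sum_le (fun k _ => ?_) (by norm_num)).trans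
      (Finset.sum_le_sum fun k _ => ?_)
    · exact ((Finset.aemeasurable_fun_sum _ fun i _ =>
        ((hWm _).sub (hWm _)).const_mul _).sub (hYm k)).aestronglyMeasurable.const_smul _
    · rw [eLpNorm_const_smul]
      refine mul_le_mul' le_rfl ?_
      rw [← eLpNorm_neg]
      refine le_trans (le_of_eq ?_) (hψ n k)
      congr 1
      funext ω
      simp
  have hGc : Tendsto (fun n => eLpNorm (Gn n - G) 2 volume) atTop (𝓝 0) := by
    refine tendsto_of_tendsto_of_tendsto_of_le_of_le tendsto_const_nhds hlim (fun n => zero_le)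
      fun n => ?_
    have h1 : Gn n - G = ∑ k ∈ s, a k • (φ n k - (Set.Ioc 0 (t k : ℝ)).indicator (g k)) := by
      funext x
      simp [hGn, hG, ← Finset.sum_sub_distrib, mul_sub]
    rw [h1]
    refine (eLpNorm_sum_le (fun k _ => ?_) (by norm_num)).trans
      (Finset.sum_le_sum fun k _ => ?_)
    · exact ((hφL n k).1.sub (hg k).1).const_smul _
    · rw [eLpNorm_const_smul]
      exact mul_le_mul' le_rfl (hdiff n k)
  refine HasLaw.gaussianReal_of_tendsto_eLpNorm hlaw ?_
    (Finset.aemeasurable_fun_sum _ fun k _ => (hYm k).const_mul _) hYc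
  exact (continuous_real_toNNReal.tendsto _).comp
    (tendsto_integral_sq_of_tendsto_eLpNorm hGnL hGL hGc)

/-! ### Equality of laws on the path space -/

/-- A law on the path space is determined by the laws of the linear combinations of values: evaluation
at a dense sequence of times is a measurable embedding into `ℕ → ℝ`, where the finite-dimensional laws
are determined by their characteristic functions. -/
theorem PathSpace.measure_ext {T : ℝ} (hT : 0 < T) {μ ν : Measure (PathSpace T)}
    [IsProbabilityMeasure μ] [IsProbabilityMeasure ν]
    (h : ∀ (s : Finset ℕ) (a : ℕ → ℝ) (t : ℕ → Set.Icc (0 : ℝ) T),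
      μ.map (fun x => ∑ k ∈ s, a k * x (t k)) = ν.map fun x => ∑ k ∈ s, a k * x (t k)) :
    μ = ν := by
  have : Nonempty (Set.Icc (0 : ℝ) T) := ⟨⟨0, by simp [hT.le]⟩⟩
  set t : ℕ → Set.Icc (0 : ℝ) T := TopologicalSpace.denseSeq _ with ht
  set ι : PathSpace T → ℕ → ℝ := fun x n => x (t n) with hι
  have hιc : Continuous ι := continuous_pi fun n => continuous_eval_const (t n)
  have hιi : Function.Injective ι := fun x y hxy => by
    refine ContinuousMap.coe_injective (Continuous.ext_on
      (TopologicalSpace.denseRange_denseSeq _) x.continuous y.continuous ?_)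
    rintro _ ⟨n, rfl⟩
    exact congrFun hxy n
  refine (hιc.measurableEmbedding hιi).map_injective ?_
  have hμ := Measure.isProbabilityMeasure_map (μ := μ) hιc.measurable.aemeasurable
  have hν := Measure.isProbabilityMeasure_map (μ := ν) hιc.measurable.aemeasurable
  refine IsProjectiveLimit.unique (P := fun I : Finset ℕ => (ν.map ι).map I.restrict)
    (fun I => ?_) fun I => rfl
  have hr := Finset.measurable_restrict (X := fun _ : ℕ => ℝ) I
  have hμ' := Measure.isProbabilityMeasure_map (μ := μ.map ι) hr.aemeasurable
  have hν' := Measure.isProbabilityMeasure_map (μ := ν.map ι) hr.aemeasurable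
  change (μ.map ι).map I.restrict = (ν.map ι).map I.restrict
  refine Measure.ext_of_charFunDual (funext fun L => ?_)
  rw [charFunDual_eq_charFun_map_one, charFunDual_eq_charFun_map_one]
  have hL : ∀ κ : Measure (PathSpace T), ((κ.map ι).map I.restrict).map L =
      κ.map fun x => ∑ k ∈ I, (if h : k ∈ I then L (Pi.single ⟨k, h⟩ 1) else 0) * x (t k) :=
    fun κ => by
      rw [Measure.map_map L.continuous.measurable hr,
        Measure.map_map (L.continuous.measurable.comp hr) hιc.measurable]
      congr 1
      funext x
      rw [← Finset.sum_coe_sort I]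
      simp only [Function.comp_apply]
      conv_lhs => rw [pi_eq_sum_univ' (I.restrict (ι x))]
      rw [map_sum]
      refine Finset.sum_congr rfl fun i _ => ?_
      rw [map_smul, smul_eq_mul, mul_comm, dif_pos i.2]
      rfl
  rw [hL, hL, h]

/-! ### The law of the cosine series -/

/-- The kernel `s ↦ ψ(t - s) 1_{(0, t]}(s)`, whose Wiener integral is the value at time `t` of the
Riemann–Liouville process. -/
noncomputable def rlWienerKernel (ρ t : ℝ) : ℝ → ℝ := (Set.Ioc 0 t).indicator fun s => rlKernel ρ (t - s)

theorem memLp_rlWienerKernel {ρ : ℝ} (hρ : 0 < ρ) {t : ℝ} (ht : 0 ≤ t) :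
    MemLp (rlWienerKernel ρ t) 2 volume := by
  have hm : Measurable (rlWienerKernel ρ t) := by
    unfold rlWienerKernel rlKernel
    exact Measurable.indicator (by fun_prop) measurableSet_Ioc
  refine (memLp_two_iff_integrable_sq hm.aestronglyMeasurable).2 ?_
  have h1 : (fun s => rlWienerKernel ρ t s ^ 2) =
      (Set.Ioc 0 t).indicator fun s => (t - s) ^ (2 * ρ - 1) := by
    funext s
    by_cases hs : s ∈ Set.Ioc 0 t
    · rw [rlWienerKernel, Set.indicator_of_mem hs, Set.indicator_of_mem hs, rlKernel,
        ← Real.rpow_mul_natCast (by linarith [hs.2])]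
      congr 1
      push_cast
      ring
    · rw [rlWienerKernel, Set.indicator_of_notMem hs, Set.indicator_of_notMem hs]
      norm_num
  rw [h1, integrable_indicator_iff measurableSet_Ioc, ← intervalIntegrable_iff_integrableOn_Ioc_of_le ht]
  have h2 : IntervalIntegrable (fun s : ℝ => s ^ (2 * ρ - 1)) volume t 0 :=
    intervalIntegral.intervalIntegrable_rpow' (by linarith)
  simpa using h2.comp_sub_left t

theorem cosineSequence_apply_eq_integral {T ρ : ℝ} (hρ : 0 < ρ) (j : ℕ) (t : Set.Icc (0 : ℝ) T) :
    cosineSequence T ρ hρ j t =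
      √(2 / T) * ∫ s, rlWienerKernel ρ t s * Real.cos (s * cosineFrequency T j) := by
  rw [cosineSequence_apply]
  congr 1
  have h1 := intervalIntegral.integral_comp_sub_left (a := 0) (b := (t : ℝ))
    (fun s => rlKernel ρ s * Real.cos ((t - s) * cosineFrequency T j)) t
  simp only [sub_sub_cancel, sub_self, sub_zero] at h1
  rw [← h1, intervalIntegral.integral_of_le t.2.1, ← integral_indicator measurableSet_Ioc]
  refine integral_congr_ae (Eventually.of_forall fun s => ?_)
  simp only [rlWienerKernel, Set.indicator_apply]
  split_ifs <;> simp

theorem hasLaw_sum_gaussianSeries_cosineSequence {T ρ : ℝ} (hT : 0 < T) (hρ : 0 < ρ)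
    (hf : GaussianSeriesConverges (cosineSequence T ρ hρ)) (s : Finset ℕ) (a : ℕ → ℝ)
    (t : ℕ → Set.Icc (0 : ℝ) T) :
    HasLaw (fun ω => ∑ k ∈ s, a k * gaussianSeries (cosineSequence T ρ hρ) ω (t k))
      (gaussianReal 0 (∫ x, (∑ k ∈ s, a k * rlWienerKernel ρ (t k) x) ^ 2).toNNReal)
      gaussianSequence := by
  set f := cosineSequence T ρ hρ with hfd
  set G : ℝ → ℝ := fun x => ∑ k ∈ s, a k * rlWienerKernel ρ (t k) x with hG
  have hKL : ∀ k, MemLp (rlWienerKernel ρ (t k)) 2 volume := fun k =>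
    memLp_rlWienerKernel hρ (t k).2.1
  have hK0 : ∀ k x, x ∉ Set.Ioc 0 T → rlWienerKernel ρ (t k) x = 0 := fun k x hx =>
    Set.indicator_of_notMem (fun h => hx ⟨h.1, h.2.trans (t k).2.2⟩) _
  have hGL : MemLp G 2 volume := memLp_finsetSum _ fun k _ => (hKL k).const_mul _
  have hP := hasSum_sq_integral_mul_cos hT hGL fun x hx =>
    Finset.sum_eq_zero fun k _ => by rw [hK0 k x hx, mul_zero]
  have hKi : ∀ k, Integrable (rlWienerKernel ρ (t k)) := fun k =>
    (integrableOn_iff_integrable_of_support_subset (s := Set.Ioc 0 T) fun x hx => by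
      by_contra h; exact hx (hK0 k x h)).1 (((hKL k).restrict _).integrable (by norm_num))
  have hc : ∀ j, √(2 / T) * ∫ x, G x * Real.cos (x * cosineFrequency T j) =
      ∑ k ∈ s, a k * f j (t k) := fun j => by
    simp only [hG, Finset.sum_mul, hfd, cosineSequence_apply_eq_integral]
    rw [integral_finsetSum, Finset.mul_sum]
    · refine Finset.sum_congr rfl fun k _ => ?_
      simp only [mul_assoc]
      rw [integral_const_mul]
      ring
    · intro k _
      exact ((hKi k).const_mul (a k)).mul_bdd (c := 1) (by fun_prop)
        (Eventually.of_forall fun x => Real.abs_cos_le_one _)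
  simp only [hc] at hP
  refine HasLaw.gaussianReal_of_tendsto_ae
    (fun n => hasLaw_sum_gaussianSequence (Finset.range n) fun j => ∑ k ∈ s, a k * f j (t k))
    ((continuous_real_toNNReal.tendsto _).comp hP.tendsto_sum_nat) ?_
  filter_upwards [tendsto_gaussianSeries hf] with ω hω
  have h1 : ∀ n, (∑ j ∈ Finset.range n, (∑ k ∈ s, a k * f j (t k)) * ω j) =
      ∑ k ∈ s, a k * (∑ j ∈ Finset.range n, ω j • f j) (t k) := fun n => by
    simp only [Finset.sum_mul, ContinuousMap.sum_apply, ContinuousMap.smul_apply, Finset.mul_sum]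
    rw [Finset.sum_comm]
    refine Finset.sum_congr rfl fun k _ => Finset.sum_congr rfl fun j _ => ?_
    rw [smul_eq_mul]
    ring
  simp only [h1]
  exact tendsto_finsetSum _ fun k _ =>
    (((continuous_eval_const (t k)).tendsto _).comp hω).const_mul _

/-- If the cosine series converges, then its sum is a Riemann–Liouville process in law: by Parseval's
identity and the Wiener isometry, both processes have the same Gaussian finite-dimensional laws. -/
theorem isAdmissible_cosineSequence {Ω : Type*} [MeasurableSpace Ω] {P : Measure Ω}
    {W : ℝ≥0 → Ω → ℝ} (hW : IsPreBrownianReal W P) {T ρ : ℝ} (hT : 0 < T) (hρ : 0 < ρ)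
    {X : Ω → PathSpace T} (hX : IsRiemannLiouville P W ρ T X)
    (hf : GaussianSeriesConverges (cosineSequence T ρ hρ)) :
    IsAdmissible (cosineSequence T ρ hρ) (P.map X) := by
  have hP : IsProbabilityMeasure P := hW.isGaussianProcess.isProbabilityMeasure
  have hS := (aestronglyMeasurable_gaussianSeries hf).aemeasurable
  have h1 := Measure.isProbabilityMeasure_map (μ := P) hX.1.aemeasurable
  have h2 := Measure.isProbabilityMeasure_map (μ := gaussianSequence) hS
  refine ⟨hf, PathSpace.measure_ext hT fun s a t => ?_⟩
  have hm : Measurable fun x : PathSpace T => ∑ k ∈ s, a k * x (t k) :=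
    (continuous_finsetSum _ fun k _ =>
      (continuous_eval_const (t k)).const_mul (a k)).measurable
  rw [AEMeasurable.map_map_of_aemeasurable hm.aemeasurable hS, Measure.map_map hm hX.1]
  have h3 := (hasLaw_sum_gaussianSeries_cosineSequence hT hρ hf s a t).map_eq
  have h4 := (hasLaw_sum_of_isWienerIntegral hW s a (t := fun k => Real.toNNReal (t k))
    (g := fun k x => rlKernel ρ (t k - x)) (Y := fun k ω => X ω (t k)) (fun k => hX.2 (t k))
    (fun k => by
      rw [Real.coe_toNNReal _ (t k).2.1]
      exact memLp_rlWienerKernel hρ (t k).2.1)).map_eq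
  have h5 : ∀ k, ((Real.toNNReal (t k) : ℝ≥0) : ℝ) = t k := fun k => Real.coe_toNNReal _ (t k).2.1
  simp only [h5] at h4
  exact h3.trans h4.symm

/-! ### The boundary terms -/

theorem ae_summable_mul_gaussianSequence {a : ℕ → ℝ} (ha : ∀ j, 0 ≤ a j) (h : Summable a) :
    ∀ᵐ ω ∂gaussianSequence, Summable fun j => a j * ω j := by
  have hm : ∀ j, Measurable fun ω : ℕ → ℝ => ‖a j * ω j‖ₑ := fun j => by fun_prop
  have h1 : ∀ j, ∫⁻ ω, ‖a j * ω j‖ₑ ∂gaussianSequence =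
      ENNReal.ofReal (a j) * eLpNorm id 1 (gaussianReal 0 1) := fun j => by
    rw [← eLpNorm_eval_gaussianSequence 1 j, eLpNorm_one_eq_lintegral_enorm,
      ← lintegral_const_mul _ (by fun_prop)]
    refine lintegral_congr fun ω => ?_
    rw [enorm_mul, Real.enorm_of_nonneg (ha j)]
  have hsum : ∫⁻ ω, ∑' j, ‖a j * ω j‖ₑ ∂gaussianSequence ≠ ∞ := by
    rw [lintegral_tsum fun j => (hm j).aemeasurable]
    simp only [h1]
    rw [ENNReal.tsum_mul_right]
    exact ENNReal.mul_ne_top h.tsum_ofReal_ne_top (memLp_id_gaussianReal' 1 (by simp)).2.ne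
  filter_upwards [ae_lt_top' (AEMeasurable.tsum fun j => (hm j).aemeasurable) hsum] with ω hω
  refine Summable.of_norm ?_
  simpa using ENNReal.summable_toReal hω.ne

theorem hasLaw_boundaryCoefficient {T : ℝ} (hT : 0 < T) (m : ℕ) :
    HasLaw (boundaryCoefficient T m)
      (gaussianReal 0 (∑' j, (cosineEigenvalue T j ^ (m + 1)) ^ 2).toNNReal) gaussianSequence := by
  have hs : Summable fun j => (cosineEigenvalue T j ^ (m + 1)) ^ 2 := by
    refine (summable_cosineEigenvalue_pow hT (m + (m + 1))).congr fun j => ?_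
    rw [← pow_mul]
    congr 1
    ring
  refine HasLaw.gaussianReal_of_tendsto_ae
    (fun n => hasLaw_sum_gaussianSequence (Finset.range n) fun j => cosineEigenvalue T j ^ (m + 1))
    ((continuous_real_toNNReal.tendsto _).comp hs.hasSum.tendsto_sum_nat) ?_
  filter_upwards [ae_summable_mul_gaussianSequence
    (fun j => pow_nonneg (cosineEigenvalue_nonneg T j) (m + 1))
    (summable_cosineEigenvalue_pow hT m)] with ω hω
  exact hω.hasSum.tendsto_sum_nat

theorem memLp_boundaryCoefficient {T : ℝ} (hT : 0 < T) (m : ℕ) {p : ℝ≥0∞} (hp : p ≠ ∞) :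
    MemLp (boundaryCoefficient T m) p gaussianSequence := by
  have h := hasLaw_boundaryCoefficient hT m
  have h1 := memLp_id_gaussianReal' (μ := 0)
    (v := (∑' j, (cosineEigenvalue T j ^ (m + 1)) ^ 2).toNNReal) p hp
  rw [← h.map_eq] at h1
  exact h1.comp_of_map h.aemeasurable

theorem ae_tendsto_sum_cosineBoundary {T ρ : ℝ} (hT : 0 < T) {n : ℕ}
    (hn : 2 * (n : ℝ) < ρ + 1 / 2) :
    ∀ᵐ ω ∂gaussianSequence,
      Tendsto (fun k => ∑ j ∈ Finset.range k, ω j • cosineBoundary T ρ n hn j) atTop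
        (𝓝 (finiteDimensionalPart T ρ n hn ω)) := by
  have h : ∀ᵐ ω ∂gaussianSequence, ∀ m : Fin n,
      Summable fun j => cosineEigenvalue T j ^ ((m : ℕ) + 1) * ω j :=
    ae_all_iff.2 fun m => ae_summable_mul_gaussianSequence
      (fun j => pow_nonneg (cosineEigenvalue_nonneg T j) _) (summable_cosineEigenvalue_pow hT m)
  filter_upwards [h] with ω hω
  have h1 : ∀ k, ∑ j ∈ Finset.range k, ω j • cosineBoundary T ρ n hn j =
      ∑ m : Fin n, (∑ j ∈ Finset.range k, cosineEigenvalue T j ^ ((m : ℕ) + 1) * ω j) •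
        boundaryPath T ρ n hn m := fun k => by
    simp only [cosineBoundary, Finset.smul_sum, Finset.sum_smul, smul_smul]
    rw [Finset.sum_comm]
    simp only [mul_comm]
  simp only [h1, finiteDimensionalPart]
  exact tendsto_finsetSum _ fun m _ => ((hω m).hasSum.tendsto_sum_nat).smul_const _

theorem gaussianSeriesConverges_cosineRemainder {T ρ : ℝ} (hT : 0 < T) (hρ : 0 < ρ) {n : ℕ}
    (hn : 2 * (n : ℝ) < ρ + 1 / 2) (hn' : ρ ≤ 2 * (n : ℝ) + 3 / 2) :
    GaussianSeriesConverges (cosineRemainder T ρ n hn) := by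
  obtain ⟨K, hK, hf⟩ := exists_norm_cosineRemainder_le hT hn hn'
  obtain ⟨K', a, hK', ha, hf'⟩ := exists_abs_cosineRemainder_sub_le (ρ := ρ) hT hn
  exact gaussianSeriesConverges_of_norm_le hT hρ hK hK' ha hf hf'

theorem ae_tendsto_sum_cosineSequence {T ρ : ℝ} (hT : 0 < T) (hρ : 0 < ρ) {n : ℕ}
    (hn : 2 * (n : ℝ) < ρ + 1 / 2) (hn' : ρ ≤ 2 * (n : ℝ) + 3 / 2) :
    ∀ᵐ ω ∂gaussianSequence,
      Tendsto (fun k => ∑ j ∈ Finset.range k, ω j • cosineSequence T ρ hρ j) atTop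
        (𝓝 (finiteDimensionalPart T ρ n hn ω + gaussianSeries (cosineRemainder T ρ n hn) ω)) := by
  filter_upwards [ae_tendsto_sum_cosineBoundary hT hn,
    tendsto_gaussianSeries (gaussianSeriesConverges_cosineRemainder hT hρ hn hn')] with ω h1 h2
  refine (h1.add h2).congr fun k => ?_
  rw [← Finset.sum_add_distrib]
  exact Finset.sum_congr rfl fun j _ => by rw [cosineSequence_eq_add hT hρ hn, smul_add]

theorem gaussianSeriesConverges_cosineSequence {T ρ : ℝ} (hT : 0 < T) (hρ : 0 < ρ) :
    GaussianSeriesConverges (cosineSequence T ρ hρ) := by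
  obtain ⟨n, hn, hn'⟩ : ∃ n : ℕ, 2 * (n : ℝ) < ρ + 1 / 2 ∧ ρ ≤ 2 * (n : ℝ) + 3 / 2 := by
    rcases le_or_gt ρ (3 / 2) with h | h
    · exact ⟨0, by push_cast; linarith, by push_cast; linarith⟩
    · refine ⟨⌈(ρ - 3 / 2) / 2⌉₊, ?_, ?_⟩
      · linarith [Nat.ceil_lt_add_one (show 0 ≤ (ρ - 3 / 2) / 2 by linarith)]
      · linarith [Nat.le_ceil ((ρ - 3 / 2) / 2)]
  exact (ae_tendsto_sum_cosineSequence hT hρ hn hn').mono fun ω h => ⟨_, h⟩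

theorem gaussianSeries_cosineSequence_ae_eq {T ρ : ℝ} (hT : 0 < T) (hρ : 0 < ρ) {n : ℕ}
    (hn : 2 * (n : ℝ) < ρ + 1 / 2) (hn' : ρ ≤ 2 * (n : ℝ) + 3 / 2) :
    gaussianSeries (cosineSequence T ρ hρ) =ᵐ[gaussianSequence] fun ω =>
      finiteDimensionalPart T ρ n hn ω + gaussianSeries (cosineRemainder T ρ n hn) ω := by
  filter_upwards [ae_tendsto_sum_cosineSequence hT hρ hn hn',
    tendsto_gaussianSeries (gaussianSeriesConverges_cosineSequence hT hρ)] with ω h1 h2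
  exact tendsto_nhds_unique h2 h1

theorem exists_cosineRemainder_quantization_rate {T ρ r : ℝ} (hT : 0 < T) (hρ : 0 < ρ)
    (hr : 0 < r) {n : ℕ} (hn : 2 * (n : ℝ) < ρ + 1 / 2) (hn' : ρ ≤ 2 * (n : ℝ) + 3 / 2) :
    ∃ C : ℝ, 0 ≤ C ∧ ∀ᶠ N : ℕ in atTop, ∃ (p : ℕ) (L : Fin p → ℕ), IsLevelAllocation N L ∧
      (∃ Xh, IsProductQuantization r (cosineRemainder T ρ n hn) L Xh) ∧
      ∀ Xh, IsProductQuantization r (cosineRemainder T ρ n hn) L Xh →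
        quantizationError gaussianSequence r (gaussianSeries (cosineRemainder T ρ n hn)) Xh ≤
          ENNReal.ofReal (C * rlRate ρ N) := by
  obtain ⟨K, hK, hf⟩ := exists_norm_cosineRemainder_le hT hn hn'
  obtain ⟨K', a, hK', ha, hf'⟩ := exists_abs_cosineRemainder_sub_le (ρ := ρ) hT hn
  exact exists_product_quantization_rate hT hρ hK hK' ha hr hf hf'

/-! ### The modified product quantization -/

theorem encard_range_pi_le {α β ι : Type*} [Fintype ι] {f : ι → α → β} {N : ι → ℕ}
    (h : ∀ i, (Set.range (f i)).encard ≤ N i) :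
    (Set.range fun x i => f i x).encard ≤ (∏ i, N i : ℕ) := by
  classical
  have hfin : ∀ i, (Set.range (f i)).Finite := fun i => Set.finite_of_encard_le_coe (h i)
  have hcard : ∀ i, (hfin i).toFinset.card ≤ N i := fun i => by
    have h1 := h i
    rw [← (hfin i).coe_toFinset, Set.encard_coe_eq_coe_finsetCard] at h1
    exact_mod_cast h1
  have hsub : (Set.range fun x i => f i x) ⊆
      (Fintype.piFinset fun i => (hfin i).toFinset : Finset (ι → β)) := by
    rintro _ ⟨x, rfl⟩
    simp
  refine (Set.encard_le_encard hsub).trans ?_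
  rw [Set.encard_coe_eq_coe_finsetCard, Fintype.card_piFinset]
  exact_mod_cast Finset.prod_le_prod' fun i _ => hcard i

theorem isQuantization_of_isModifiedProductQuantization {T ρ r : ℝ} {n : ℕ}
    {hn : 2 * (n : ℝ) < ρ + 1 / 2} {M N p : ℕ} {L : Fin p → ℕ} (h : M ^ n * ∏ j, L j ≤ N)
    {Xh : (ℕ → ℝ) → PathSpace T} (hX : IsModifiedProductQuantization T ρ n hn r M L Xh) :
    IsQuantization N Xh := by
  obtain ⟨ηh, Zh, hη, ⟨ξh, hξ, rfl⟩, rfl⟩ := hX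
  refine ⟨?_, ?_⟩
  · refine Measurable.add ?_ ?_
    · exact Finset.measurable_fun_sum _ fun m _ => (hη m).1.1.smul_const _
    · exact Finset.measurable_fun_sum _ fun j _ => (hξ j).1.1.smul_const _
  · have h1 := encard_range_pi_le (f := Sum.elim ηh ξh) (N := Sum.elim (fun _ => M) L) (by
      rintro (m | j)
      · exact (hη m).1.2
      · exact (hξ j).1.2)
    simp only [Fintype.prod_sum_type, Sum.elim_inl, Sum.elim_inr, Finset.prod_const,
      Finset.card_univ, Fintype.card_fin] at h1
    set Φ : (Fin n ⊕ Fin p → ℝ) → PathSpace T := fun x =>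
      (∑ m, x (Sum.inl m) • boundaryPath T ρ n hn m) +
        ∑ j, x (Sum.inr j) • cosineRemainder T ρ n hn j with hΦ
    have h2 : (Set.range fun ω => (∑ m, ηh m ω • boundaryPath T ρ n hn m) +
        ∑ j, ξh j ω • cosineRemainder T ρ n hn j) =
          Φ '' Set.range fun ω i => Sum.elim ηh ξh i ω := by
      rw [← Set.range_comp]
      rfl
    rw [h2]
    exact (Set.encard_image_le _ _).trans (h1.trans (by exact_mod_cast h))

theorem floor_rpow_pow_mul_floor_sqrt_le {n : ℕ} (hn : 1 ≤ n) (N : ℕ) :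
    ⌊(N : ℝ) ^ (1 / (2 * (n : ℝ)))⌋₊ ^ n * ⌊√(N : ℝ)⌋₊ ≤ N := by
  have hn0 : (n : ℝ) ≠ 0 := by positivity
  have h1 : ((⌊(N : ℝ) ^ (1 / (2 * (n : ℝ)))⌋₊ : ℝ)) ^ n ≤ √N := by
    calc ((⌊(N : ℝ) ^ (1 / (2 * (n : ℝ)))⌋₊ : ℝ)) ^ n ≤ ((N : ℝ) ^ (1 / (2 * (n : ℝ)))) ^ n :=
          pow_le_pow_left₀ (by positivity) (Nat.floor_le (by positivity)) n
      _ = √N := by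
          rw [← Real.rpow_mul_natCast (by positivity), Real.sqrt_eq_rpow]
          congr 1
          field_simp
  have h2 : (⌊√(N : ℝ)⌋₊ : ℝ) ≤ √N := Nat.floor_le (by positivity)
  have h3 : ((⌊(N : ℝ) ^ (1 / (2 * (n : ℝ)))⌋₊ : ℝ)) ^ n * ⌊√(N : ℝ)⌋₊ ≤ N :=
    (mul_le_mul h1 h2 (by positivity) (by positivity)).trans_eq
      (Real.mul_self_sqrt (by positivity))
  exact_mod_cast h3

theorem tendsto_floor_sqrt_natCast : Tendsto (fun N : ℕ => ⌊√(N : ℝ)⌋₊) atTop atTop :=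
  tendsto_nat_floor_atTop.comp (Real.tendsto_sqrt_atTop.comp tendsto_natCast_atTop_atTop)

theorem eventually_rlRate_floor_sqrt_le {ρ : ℝ} (hρ : 0 < ρ) :
    ∀ᶠ N : ℕ in atTop, rlRate ρ ⌊√(N : ℝ)⌋₊ ≤ 4 ^ ρ * rlRate ρ N := by
  filter_upwards [tendsto_floor_sqrt_natCast.eventually_ge_atTop 3, eventually_ge_atTop 1]
    with N hs hN
  set s := ⌊√(N : ℝ)⌋₊ with hsd
  have hs3 : (3 : ℝ) ≤ s := by exact_mod_cast hs
  have hN0 : (0 : ℝ) < N := by exact_mod_cast hN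
  have hsN : (s : ℝ) ≤ N := by
    have h1 : (s : ℝ) ≤ √N := Nat.floor_le (by positivity)
    have h2 : √(N : ℝ) * √N = N := Real.mul_self_sqrt hN0.le
    nlinarith
  have hNs : (N : ℝ) ≤ (s : ℝ) ^ 4 := by
    have h1 : √(N : ℝ) < s + 1 := Nat.lt_floor_add_one _
    have h2 : √(N : ℝ) * √N = N := Real.mul_self_sqrt hN0.le
    have h3 : (0 : ℝ) ≤ √N := by positivity
    have h4 : √(N : ℝ) ≤ (s : ℝ) ^ 2 := by nlinarith
    calc (N : ℝ) = √N * √N := h2.symm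
      _ ≤ (s : ℝ) ^ 2 * (s : ℝ) ^ 2 := mul_le_mul h4 h4 h3 (by positivity)
      _ = _ := by ring
  have hl1 : 1 ≤ Real.log s := by
    rw [Real.le_log_iff_exp_le (by linarith)]
    linarith [Real.exp_one_lt_d9]
  have hl : Real.log s ≤ Real.log N := Real.log_le_log (by linarith) hsN
  have hl4 : Real.log N / 4 ≤ Real.log s := by
    have := Real.log_le_log hN0 hNs
    rw [Real.log_pow] at this
    push_cast at this
    linarith
  have hl0 : 0 < Real.log N := by linarith
  unfold rlRate
  calc Real.log (Real.log s) ^ (ρ + 1 / 2) / Real.log s ^ ρ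
      ≤ Real.log (Real.log N) ^ (ρ + 1 / 2) / (Real.log N / 4) ^ ρ := by
        have h1 : 0 ≤ Real.log (Real.log s) := Real.log_nonneg hl1
        have h2 : Real.log (Real.log s) ≤ Real.log (Real.log N) :=
          Real.log_le_log (by linarith) hl
        exact div_le_div₀ (Real.rpow_nonneg (h1.trans h2) _)
          (Real.rpow_le_rpow h1 h2 (by linarith)) (by positivity)
          (Real.rpow_le_rpow (by positivity) hl4 hρ.le)
    _ = 4 ^ ρ * (Real.log (Real.log N) ^ (ρ + 1 / 2) / Real.log N ^ ρ) := by
        rw [Real.div_rpow hl0.le (by norm_num), div_div_eq_mul_div]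
        ring

/-- The quantization error of a real random variable at the polynomial level `⌊N^{1/(2n)}⌋` is
negligible with respect to the logarithmic rate. -/
theorem eventually_exists_inv_sqrt_le_rlRate {ρ : ℝ} (hρ : 0 < ρ) {n : ℕ} (hn : 1 ≤ n) :
    ∀ᶠ N : ℕ in atTop, ∃ K : ℕ, 1 ≤ K ∧ 2 * K ≤ ⌊(N : ℝ) ^ (1 / (2 * (n : ℝ)))⌋₊ ∧
      1 / √(K : ℝ) ≤ 2 * rlRate ρ N := by
  have hn0 : (0 : ℝ) < n := by exact_mod_cast hn
  have hx := (tendsto_rpow_atTop (show 0 < 1 / (2 * (n : ℝ)) by positivity)).comp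
    (tendsto_natCast_atTop_atTop (R := ℝ))
  have hlog := (isLittleO_log_rpow_rpow_atTop ρ (show 0 < 1 / (4 * (n : ℝ)) by positivity)).bound
    (show (0 : ℝ) < 1 by norm_num)
  have hloglog : Tendsto (fun N : ℕ => Real.log (Real.log N)) atTop atTop :=
    Real.tendsto_log_atTop.comp (Real.tendsto_log_atTop.comp tendsto_natCast_atTop_atTop)
  filter_upwards [hx.eventually_ge_atTop 4, tendsto_natCast_atTop_atTop.eventually hlog,
    hloglog.eventually_ge_atTop 1, eventually_ge_atTop 1,
    (Real.tendsto_log_atTop.comp tendsto_natCast_atTop_atTop).eventually_ge_atTop 1]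
    with N hx4 hN hll hN1 hl
  simp only [Function.comp_apply] at hx4 hl
  have hN0 : (0 : ℝ) < N := by exact_mod_cast hN1
  set x : ℝ := (N : ℝ) ^ (1 / (2 * (n : ℝ))) with hxd
  have hM : x < ⌊x⌋₊ + 1 := Nat.lt_floor_add_one x
  -- with `K = ⌊x⌋₊ / 2`, the bound `x ≥ 4` gives `K ≥ x / 4`
  have hK2 : (⌊x⌋₊ : ℝ) ≤ 2 * (⌊x⌋₊ / 2 : ℕ) + 1 := by
    have : ⌊x⌋₊ ≤ 2 * (⌊x⌋₊ / 2) + 1 := by omega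
    exact_mod_cast this
  have hK : x / 4 ≤ (⌊x⌋₊ / 2 : ℕ) := by linarith
  have hK1 : (1 : ℝ) ≤ (⌊x⌋₊ / 2 : ℕ) := by linarith
  refine ⟨⌊x⌋₊ / 2, by exact_mod_cast hK1, by omega, ?_⟩
  rw [Real.norm_of_nonneg (by positivity), Real.norm_of_nonneg (by positivity), one_mul] at hN
  have hlρ : 0 < Real.log N ^ ρ := by positivity
  have hsq : √(x / 4) = (N : ℝ) ^ (1 / (4 * (n : ℝ))) / 2 := by
    rw [Real.sqrt_div (by positivity), show (4 : ℝ) = 2 ^ 2 by norm_num,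
      Real.sqrt_sq (by norm_num), hxd, Real.sqrt_eq_rpow, ← Real.rpow_mul hN0.le]
    congr 2
    field_simp
  calc 1 / √((⌊x⌋₊ / 2 : ℕ) : ℝ) ≤ 1 / √(x / 4) :=
        one_div_le_one_div_of_le (by positivity) (Real.sqrt_le_sqrt hK)
    _ = 2 * (1 / (N : ℝ) ^ (1 / (4 * (n : ℝ)))) := by
        rw [hsq]
        field_simp
    _ ≤ 2 * (1 / Real.log N ^ ρ) := by
        gcongr
    _ ≤ 2 * rlRate ρ N := by
        unfold rlRate
        gcongr
        exact Real.one_le_rpow hll (by linarith)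

theorem quantizationError_le_of_isModifiedProductQuantization {T ρ r : ℝ} (hT : 0 < T)
    (hr : 0 < r) {n : ℕ} {hn : 2 * (n : ℝ) < ρ + 1 / 2}
    (hh : GaussianSeriesConverges (cosineRemainder T ρ n hn)) {M p : ℕ} {L : Fin p → ℕ}
    {K : ℝ} (hK : ∀ m, ‖boundaryPath T ρ n hn m‖ ≤ K) {ε δ : ℝ≥0∞}
    (hε : ∀ m : Fin n, minimalQuantizationError gaussianSequence M r (boundaryCoefficient T m) ≤ ε)
    (hδ : ∀ Zh, IsProductQuantization r (cosineRemainder T ρ n hn) L Zh →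
      quantizationError gaussianSequence r (gaussianSeries (cosineRemainder T ρ n hn)) Zh ≤ δ)
    {Xh : (ℕ → ℝ) → PathSpace T} (hX : IsModifiedProductQuantization T ρ n hn r M L Xh) :
    quantizationError gaussianSequence r (fun ω =>
      finiteDimensionalPart T ρ n hn ω + gaussianSeries (cosineRemainder T ρ n hn) ω) Xh ≤
        ENNReal.LpAddConst (ENNReal.ofReal r) *
          (ENNReal.ofReal K * (n : ℝ≥0∞) ^ (1 + 1 / r) * ε + δ) := by
  obtain ⟨ηh, Zh, hη, hZ, rfl⟩ := hX
  have hd : ∀ m : Fin n, AEMeasurable (fun ω => boundaryCoefficient T m ω - ηh m ω)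
      gaussianSequence := fun m =>
    (hasLaw_boundaryCoefficient hT m).aemeasurable.sub (hη m).1.1.aemeasurable
  have hZm : AEStronglyMeasurable Zh gaussianSequence := by
    obtain ⟨ξh, hξ, rfl⟩ := hZ
    exact (Finset.measurable_fun_sum _ fun j _ =>
      (hξ j).1.1.smul_const _).aestronglyMeasurable
  have h1 : (fun ω => finiteDimensionalPart T ρ n hn ω +
      gaussianSeries (cosineRemainder T ρ n hn) ω -
        ((∑ m, ηh m ω • boundaryPath T ρ n hn m) + Zh ω)) =
      (fun ω => ∑ m : Fin n, (boundaryCoefficient T m ω - ηh m ω) • boundaryPath T ρ n hn m) +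
        fun ω => gaussianSeries (cosineRemainder T ρ n hn) ω - Zh ω := by
    funext ω
    simp only [Pi.add_apply, finiteDimensionalPart, sub_smul, Finset.sum_sub_distrib]
    abel
  unfold quantizationError
  rw [h1]
  refine (eLpNorm_add_le' ?_ ((aestronglyMeasurable_gaussianSeries hh).sub hZm) _).trans
    (mul_le_mul' le_rfl (add_le_add ?_ (hδ Zh hZ)))
  · exact (Finset.aemeasurable_fun_sum _ fun m _ => (hd m).smul_const _).aestronglyMeasurable
  · exact eLpNorm_sum_smul_le hr hd hK fun m => ((hη m).2.trans_le (hε m))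

theorem exists_isModifiedProductQuantization {T ρ r : ℝ} (hT : 0 < T) (hr : 0 < r) {n : ℕ}
    {hn : 2 * (n : ℝ) < ρ + 1 / 2} {M p : ℕ} (hM : 1 ≤ M) {L : Fin p → ℕ}
    (h : ∃ Zh, IsProductQuantization r (cosineRemainder T ρ n hn) L Zh) :
    ∃ Xh, IsModifiedProductQuantization T ρ n hn r M L Xh := by
  obtain ⟨Zh, hZ⟩ := h
  choose ηh hη using fun m : Fin n => exists_isOptimalQuantization gaussianSequence hr
    (memLp_boundaryCoefficient hT m (ENNReal.ofReal_ne_top (r := r))) hM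
  exact ⟨_, ηh, Zh, hη, hZ, rfl⟩

/-- Half of the logarithmic budget goes to each of the two parts of the quantization; the error of the
finite-dimensional part is negligible. -/
theorem exists_modified_product_quantization_rate {T ρ r : ℝ} (hT : 0 < T) (hρ : 0 < ρ)
    (hr : 0 < r) {n : ℕ} (hn : 2 * (n : ℝ) < ρ + 1 / 2) (hn1 : 1 ≤ n)
    (hn' : ρ ≤ 2 * (n : ℝ) + 3 / 2) :
    ∃ C : ℝ, ∀ᶠ N : ℕ in atTop, ∃ (p : ℕ) (L : Fin p → ℕ),
      IsLevelAllocation ⌊√(N : ℝ)⌋₊ L ∧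
      (∃ Xh, IsModifiedProductQuantization T ρ n hn r
        ⌊(N : ℝ) ^ (1 / (2 * (n : ℝ)))⌋₊ L Xh) ∧
      ∀ Xh, IsModifiedProductQuantization T ρ n hn r
          ⌊(N : ℝ) ^ (1 / (2 * (n : ℝ)))⌋₊ L Xh →
        IsQuantization N Xh ∧
        quantizationError gaussianSequence r (fun ω =>
            finiteDimensionalPart T ρ n hn ω + gaussianSeries (cosineRemainder T ρ n hn) ω) Xh
          ≤ ENNReal.ofReal (C * rlRate ρ N) := by
  have hh := gaussianSeriesConverges_cosineRemainder hT hρ hn hn'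
  obtain ⟨C₁, hC₁, h₁⟩ := exists_cosineRemainder_quantization_rate hT hρ hr hn hn'
  -- one bound for the moments of order `2r` of all the coefficients `η_m`
  obtain ⟨C₂, hC₂, h₂⟩ := exists_minimalQuantizationError_le gaussianSequence hr
    (B := ∑ m : Fin n, eLpNorm (boundaryCoefficient T m) (ENNReal.ofReal (2 * r)) gaussianSequence)
    (ENNReal.sum_ne_top.2 fun m _ =>
      (memLp_boundaryCoefficient hT m ENNReal.ofReal_ne_top).2.ne)
  set K : ℝ := ∑ m, ‖boundaryPath T ρ n hn m‖ with hK
  set D : ℝ≥0∞ := ENNReal.LpAddConst (ENNReal.ofReal r) *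
    (ENNReal.ofReal K * (n : ℝ≥0∞) ^ (1 + 1 / r) * ENNReal.ofReal (2 * C₂) +
      ENNReal.ofReal (C₁ * 4 ^ ρ)) with hD
  have hDtop : D ≠ ∞ := by
    refine ENNReal.mul_ne_top (ENNReal.LpAddConst_lt_top _).ne (ENNReal.add_ne_top.2
      ⟨ENNReal.mul_ne_top (ENNReal.mul_ne_top ENNReal.ofReal_ne_top
        (ENNReal.rpow_ne_top_of_nonneg (by positivity) (by simp))) ENNReal.ofReal_ne_top,
        ENNReal.ofReal_ne_top⟩)
  refine ⟨D.toReal, ?_⟩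
  filter_upwards [tendsto_floor_sqrt_natCast.eventually h₁, eventually_rlRate_floor_sqrt_le hρ,
    eventually_exists_inv_sqrt_le_rlRate hρ hn1] with N hN hrate ⟨k, hk1, hk2, hk⟩
  obtain ⟨p, L, hL, hex, herr⟩ := hN
  refine ⟨p, L, hL, exists_isModifiedProductQuantization hT hr (by omega) hex, fun Xh hX =>
    ⟨isQuantization_of_isModifiedProductQuantization ((Nat.mul_le_mul_left _ hL.2.2).trans
      (floor_rpow_pow_mul_floor_sqrt_le hn1 N)) hX, ?_⟩⟩
  refine (quantizationError_le_of_isModifiedProductQuantization hT hr hh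
    (ε := ENNReal.ofReal (2 * C₂) * ENNReal.ofReal (rlRate ρ N))
    (δ := ENNReal.ofReal (C₁ * 4 ^ ρ) * ENNReal.ofReal (rlRate ρ N)) (K := K)
    (fun m => Finset.single_le_sum (f := fun m => ‖boundaryPath T ρ n hn m‖)
      (fun _ _ => norm_nonneg _) (Finset.mem_univ m)) (fun m => ?_) (fun Zh hZ => ?_) hX).trans_eq ?_
  · refine (h₂ _ (hasLaw_boundaryCoefficient hT m).aemeasurable
      (Finset.single_le_sum (f := fun m : Fin n => eLpNorm (boundaryCoefficient T m)
        (ENNReal.ofReal (2 * r)) gaussianSequence) (fun _ _ => zero_le) (Finset.mem_univ m))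
      k _ hk1 hk2).trans ?_
    rw [← ENNReal.ofReal_mul (by positivity)]
    refine ENNReal.ofReal_le_ofReal ?_
    calc C₂ / √(k : ℝ) = C₂ * (1 / √(k : ℝ)) := by ring
      _ ≤ C₂ * (2 * rlRate ρ N) := mul_le_mul_of_nonneg_left hk hC₂
      _ = _ := by ring
  · refine (herr Zh hZ).trans ?_
    rw [← ENNReal.ofReal_mul (by positivity)]
    refine ENNReal.ofReal_le_ofReal ?_
    rw [mul_assoc]
    exact mul_le_mul_of_nonneg_left hrate hC₁
  · rw [ENNReal.ofReal_mul ENNReal.toReal_nonneg, ENNReal.ofReal_toReal hDtop, hD]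
    ring

theorem mainTheorem5 {Ω : Type*} [MeasurableSpace Ω] (P : Measure Ω) [IsProbabilityMeasure P]
    (W : ℝ≥0 → Ω → ℝ) (hW : IsBrownianReal W P)
    (T : ℝ) (hT : 0 < T) (ρ : ℝ) (hρ : 0 < ρ) (r : ℝ) (hr : 0 < r)
    (X : Ω → PathSpace T) (hX : IsRiemannLiouville P W ρ T X) :
    -- the cosine sequence is admissible for `X`
    IsAdmissible (cosineSequence T ρ hρ) (P.map X) ∧
    -- `0 < ρ ≤ 3/2`: the rate of `e^{(prod)}_{N,r}(X)`, and its attainment by product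
    -- quantizations with respect to the cosine sequence
    (ρ ≤ 3 / 2 →
      (∃ C : ℝ, ∀ᶠ N : ℕ in atTop,
        minimalProductQuantizationError N r (P.map X) ≤ ENNReal.ofReal (C * rlRate ρ N)) ∧
      (∃ C : ℝ, ∀ᶠ N : ℕ in atTop, ∃ (p : ℕ) (L : Fin p → ℕ), IsLevelAllocation N L ∧
        (∃ Xh, IsProductQuantization r (cosineSequence T ρ hρ) L Xh) ∧
        ∀ Xh, IsProductQuantization r (cosineSequence T ρ hρ) L Xh →
          quantizationError gaussianSequence r (gaussianSeries (cosineSequence T ρ hρ)) Xh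
            ≤ ENNReal.ofReal (C * rlRate ρ N))) ∧
    -- `ρ > 3/2`: here `n ≥ 1` is the integer with `2n - 1/2 < ρ ≤ 2n + 3/2`
    (∀ (n : ℕ) (hn : 2 * (n : ℝ) < ρ + 1 / 2), 1 ≤ n → ρ ≤ 2 * (n : ℝ) + 3 / 2 →
      -- the splitting `f_j = g_j + h_j`, `U = ∑ ξ_j g_j`, `Z = ∑ ξ_j h_j`, `X = U + Z` in law
      (∀ j, cosineSequence T ρ hρ j = cosineBoundary T ρ n hn j + cosineRemainder T ρ n hn j) ∧
      (∀ᵐ ω ∂gaussianSequence,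
        Tendsto (fun k => ∑ j ∈ Finset.range k, ω j • cosineBoundary T ρ n hn j) atTop
          (𝓝 (finiteDimensionalPart T ρ n hn ω))) ∧
      GaussianSeriesConverges (cosineRemainder T ρ n hn) ∧
      gaussianSequence.map (fun ω =>
        finiteDimensionalPart T ρ n hn ω + gaussianSeries (cosineRemainder T ρ n hn) ω)
          = P.map X ∧
      -- the rate of the modified product `N`-quantization
      (∃ C : ℝ, ∀ᶠ N : ℕ in atTop, ∃ (p : ℕ) (L : Fin p → ℕ),
        IsLevelAllocation ⌊√(N : ℝ)⌋₊ L ∧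
        (∃ Xh, IsModifiedProductQuantization T ρ n hn r
          ⌊(N : ℝ) ^ (1 / (2 * (n : ℝ)))⌋₊ L Xh) ∧
        ∀ Xh, IsModifiedProductQuantization T ρ n hn r
            ⌊(N : ℝ) ^ (1 / (2 * (n : ℝ)))⌋₊ L Xh →
          IsQuantization N Xh ∧
          quantizationError gaussianSequence r (fun ω =>
              finiteDimensionalPart T ρ n hn ω + gaussianSeries (cosineRemainder T ρ n hn) ω) Xh
            ≤ ENNReal.ofReal (C * rlRate ρ N))) := by
  have hf := isAdmissible_cosineSequence hW.toIsPreBrownianReal hT hρ hX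
    (gaussianSeriesConverges_cosineSequence hT hρ)
  refine ⟨hf, fun hρ' => ?_, fun n hn hn1 hn' => ⟨cosineSequence_eq_add hT hρ hn,
    ae_tendsto_sum_cosineBoundary hT hn, gaussianSeriesConverges_cosineRemainder hT hρ hn hn', ?_,
    exists_modified_product_quantization_rate hT hρ hr hn hn1 hn'⟩⟩
  · -- without boundary terms, the remainder is the cosine sequence itself
    have hn : 2 * ((0 : ℕ) : ℝ) < ρ + 1 / 2 := by
      push_cast
      linarith
    obtain ⟨C, -, hC⟩ := exists_cosineRemainder_quantization_rate hT hρ hr hn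
      (by push_cast; linarith)
    rw [cosineRemainder_zero hρ hn] at hC
    refine ⟨⟨C, hC.mono fun N hN => ?_⟩, C, hC⟩
    obtain ⟨p, L, hL, ⟨Xh, hXh⟩, herr⟩ := hN
    refine le_trans (sInf_le ?_) (herr Xh hXh)
    exact ⟨_, hf, p, L, Xh, hL, hXh, rfl⟩
  · rw [← hf.2]
    exact (Measure.map_congr (gaussianSeries_cosineSequence_ae_eq hT hρ hn hn')).symm
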